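/- **Setting.** Let $\mathbb X$ be a complete separable metric space and $\mathbb A$ a non-empty compact metric space, with Borel $\sigma$-algebras; let $\Xi,\Lambda$ be the sets of Borel probability measures on $\mathbb X,\mathbb A$ (weak topology, Borel $\sigma$-algebra). $\mathbb X\times\mathbb A$ carries the sum metric, $B_b$ denotes bounded measurable functions, and $\|\mu-\nu\|_{BL}=\sup_h\frac12|\int h\,d\mu-\int h\,d\nu|$ over $1$-Lipschitz $h$ with $|h|\le1$; $\|\mu-\nu\|_{TV}$ is the same with all measurable $|h|\le 1$. A *modulus* is a nondecreasing subadditive $\beta:[0,\infty)\to[0,\infty)$ with $\beta(0+)=0$, and $\hat\beta$ is its least concave majorant ($\hat\beta=\beta$ if $\beta$ is concave). $\bar\delta(y)=\frac1N\sum_n\delta_{y^n}$ for $y\in\mathbb Y^N$. Let $T\ge1$, $\mathring\xi\in\Xi$, and let $P_t:\mathbb X\times\Xi\times\mathbb A\to\Xi$ be measurable, $1\le t<T$. Put $Q^\lambda_{t,x,\xi}=\int P_t(x,\xi,a)\lambda(da)$. For $1\le t<T$ and $N\ge1$ let $G^{N,\lambda^N}_t$ ($\lambda^N\in\Lambda^N$)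 map $B_b(\mathbb X^N)$ to itself and $\overline G^\lambda_{t,\xi}$ map $B_b(\mathbb X)$ to itself, with $(x,\lambda^N)\mapsto G_t^{N,\lambda^N}u(x)$ and $(x,\xi,\lambda)\mapsto\overline G^\lambda_{t,\xi}v(x)$ measurable. **Assumptions.** There are constants $C_0,C_1,\overline C>0$ and moduli $\eta,\zeta,\vartheta,\iota$ such that, for all $1\le t<T$, all $N\ge1$ and all arguments: 1. (Lyapunov) $K_1\subseteq K_2\subseteq\cdots$ are compact in $\mathbb X$, and there is a continuous $\sigma:\mathbb X\to[0,\infty)$ with $\sigma\ge i$ off $K_i$, $\int\sigma\,d\mathring\xi\le1$ and $\int\sigma\,dP_t(x,\xi,a)\le\sigma(x)$. 2. (i) $G^{N,\lambda^N}_t,\overline G^\lambda_{t,\xi}$ are nondecreasing; (ii) $\|G^{N,\lambda^N}_tu\|_\infty\le C_0+C_1\|u\|_\infty$ and $\|\overline G^\lambda_{t,\xi}v\|_\infty\le C_0+C_1\|v\|_\infty$; (iii) $|G^{N,\lambda^N}_tu(x)-G^{N,\lambda^N}_t\hat u(x)|\le\overline C\int|u-\hat u|\,d\bigotimes_nQ^{\lambda^n}_{t,x^n,\bar\delta(x)}$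 and $|\overline G^\lambda_{t,\xi}v(x)-\overline G^\lambda_{t,\xi}\hat v(x)|\le\overline C\int|v-\hat v|\,dQ^\lambda_{t,x,\xi}$; (iv) if $u$ is invariant under permutations of the coordinates $2,\dots,N$, then $G^{N,\lambda^N}_tu(x)=G^{N,\phi\lambda^N}_tu(\phi x)$ for each such permutation $\phi$; (v) if $u(x)=v(x^1)$, then $G^{N,\lambda^N}_tu(x)=\overline G^{\lambda^1}_{t,\bar\delta(x)}v(x^1)$; (vi) $\overline G^{\gamma\lambda+(1-\gamma)\lambda'}_{t,\xi}v\le\gamma\overline G^\lambda_{t,\xi}v+(1-\gamma)\overline G^{\lambda'}_{t,\xi}v$ for $\gamma\in(0,1)$. 3. $\|P_t(x,\xi,a)-P_t(x,\xi',a')\|_{TV}\le\eta(d(a,a'))+\eta(\|\xi-\xi'\|_{BL})$. 4. $\|G^{N,\lambda^N}_tu-G^{N,\hat\lambda^N}_tu\|_\infty\le(C_0+C_1\|u\|_\infty)\zeta(\|\lambda^1-\hat\lambda^1\|_{BL})$ whenever $\lambda^n=\hat\lambda^n$ for $n\ge2$, and $\|\overline G^\lambda_{t,\xi}v-\overline G^{\lambda'}_{t,\xi'}v\|_\infty\le(C_0+C_1\|v\|_\infty)(\zeta(\|\xi-\xi'\|_{BL})+\zeta(\|\lambda-\lambda'\|_{BL}))$.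 5. $V\in B_b(\mathbb X\times\Xi)$ satisfies $|V(x,\xi)-V(x,\xi')|\le\iota(\|\xi-\xi'\|_{BL})$, and $U^N(x)=V(x^1,\bar\delta(x))$ on $\mathbb X^N$. **$N$-player game.** Player $n$ uses measurable $\tilde\pi^n_t:\mathbb X\times\Xi\to\Lambda$, $1\le t<T$, which are *$\vartheta$-symmetrically continuous*: $\|\tilde\pi^n_t(x,\xi)-\tilde\pi^n_t(x,\xi')\|_{BL}\le\vartheta(\|\xi-\xi'\|_{BL})$. Let $\mathfrak T^N_tf$ be the expectation of $f(x_t)$ when $x_1\sim\mathring\xi^{\otimes N}$ and, given $x_t=x$, $x_{t+1}\sim\bigotimes_nQ^{\tilde\pi^n_t(x^n,\bar\delta(x))}_{t,x^n,\bar\delta(x)}$. With $\lambda^n=\tilde\pi^n_t(x^n,\bar\delta(x))$ put $S_tu(x)=G^{N,(\lambda^1,\dots,\lambda^N)}_tu(x)$, $S^*_tu(x)=\inf_{\lambda\in\Lambda}G^{N,(\lambda,\lambda^2,\dots,\lambda^N)}_tu(x)$, and $S^*_{t,T}=S^*_t\circ\cdots\circ S^*_{T-1}$ (identity if $t=T$).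 The stepwise regret of player $1$ is $$\mathfrak R^N_1=\sum_{t=1}^{T-1}\overline C^{\,t}\,\mathfrak T^N_t\big(S_tS^*_{t+1,T}U^N-S^*_{t,T}U^N\big),$$ and $\mathfrak R^N_n$ is the regret of player $1$ after the players' policies are reordered as $(n,1,\dots,n-1,n+1,\dots,N)$. **Mean field flow.** Put $\mu^n_1=\mathring\xi$, $\bar\xi^N_t=\frac1N\sum_n\mu^n_t$, $\mu^n_{t+1}=\int Q^{\tilde\pi^n_t(x,\bar\xi^N_t)}_{t,x,\bar\xi^N_t}\mu^n_t(dx)$, $\bar\psi^N_t(dx\,da)=\frac1N\sum_n\tilde\pi^n_t(x,\bar\xi^N_t)(da)\,\mu^n_t(dx)$ and $\overline{\mathfrak M}^N=(\bar\psi^N_1,\dots,\bar\psi^N_{T-1})$. In general $\mathfrak M=(\psi_1,\dots,\psi_{T-1})$ with $\mathbb X$-marginals $\xi_{\psi_t}$ is a *mean field flow* if $\xi_{\psi_1}=\mathring\xi$ and $\xi_{\psi_{t+1}}=\int P_t(y,\xi_{\psi_t},a)\psi_t(dy\,da)$ for $t\le T-2$. Let $\bar\pi_{\psi}$ be the conditional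 law of the action given the state under $\psi$, $\overline S^{\bar\pi_{\psi_t}}_tv(x)=\overline G^{\bar\pi_{\psi_t}(x)}_{t,\xi_{\psi_t}}v(x)$, $\overline S^*_tv(x)=\inf_\lambda\overline G^\lambda_{t,\xi_{\psi_t}}v(x)$, $\overline S^*_{t,T}=\overline S^*_t\circ\cdots\circ\overline S^*_{T-1}$, $V_{\mathfrak M}(x)=V(x,\int P_{T-1}(y,\xi_{\psi_{T-1}},a)\psi_{T-1}(dy\,da))$ and $$\overline{\mathfrak R}(\mathfrak M;V)=\sum_{t=1}^{T-1}\overline C^{\,t}\,\overline{\mathfrak T}_t\big(\overline S_t^{\bar\pi_{\psi_t}}\overline S^*_{t+1,T}V_{\mathfrak M}-\overline S^*_{t,T}V_{\mathfrak M}\big),$$ where $\overline{\mathfrak T}_th$ is the expectation of $h(x_t)$ for the Markov chain with $x_1\sim\mathring\xi$ and transitions $Q^{\bar\pi_{\psi_t}(x)}_{t,x,\xi_{\psi_t}}$ (so $\overline{\mathfrak T}_th=\int h\,d\xi_{\psi_t}$ if $\mathfrak M$ is a mean field flow). **Error terms.** For compact sets $\mathcal K=(\mathcal K_i)$ let $\mathfrak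 n_j(\mathcal K_i)$ be the least number of open sup-norm balls of radius $1/j$ covering the set $C_{BL}(\mathcal K_i)$ of $1$-Lipschitz functions on $\mathcal K_i$ bounded by $1$, with centres in that set, and $\mathfrak r_{\mathcal K}(N)=\inf_{i,j\ge1}\{j^{-1}+i^{-1}+\sqrt\pi\,\mathfrak n_j(\mathcal K_i)/\sqrt{2N}\}$. Write $\mathfrak K=(K_i)$, $\mathfrak K\times\mathbb A=(K_i\times\mathbb A)$. Put $\mathfrak e_1(N)=\mathfrak r_{\mathfrak K}(N)$ and, for $2\le t\le T$, $$\mathfrak e_t(N)=2\inf_{L>1+\eta(2/L)}\Big\{\sum_{r=1}^{t-1}\big(L\hat\vartheta(\mathfrak e_r(N))+\hat\eta(\mathfrak e_r(N))\big)+(t-1)\eta(2/L)\Big\}+\frac tN+\mathfrak r_{\mathfrak K}(N).$$ With $\mathfrak C_r=C_0\sum_{k=1}^rC_1^{k-1}+C_1^r\|V\|_\infty$ and $B_t(N)=\sum_{r=t}^{T-1}\overline C^{\,r-t}\mathfrak C_{T-r}\hat\zeta(\mathfrak e_r(N))+\overline C^{\,T-t}\hat\iota(\mathfrak e_T(N))$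 put $$\mathfrak E(N)=2\sum_{t=1}^{T-1}\overline C^{\,t}(T+1-t)B_t(N)+\overline C^{\,T}\hat\iota(\mathfrak e_T(N))+\sum_{t=1}^{T-1}\overline C^{\,t}\mathfrak C_{T-t}\big(\hat\zeta(\hat\vartheta(\mathfrak e_t(N)))+\hat\zeta(\mathfrak e_t(N))+\mathfrak e_t(N)\big).$$ **Theorem.** Under these assumptions, as $N\to\infty$: $\mathfrak e_t(N)\to0$ for $1\le t\le T$, $2\hat\vartheta(\mathfrak e_t(N))+\frac32\mathfrak e_t(N)+\mathfrak r_{\mathfrak K\times\mathbb A}(N)-\mathfrak r_{\mathfrak K}(N)\to0$ for $1\le t<T$, and $\mathfrak E(N)\to0$. For every $N\ge2$ and all $\vartheta$-symmetrically continuous policies $(\tilde\pi^n_t)$ of the $N$ players, $\overline{\mathfrak M}^N$ is a mean field flow, and: (a) for $1\le t<T$, with $\breve e^N_t(x)=\int_{\mathbb A^N}\big\|\bar\delta\big((x^n,a^n)_{n\le N}\big)-\bar\psi^N_t\big\|_{BL}\,\bigotimes_n\tilde\pi^n_t(x^n,\bar\delta(x))(da)$, $$\mathfrak T^N_t\breve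 e^N_t\le2\hat\vartheta(\mathfrak e_t(N))+\tfrac32\mathfrak e_t(N)+\mathfrak r_{\mathfrak K\times\mathbb A}(N)-\mathfrak r_{\mathfrak K}(N);$$ (b) $\overline{\mathfrak R}(\overline{\mathfrak M}^N;V)\le\frac1N\sum_{n=1}^N\mathfrak R^N_n+\mathfrak E(N)$; (c) if equality holds in 2(vi), then $\big|\overline{\mathfrak R}(\overline{\mathfrak M}^N;V)-\frac1N\sum_{n=1}^N\mathfrak R^N_n\big|\le\mathfrak E(N)$. -/

import Mathlib

open MeasureTheory ProbabilityTheory Filter Topology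
open scoped ENNReal NNReal

noncomputable section

namespace MFG

/-! ### Moduli of continuity, sup norms, distances between probability measures -/

/-- A subadditive modulus of continuity. Only the values on `[0, ∞)` matter; subadditivity and the
limit at `0` force the values of a `[0, ∞]`-valued modulus to be finite there. -/
structure IsModulus (β : ℝ → ℝ) : Prop where
  nonneg : ∀ s, 0 ≤ s → 0 ≤ β s
  mono : ∀ s r, 0 ≤ s → s ≤ r → β s ≤ β r
  subadd : ∀ s r, 0 ≤ s → 0 ≤ r → β (s + r) ≤ β s + β r
  tendsto_zero : Tendsto β (𝓝[>] 0) (𝓝 0)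

/-- The least concave majorant of a modulus on `[0, ∞)`: the infimum of the affine majorants
(their slopes and intercepts are automatically nonnegative). It is `β` itself if `β` is concave. -/
def hull (β : ℝ → ℝ) (l : ℝ) : ℝ :=
  sInf {y | ∃ a b : ℝ, 0 ≤ a ∧ 0 ≤ b ∧ (∀ s, 0 ≤ s → β s ≤ a * s + b) ∧ y = a * l + b}

/-- The sup norm of a bounded function. -/
def supNorm {Y : Type*} (f : Y → ℝ) : ℝ := ⨆ y, |f y|

/-- `f ∈ B_b(Y)`: bounded and measurable. -/
def IsBb {Y : Type*} [MeasurableSpace Y] (f : Y → ℝ) : Prop :=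
  Measurable f ∧ ∃ C : ℝ, ∀ y, |f y| ≤ C

/-- Functions bounded by `1` that are `1`-Lipschitz for the distance `d`. -/
def IsBL {Y : Type*} (d : Y → Y → ℝ) (h : Y → ℝ) : Prop :=
  (∀ y, |h y| ≤ 1) ∧ ∀ y z, |h y - h z| ≤ d y z

/-- The bounded-Lipschitz distance (with the factor `1 / 2`) for the distance `d` on `Y`. -/
def blDist {Y : Type*} [MeasurableSpace Y] (d : Y → Y → ℝ) (μ ν : ProbabilityMeasure Y) : ℝ :=
  sSup {r | ∃ h : Y → ℝ, IsBL d h ∧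
    r = 1 / 2 * |∫ y, h y ∂(μ : Measure Y) - ∫ y, h y ∂(ν : Measure Y)|}

/-- The total-variation distance (with the factor `1 / 2`). -/
def tvDist {Y : Type*} [MeasurableSpace Y] (μ ν : ProbabilityMeasure Y) : ℝ :=
  sSup {r | ∃ h : Y → ℝ, Measurable h ∧ (∀ y, |h y| ≤ 1) ∧
    r = 1 / 2 * |∫ y, h y ∂(μ : Measure Y) - ∫ y, h y ∂(ν : Measure Y)|}

/-- The sum metric on a product of two metric spaces. -/
def sumDist {X A : Type*} [MetricSpace X] [MetricSpace A] (p q : X × A) : ℝ :=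
  dist p.1 q.1 + dist p.2 q.2

/-! ### The rate of convergence of empirical measures -/

/-- The smallest number of open sup-norm balls of radius `1 / j`, with centres in `C_BL(S)`,
that cover `C_BL(S)`. -/
def coverNum {Y : Type*} (d : Y → Y → ℝ) (S : Set Y) (j : ℕ) : ℕ :=
  sInf {n | ∃ c : Fin n → (S → ℝ), (∀ k, IsBL (fun y z : S => d y z) (c k)) ∧
    ∀ h : S → ℝ, IsBL (fun y z : S => d y z) h → ∃ k, supNorm (fun y => h y - c k y) < 1 / (j : ℝ)}

/-- The rate attached to a sequence of compact sets `K 1 ⊆ K 2 ⊆ ...`. -/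
def rate {Y : Type*} (d : Y → Y → ℝ) (K : ℕ → Set Y) (N : ℕ) : ℝ :=
  sInf {r | ∃ i j : ℕ, 1 ≤ i ∧ 1 ≤ j ∧
    r = 1 / (j : ℝ) + 1 / (i : ℝ) + √Real.pi * (coverNum d (K i) j : ℝ) / √(2 * (N : ℝ))}

/-! ### Operations on probability measures -/

/-- The average of finitely many probability measures. -/
def avg {Y : Type*} [MeasurableSpace Y] {N : ℕ} [NeZero N] (μ : Fin N → ProbabilityMeasure Y) :
    ProbabilityMeasure Y :=
  ⟨(N : ℝ≥0∞)⁻¹ • ∑ n, (μ n : Measure Y), ⟨by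
    have h : (N : ℝ≥0∞) ≠ 0 := by exact_mod_cast NeZero.ne N
    simp [ENNReal.inv_mul_cancel h]⟩⟩

/-- The empirical measure of a tuple. -/
def emp {Y : Type*} [MeasurableSpace Y] {N : ℕ} [NeZero N] (y : Fin N → Y) :
    ProbabilityMeasure Y :=
  avg fun n => ⟨Measure.dirac (y n), inferInstance⟩

/-- The mixture `∫ κ(a) μ(da)`. -/
def mix {Y Z : Type*} [MeasurableSpace Y] [MeasurableSpace Z] (μ : ProbabilityMeasure Y)
    (κ : {κ : Y → ProbabilityMeasure Z // Measurable κ}) : ProbabilityMeasure Z :=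
  ⟨(μ : Measure Y).bind fun y => (κ.1 y : Measure Z),
    isProbabilityMeasure_bind (measurable_subtype_coe.comp κ.2).aemeasurable
      (Eventually.of_forall fun y => (κ.1 y).2)⟩

/-- The joint law on `Y × Z` of `y ∼ μ` and `z ∼ κ(y)`. -/
def joint {Y Z : Type*} [MeasurableSpace Y] [MeasurableSpace Z] (μ : ProbabilityMeasure Y)
    (κ : {κ : Y → ProbabilityMeasure Z // Measurable κ}) : ProbabilityMeasure (Y × Z) :=
  haveI : IsMarkovKernel
      (⟨fun y => (κ.1 y : Measure Z), measurable_subtype_coe.comp κ.2⟩ : Kernel Y Z) :=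
    ⟨fun y => (κ.1 y).2⟩
  ⟨(μ : Measure Y) ⊗ₘ
    (⟨fun y => (κ.1 y : Measure Z), measurable_subtype_coe.comp κ.2⟩ : Kernel Y Z), inferInstance⟩

/-- The convex combination `γ μ + (1 - γ) ν`. -/
def convComb {Y : Type*} [MeasurableSpace Y] (γ : Set.Icc (0 : ℝ) 1)
    (μ ν : ProbabilityMeasure Y) : ProbabilityMeasure Y :=
  ⟨ENNReal.ofReal γ • (μ : Measure Y) + ENNReal.ofReal (1 - γ) • (ν : Measure Y), ⟨by
    have h1 : (0 : ℝ) ≤ γ := γ.2.1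
    have h2 : (0 : ℝ) ≤ 1 - γ := sub_nonneg.2 γ.2.2
    simp [← ENNReal.ofReal_add h1 h2]⟩⟩

theorem measurable_emp {Y : Type*} [MeasurableSpace Y] {N : ℕ} [NeZero N] :
    Measurable (emp : (Fin N → Y) → ProbabilityMeasure Y) := by
  refine Measurable.subtype_mk (Measure.measurable_of_measurable_coe _ fun s hs => ?_)
  simp only [Measure.smul_apply, Measure.coe_finsetSum, Finset.sum_apply, smul_eq_mul]
  refine Measurable.const_mul (Finset.measurable_fun_sum _ fun n _ => ?_) _
  exact (Measure.measurable_coe hs).comp (Measure.measurable_dirac.comp (measurable_pi_apply n))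

/-! ### The game -/

/-- `compose op s k = op s ∘ op (s + 1) ∘ ⋯ ∘ op (s + k - 1)` (the identity if `k = 0`). -/
def compose {F : Type*} (op : ℕ → F → F) : ℕ → ℕ → F → F
  | _, 0 => id
  | s, k + 1 => fun f => op s (compose op (s + 1) k f)

/-- The data of the controlled dynamics and of the score operators: the horizon `T`, the initial
law `ξ₀`, the transition kernels `P t`, the operators `GN N t λ` acting on functions on `X ^ N`
that score player `1` (the index `0 : Fin N`), and the mean field operators `G t ξ λ`, with the
standing measurability conditions. Times run over `1, ..., T - 1`; other indices are dummies. -/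
structure Game (X A : Type*) [MeasurableSpace X] [MeasurableSpace A] where
  T : ℕ
  ξ₀ : ProbabilityMeasure X
  P : ℕ → X × ProbabilityMeasure X × A → ProbabilityMeasure X
  measurable_P : ∀ t, Measurable (P t)
  GN : (N : ℕ) → ℕ → (Fin N → ProbabilityMeasure A) → ((Fin N → X) → ℝ) → (Fin N → X) → ℝ
  measurable_GN : ∀ (N : ℕ) (t : ℕ) (u : (Fin N → X) → ℝ), 1 ≤ t → t < T → IsBb u →
    Measurable fun p : (Fin N → X) × (Fin N → ProbabilityMeasure A) => GN N t p.2 u p.1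
  G : ℕ → ProbabilityMeasure X → ProbabilityMeasure A → (X → ℝ) → X → ℝ
  measurable_G : ∀ (t : ℕ) (v : X → ℝ), 1 ≤ t → t < T → IsBb v →
    Measurable fun p : X × ProbabilityMeasure X × ProbabilityMeasure A => G t p.2.1 p.2.2 v p.1

/-- Markovian action kernels (elements of `Π`). -/
abbrev ActionKernel (X A : Type*) [MeasurableSpace X] [MeasurableSpace A] (N : ℕ) :=
  {π : (Fin N → X) → ProbabilityMeasure A // Measurable π}

/-- Symmetric Markovian action kernels. -/
abbrev SymKernel (X A : Type*) [MeasurableSpace X] [MeasurableSpace A] :=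
  {π : X × ProbabilityMeasure X → ProbabilityMeasure A // Measurable π}

/-- A symmetric kernel used by player `n`, as a Markovian action kernel. -/
def SymKernel.toAction {X A : Type*} [MeasurableSpace X] [MeasurableSpace A] {N : ℕ} [NeZero N]
    (π : SymKernel X A) (n : Fin N) : ActionKernel X A N :=
  ⟨fun x => π.1 (x n, emp x), π.2.comp ((measurable_pi_apply n).prodMk measurable_emp)⟩

/-- A symmetric kernel with frozen population distribution. -/
def SymKernel.freeze {X A : Type*} [MeasurableSpace X] [MeasurableSpace A]
    (π : SymKernel X A) (ξ : ProbabilityMeasure X) :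
    {κ : X → ProbabilityMeasure A // Measurable κ} :=
  ⟨fun x => π.1 (x, ξ), π.2.comp (measurable_id.prodMk measurable_const)⟩

/-- A policy profile of symmetric kernels, as a profile of Markovian policies. -/
def toProfile {X A : Type*} [MeasurableSpace X] [MeasurableSpace A] {N : ℕ} [NeZero N]
    (p : Fin N → ℕ → SymKernel X A) : Fin N → ℕ → ActionKernel X A N :=
  fun n t => (p n t).toAction n

/-- The state marginal `ξ_ψ` of a state-action distribution `ψ`. -/
def marg {X A : Type*} [MeasurableSpace X] [MeasurableSpace A] (ψ : ProbabilityMeasure (X × A)) :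
    ProbabilityMeasure X :=
  ψ.map measurable_fst.aemeasurable

/-- The action kernel induced by `ψ` (the regular conditional law of the action given the state),
as a symmetric kernel that ignores the population distribution. -/
def induced {X A : Type*} [MeasurableSpace X] [MeasurableSpace A] [StandardBorelSpace A]
    [Nonempty A] (ψ : ProbabilityMeasure (X × A)) : SymKernel X A :=
  ⟨fun p => ⟨(ψ : Measure (X × A)).condKernel p.1, inferInstance⟩,
    ((ψ : Measure (X × A)).condKernel.measurable.comp measurable_fst).subtype_mk⟩

namespace Game

variable {X A : Type*} [MeasurableSpace X] [MeasurableSpace A] (Γ : Game X A)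

/-- `Q t x ξ λ = ∫ P_t(x, ξ, a) λ(da)`. -/
def Q (t : ℕ) (x : X) (ξ : ProbabilityMeasure X) (l : ProbabilityMeasure A) :
    ProbabilityMeasure X :=
  mix l ⟨fun a => Γ.P t (x, ξ, a), (Γ.measurable_P t).comp
    (measurable_const.prodMk (measurable_const.prodMk measurable_id))⟩

theorem measurable_Q (t : ℕ) (ξ : ProbabilityMeasure X)
    (κ : {κ : X → ProbabilityMeasure A // Measurable κ}) :
    Measurable fun x => Γ.Q t x ξ (κ.1 x) := by
  refine Measurable.subtype_mk (Measure.measurable_of_measurable_coe _ fun s hs => ?_)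
  have hP : Measurable fun p : X × A => (Γ.P t (p.1, ξ, p.2) : Measure X) s :=
    (Measure.measurable_coe hs).comp (measurable_subtype_coe.comp ((Γ.measurable_P t).comp
      (measurable_fst.prodMk (measurable_const.prodMk measurable_snd))))
  have h : ∀ x, ((κ.1 x : Measure A).bind fun a => (Γ.P t (x, ξ, a) : Measure X)) s
      = ∫⁻ a, (Γ.P t (x, ξ, a) : Measure X) s ∂(κ.1 x : Measure A) := fun x =>
    Measure.bind_apply hs (measurable_subtype_coe.comp ((Γ.measurable_P t).comp
      (measurable_const.prodMk (measurable_const.prodMk measurable_id)))).aemeasurable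
  simp only [h]
  have : IsMarkovKernel
      (⟨fun y => (κ.1 y : Measure A), measurable_subtype_coe.comp κ.2⟩ : Kernel X A) :=
    ⟨fun y => (κ.1 y).2⟩
  exact Measurable.lintegral_kernel_prod_right' (κ :=
    (⟨fun y => (κ.1 y : Measure A), measurable_subtype_coe.comp κ.2⟩ : Kernel X A)) hP

/-! #### Transition operators -/

/-- The one-step transition operator of the `N`-player game. -/
def stepT {N : ℕ} [NeZero N] (t : ℕ) (π : Fin N → ActionKernel X A N)
    (f : (Fin N → X) → ℝ) (x : Fin N → X) : ℝ :=
  ∫ y, f y ∂Measure.pi fun n => (Γ.Q t (x n) (emp x) ((π n).1 x) : Measure X)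

/-- The expectation of `f(x_t)` in the `N`-player game started from `ξ₀ ⊗ ⋯ ⊗ ξ₀`. -/
def lawT {N : ℕ} [NeZero N] (p : Fin N → ℕ → ActionKernel X A N) (t : ℕ)
    (f : (Fin N → X) → ℝ) : ℝ :=
  ∫ y, compose (fun s => Γ.stepT s fun n => p n s) 1 (t - 1) f y
    ∂Measure.pi fun _ : Fin N => (Γ.ξ₀ : Measure X)

/-- The one-step mean field transition operator. -/
def meanT (t : ℕ) (ξ : ProbabilityMeasure X) (π : SymKernel X A) (h : X → ℝ) (x : X) : ℝ :=
  ∫ y, h y ∂(Γ.Q t x ξ (π.1 (x, ξ)) : Measure X)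

/-- The mean field expectation at time `t` under the policy `p` and the flow `ξ 1, ξ 2, ...`. -/
def meanLawT (p : ℕ → SymKernel X A) (ξ : ℕ → ProbabilityMeasure X) (t : ℕ) (h : X → ℝ) : ℝ :=
  ∫ y, compose (fun s => Γ.meanT s (ξ s) (p s)) 1 (t - 1) h y ∂(Γ.ξ₀ : Measure X)

/-! #### Score operators and regrets -/

/-- The score operator of player `1`. -/
def S {N : ℕ} (t : ℕ) (π : Fin N → ActionKernel X A N) (u : (Fin N → X) → ℝ)
    (x : Fin N → X) : ℝ :=
  Γ.GN N t (fun n => (π n).1 x) u x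

/-- The Bellman operator of player `1` against the other players' kernels. -/
def Sstar {N : ℕ} [NeZero N] (t : ℕ) (π : Fin N → ActionKernel X A N) (u : (Fin N → X) → ℝ)
    (x : Fin N → X) : ℝ :=
  ⨅ l : ProbabilityMeasure A, Γ.GN N t (Function.update (fun n => (π n).1 x) 0 l) u x

/-- The iterated Bellman operator from time `T` down to time `s`. -/
def Sstars {N : ℕ} [NeZero N] (p : Fin N → ℕ → ActionKernel X A N) (s : ℕ) :
    ((Fin N → X) → ℝ) → (Fin N → X) → ℝ :=
  compose (fun r => Γ.Sstar r fun n => p n r) s (Γ.T - s)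

/-- The stepwise regret of player `1`. -/
def regret {N : ℕ} [NeZero N] (Cb : ℝ) (p : Fin N → ℕ → ActionKernel X A N)
    (U : (Fin N → X) → ℝ) : ℝ :=
  ∑ t ∈ Finset.Ico 1 Γ.T, Cb ^ t * Γ.lawT p t fun x =>
    Γ.S t (fun n => p n t) (Γ.Sstars p (t + 1) U) x - Γ.Sstars p t U x

/-- The stepwise regret of player `n`, all players using symmetric policies: the regret of player
`1` after the relabelling `(z¹, …, z^N) ↦ (zⁿ, z¹, …, z^{n-1}, z^{n+1}, …, z^N)`. -/
def regretOf {N : ℕ} [NeZero N] (Cb : ℝ) (p : Fin N → ℕ → SymKernel X A)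
    (U : (Fin N → X) → ℝ) (n : Fin N) : ℝ :=
  Γ.regret Cb (toProfile fun k => p ((Fin.cycleRange n).symm k)) U

/-- The mean field score operator. -/
def meanS (t : ℕ) (ξ : ProbabilityMeasure X) (π : SymKernel X A) (v : X → ℝ) (x : X) : ℝ :=
  Γ.G t ξ (π.1 (x, ξ)) v x

/-- The mean field Bellman operator. -/
def meanSstar (t : ℕ) (ξ : ProbabilityMeasure X) (v : X → ℝ) (x : X) : ℝ :=
  ⨅ l : ProbabilityMeasure A, Γ.G t ξ l v x

/-- The iterated mean field Bellman operator from time `T` down to time `s`. -/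
def meanSstars (ξ : ℕ → ProbabilityMeasure X) (s : ℕ) : (X → ℝ) → X → ℝ :=
  compose (fun r => Γ.meanSstar r (ξ r)) s (Γ.T - s)

/-- The next state distribution `∫ P_t(y, ξ_ψ, a)(·) ψ(dy da)`. -/
def next (t : ℕ) (ψ : ProbabilityMeasure (X × A)) : ProbabilityMeasure X :=
  mix ψ ⟨fun p => Γ.P t (p.1, marg ψ, p.2), (Γ.measurable_P t).comp
    (measurable_fst.prodMk (measurable_const.prodMk measurable_snd))⟩

/-- `(M 1, ..., M (T - 1))` is a mean field flow. -/
def IsMeanFieldFlow (M : ℕ → ProbabilityMeasure (X × A)) : Prop :=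
  marg (M 1) = Γ.ξ₀ ∧ ∀ t, 1 ≤ t → t + 1 < Γ.T → marg (M (t + 1)) = Γ.next t (M t)

/-- The terminal condition `V_M`. -/
def terminal (M : ℕ → ProbabilityMeasure (X × A)) (V : X × ProbabilityMeasure X → ℝ) : X → ℝ :=
  fun x => V (x, Γ.next (Γ.T - 1) (M (Γ.T - 1)))

/-- The stepwise mean field regret. -/
def meanRegret [StandardBorelSpace A] [Nonempty A] (Cb : ℝ)
    (M : ℕ → ProbabilityMeasure (X × A)) (V : X × ProbabilityMeasure X → ℝ) : ℝ :=
  ∑ t ∈ Finset.Ico 1 Γ.T, Cb ^ t *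
    Γ.meanLawT (fun s => induced (M s)) (fun s => marg (M s)) t fun x =>
      Γ.meanS t (marg (M t)) (induced (M t))
          (Γ.meanSstars (fun s => marg (M s)) (t + 1) (Γ.terminal M V)) x
        - Γ.meanSstars (fun s => marg (M s)) t (Γ.terminal M V) x

/-! #### The mean field flow built from the `N`-player game -/

/-- The law at time `t` of a representative of player `n` that moves by the symmetric policy
`p n`, the population distribution being frozen, at each time, at the average over all `n` of
these laws. (The value at time `0` is a dummy.) -/
def playerLaw {N : ℕ} [NeZero N] (p : Fin N → ℕ → SymKernel X A) :
    ℕ → Fin N → ProbabilityMeasure X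
  | 0 => fun _ => Γ.ξ₀
  | 1 => fun _ => Γ.ξ₀
  | t + 2 => fun n =>
    let ξ := avg (playerLaw p (t + 1))
    mix (playerLaw p (t + 1) n)
      ⟨fun x => Γ.Q (t + 1) x ξ (((p n (t + 1)).freeze ξ).1 x),
        Γ.measurable_Q (t + 1) ξ ((p n (t + 1)).freeze ξ)⟩

/-- The mean field state distribution at time `t`. -/
def xiBar {N : ℕ} [NeZero N] (p : Fin N → ℕ → SymKernel X A) (t : ℕ) : ProbabilityMeasure X :=
  avg (Γ.playerLaw p t)

/-- The mean field state-action distribution at time `t`. -/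
def psiBar {N : ℕ} [NeZero N] (p : Fin N → ℕ → SymKernel X A) (t : ℕ) :
    ProbabilityMeasure (X × A) :=
  avg fun n => joint (Γ.playerLaw p t n) ((p n t).freeze (Γ.xiBar p t))

/-- Given the states `x`, the expected bounded-Lipschitz distance (for the sum metric) between the
empirical state-action measure and the mean field state-action distribution at time `t`. -/
def empError {X A : Type*} [MetricSpace X] [MetricSpace A] [MeasurableSpace X] [MeasurableSpace A]
    (Γ : Game X A) {N : ℕ} [NeZero N] (p : Fin N → ℕ → SymKernel X A) (t : ℕ)
    (x : Fin N → X) : ℝ :=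
  ∫ a : Fin N → A, blDist sumDist (emp fun n => (x n, a n)) (Γ.psiBar p t)
    ∂Measure.pi fun n => ((p n t).1 (x n, emp x) : Measure A)

end Game

/-! ### Assumptions -/

section Assumptions

variable {X A : Type*} [MetricSpace X] [MetricSpace A] [MeasurableSpace X] [MeasurableSpace A]

/-- The Lyapunov-type tightness condition. -/
def Game.MomentTight (Γ : Game X A) (K : ℕ → Set X) : Prop :=
  Monotone K ∧ (∀ i, IsCompact (K i)) ∧
  ∃ σ : X → ℝ, Continuous σ ∧ (∀ x, 0 ≤ σ x) ∧
    (∀ i : ℕ, ∀ x, x ∉ K i → (i : ℝ) ≤ σ x) ∧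
    ∫⁻ y, ENNReal.ofReal (σ y) ∂(Γ.ξ₀ : Measure X) ≤ 1 ∧
    ∀ t, 1 ≤ t → t < Γ.T → ∀ x ξ a,
      ∫⁻ y, ENNReal.ofReal (σ y) ∂(Γ.P t (x, ξ, a) : Measure X) ≤ ENNReal.ofReal (σ x)

/-- The structural assumptions on the score operators. -/
structure Game.GBasic (Γ : Game X A) (C₀ C₁ Cb : ℝ) : Prop where
  mono_GN : ∀ (N : ℕ) [NeZero N] (t : ℕ), 1 ≤ t → t < Γ.T → ∀ l u u', IsBb u → IsBb u' →
    (∀ x, u x ≤ u' x) → ∀ x, Γ.GN N t l u x ≤ Γ.GN N t l u' x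
  mono_G : ∀ t, 1 ≤ t → t < Γ.T → ∀ ξ l v v', IsBb v → IsBb v' →
    (∀ x, v x ≤ v' x) → ∀ x, Γ.G t ξ l v x ≤ Γ.G t ξ l v' x
  bound_GN : ∀ (N : ℕ) [NeZero N] (t : ℕ), 1 ≤ t → t < Γ.T → ∀ l u, IsBb u →
    ∀ x, |Γ.GN N t l u x| ≤ C₀ + C₁ * supNorm u
  bound_G : ∀ t, 1 ≤ t → t < Γ.T → ∀ ξ l v, IsBb v → ∀ x, |Γ.G t ξ l v x| ≤ C₀ + C₁ * supNorm v
  lip_GN : ∀ (N : ℕ) [NeZero N] (t : ℕ), 1 ≤ t → t < Γ.T → ∀ l u u', IsBb u → IsBb u' → ∀ x,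
    |Γ.GN N t l u x - Γ.GN N t l u' x| ≤
      Cb * ∫ y, |u y - u' y| ∂Measure.pi fun n => (Γ.Q t (x n) (emp x) (l n) : Measure X)
  lip_G : ∀ t, 1 ≤ t → t < Γ.T → ∀ ξ l v v', IsBb v → IsBb v' → ∀ x,
    |Γ.G t ξ l v x - Γ.G t ξ l v' x| ≤ Cb * ∫ y, |v y - v' y| ∂(Γ.Q t x ξ l : Measure X)
  symm_GN : ∀ (N : ℕ) [NeZero N] (t : ℕ), 1 ≤ t → t < Γ.T → ∀ u, IsBb u →
    (∀ φ : Equiv.Perm (Fin N), φ 0 = 0 → ∀ x, u (x ∘ φ) = u x) →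
    ∀ φ : Equiv.Perm (Fin N), φ 0 = 0 → ∀ l x, Γ.GN N t l u x = Γ.GN N t (l ∘ φ) u (x ∘ φ)
  compat : ∀ (N : ℕ) [NeZero N] (t : ℕ), 1 ≤ t → t < Γ.T → ∀ v, IsBb v → ∀ l x,
    Γ.GN N t l (fun y => v (y 0)) x = Γ.G t (emp x) (l 0) v (x 0)
  convex : ∀ t, 1 ≤ t → t < Γ.T → ∀ ξ (γ : Set.Icc (0 : ℝ) 1) l l' v, IsBb v → ∀ x,
    Γ.G t ξ (convComb γ l l') v x ≤ γ * Γ.G t ξ l v x + (1 - γ) * Γ.G t ξ l' v x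

/-- Equality in the convexity condition. -/
def Game.AffineInAction (Γ : Game X A) : Prop :=
  ∀ t, 1 ≤ t → t < Γ.T → ∀ ξ (γ : Set.Icc (0 : ℝ) 1) l l' v, IsBb v → ∀ x,
    Γ.G t ξ (convComb γ l l') v x = γ * Γ.G t ξ l v x + (1 - γ) * Γ.G t ξ l' v x

/-- Total-variation continuity of the transition kernel in the population and the action. -/
def Game.PCont (Γ : Game X A) (η : ℝ → ℝ) : Prop :=
  ∀ t, 1 ≤ t → t < Γ.T → ∀ x ξ ξ' a a',
    tvDist (Γ.P t (x, ξ, a)) (Γ.P t (x, ξ', a')) ≤ η (dist a a') + η (blDist dist ξ ξ')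

/-- Continuity of the score operators: in the first player's action law for the `N`-player
operators, in the population and the action law for the mean field operators. -/
structure Game.GCont (Γ : Game X A) (C₀ C₁ : ℝ) (ζ : ℝ → ℝ) : Prop where
  cont_GN : ∀ (N : ℕ) [NeZero N] (t : ℕ), 1 ≤ t → t < Γ.T →
    ∀ (l : Fin N → ProbabilityMeasure A) (l₁ : ProbabilityMeasure A) u, IsBb u → ∀ x,
    |Γ.GN N t l u x - Γ.GN N t (Function.update l 0 l₁) u x| ≤
      (C₀ + C₁ * supNorm u) * ζ (blDist dist (l 0) l₁)
  cont_G : ∀ t, 1 ≤ t → t < Γ.T → ∀ ξ ξ' l l' v, IsBb v → ∀ x,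
    |Γ.G t ξ l v x - Γ.G t ξ' l' v x| ≤
      (C₀ + C₁ * supNorm v) * (ζ (blDist dist ξ ξ') + ζ (blDist dist l l'))

/-- A profile of `ϑ`-symmetrically continuous policies, over the times `1, ..., T - 1`. -/
def SymContProfile (T : ℕ) (ϑ : ℝ → ℝ) {N : ℕ} (p : Fin N → ℕ → SymKernel X A) : Prop :=
  ∀ n t, 1 ≤ t → t < T → ∀ x ξ ξ',
    blDist dist ((p n t).1 (x, ξ)) ((p n t).1 (x, ξ')) ≤ ϑ (blDist dist ξ ξ')

/-- An `ι`-symmetrically continuous terminal cost. -/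
def SymCont (ι : ℝ → ℝ) (V : X × ProbabilityMeasure X → ℝ) : Prop :=
  ∀ x ξ ξ', |V (x, ξ) - V (x, ξ')| ≤ ι (blDist dist ξ ξ')

end Assumptions

/-! ### Error terms -/

/-- The error `e_t` of the empirical state distribution at time `t`, where `r` is the rate at the
number `N` of players. -/
def errE (η ϑ : ℝ → ℝ) (N : ℕ) (r : ℝ) (t : ℕ) : ℝ :=
  if t ≤ 1 then r else
    2 * sInf {y | ∃ L : ℝ, 0 < L ∧ 1 + η (2 / L) < L ∧
      y = ∑ s ∈ (Finset.Ico 1 t).attach,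
            (L * hull ϑ (errE η ϑ N r s.1) + hull η (errE η ϑ N r s.1))
          + ((t : ℝ) - 1) * η (2 / L)}
      + (t : ℝ) / (N : ℝ) + r
  termination_by t
  decreasing_by all_goals exact (Finset.mem_Ico.1 s.2).2

/-- `C₀ ∑_{k = 1}^{r} C₁^{k - 1} + C₁^r z`. -/
def growth (C₀ C₁ : ℝ) (r : ℕ) (z : ℝ) : ℝ :=
  C₀ * ∑ k ∈ Finset.range r, C₁ ^ k + C₁ ^ r * z

/-- The error of the value functions at time `t`; `e r` is the error of the empirical state
distribution at time `r`, and `M` the sup norm of the terminal cost. -/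
def errB (T : ℕ) (C₀ C₁ Cb M : ℝ) (ζ ι : ℝ → ℝ) (e : ℕ → ℝ) (t : ℕ) : ℝ :=
  ∑ r ∈ Finset.Ico t T, Cb ^ (r - t) * growth C₀ C₁ (T - r) M * hull ζ (e r)
    + Cb ^ (T - t) * hull ι (e T)

/-- The error of the regrets. -/
def errRegret (T : ℕ) (C₀ C₁ Cb M : ℝ) (ζ ϑ ι : ℝ → ℝ) (e : ℕ → ℝ) : ℝ :=
  2 * ∑ t ∈ Finset.Ico 1 T, Cb ^ t * ((T : ℝ) + 1 - t) * errB T C₀ C₁ Cb M ζ ι e t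
    + Cb ^ T * hull ι (e T)
    + ∑ t ∈ Finset.Ico 1 T, Cb ^ t * growth C₀ C₁ (T - t) M *
        (hull ζ (hull ϑ (e t)) + hull ζ (e t) + e t)

/-- The error of the empirical state-action distribution, where `rX` and `rXA` are the rates for
the state space and for the state-action space, and `e` the error of the empirical state
distribution. -/
def errEmp (ϑ : ℝ → ℝ) (rX rXA e : ℝ) : ℝ :=
  2 * hull ϑ e + 3 / 2 * e + rXA - rX

section ErrorTerms

variable {X A : Type*} [MetricSpace X] [MetricSpace A] [MeasurableSpace X] [MeasurableSpace A]

/-- The error of the empirical state distribution at time `t` in the `N`-player game. -/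
def stateErr (η ϑ : ℝ → ℝ) (K : ℕ → Set X) (N t : ℕ) : ℝ :=
  errE η ϑ N (rate dist K N) t

/-- The error of the empirical state-action distribution at time `t` in the `N`-player game. -/
def stateActionErr (A : Type*) [MetricSpace A] (η ϑ : ℝ → ℝ) (K : ℕ → Set X) (N t : ℕ) : ℝ :=
  errEmp ϑ (rate dist K N) (rate sumDist (fun i => K i ×ˢ (Set.univ : Set A)) N)
    (stateErr η ϑ K N t)

/-- The error of the regrets in the `N`-player game. -/
def regretErr (T : ℕ) (C₀ C₁ Cb M : ℝ) (η ζ ϑ ι : ℝ → ℝ) (K : ℕ → Set X) (N : ℕ) : ℝ :=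
  errRegret T C₀ C₁ Cb M ζ ϑ ι (stateErr η ϑ K N)

/-- The terminal cost `x ↦ V(x¹, δ̄(x))` of the `N`-player game. -/
def terminalN {N : ℕ} [NeZero N] (V : X × ProbabilityMeasure X → ℝ) (x : Fin N → X) : ℝ :=
  V (x 0, emp x)

end ErrorTerms

end MFG

end

/-!
The mean field distribution `xiBar p t` is the average of the laws of `N` representatives, which
move independently of each other because the population is frozen at `xiBar`. Everything rests on
comparing the `N`-player game with this independent system.

*Comparison.* One step of the game differs from one step of the independent system only through the
argument `emp x` in place of `xiBar` in the transitions and the policies. The transitions are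
continuous in total variation; inf-convolution (`half_abs_integral_sub_le_of_modulus`) turns this
into an estimate for action laws that are close in the bounded-Lipschitz distance, at the cost of a
slope `L` and an error `η (2 / L)`. Functions with bounded differences (`BddDiff`) are preserved by
the independent transitions, and an error in total variation of each coordinate is weighted by the
differences, so errors do not accumulate in the number of players. In the independent system the
empirical measure is close to its mean by a variance bound for each member of a finite net of test
functions (`integral_blDist_emp_avg_le`). Induction on time gives `stateErr`, with Jensen's
inequality for the concave hulls of the moduli.

*Deviations.* The value of player `1` in the game involves infima over action laws at later times,
so the empirical measure has to be controlled for every behaviour of player `1`. Instead of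
selecting near-optimal deviations measurably, the bounds are carried by functions of the states
that decrease in mean for every action law of player `1` (`IsSupersolution`, `devBound_empDev`); a
deviation of one player changes a function with differences `1 / N` by at most `1 / N`. These
supersolutions dominate the difference of the values of player `1` in the game and in the mean
field problem (`integral_abs_value_sub_le`), and the regret of each player is close to a mean field
regret of its own policy against the frozen flow (`abs_regret_sub_le`, `abs_regretOf_sub_le`).

*Averaging over the players.* Given a state `x`, the action law of the mean field is the average of
the players' action laws over the conditional law, given `x`, of the label of a randomly chosen
player (`labelLaw`). Convexity of the scores therefore gives `integral_induced_le`: the regret of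
the mean field flow is at most the average of the mean field regrets of the players, with equality
in the affine case.
-/

open MeasureTheory ProbabilityTheory Filter Topology
open scoped ENNReal NNReal

namespace MFG

/-! ### Moduli and their concave hulls -/

/-- The affine function `s ↦ a * s + b` has nonnegative coefficients and dominates `β` on
`[0, ∞)`; these are the competitors in the definition of `hull β`. -/
structure IsMajorant (β : ℝ → ℝ) (a b : ℝ) : Prop where
  slope_nonneg : 0 ≤ a
  const_nonneg : 0 ≤ b
  le : ∀ s, 0 ≤ s → β s ≤ a * s + b

theorem IsModulus.zero {β : ℝ → ℝ} (hβ : IsModulus β) : β 0 = 0 := by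
  refine le_antisymm ?_ (hβ.nonneg 0 le_rfl)
  refine ge_of_tendsto hβ.tendsto_zero ?_
  filter_upwards [self_mem_nhdsWithin] with s hs
  exact hβ.mono 0 s le_rfl (le_of_lt hs)

/-- A subadditive modulus has affine majorants with arbitrarily small intercept. -/
theorem IsModulus.exists_majorant {β : ℝ → ℝ} (hβ : IsModulus β) {ε : ℝ} (hε : 0 < ε) :
    ∃ a, IsMajorant β a ε := by
  have h := (hβ.tendsto_zero.eventually (gt_mem_nhds hε)).and self_mem_nhdsWithin
  obtain ⟨δ, hδ, hδ0⟩ := h.exists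
  have hδ0 : 0 < δ := hδ0
  refine ⟨2 * β δ / δ, by have := hβ.nonneg δ hδ0.le; positivity, hε.le, fun s hs => ?_⟩
  have hβδ := hβ.nonneg δ hδ0.le
  rcases le_total s δ with h | h
  · have h1 := hβ.mono s δ hs h
    have : 0 ≤ 2 * β δ / δ * s := by positivity
    linarith
  · -- `β s ≤ (k + 1) β δ` for `k = ⌊s / δ⌋`, and `k + 1 ≤ 2 s / δ`
    have hn : ∀ k : ℕ, β (k * δ) ≤ k * β δ := by
      intro k
      induction k with
      | zero => simp [hβ.zero]
      | succ k ih =>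
        have := hβ.subadd (k * δ) δ (by positivity) hδ0.le
        push_cast
        rw [add_mul, one_mul]
        linarith
    have h1 : s ≤ (⌊s / δ⌋₊ + 1 : ℕ) * δ := by
      have := (Nat.lt_floor_add_one (s / δ)).le
      push_cast
      rwa [div_le_iff₀ hδ0] at this
    have h2 : ((⌊s / δ⌋₊ + 1 : ℕ) : ℝ) ≤ 2 * (s / δ) := by
      have h3 := Nat.floor_le (div_nonneg hs hδ0.le)
      have h4 : 1 ≤ s / δ := by rwa [le_div_iff₀ hδ0, one_mul]
      push_cast
      linarith
    calc β s ≤ (⌊s / δ⌋₊ + 1 : ℕ) * β δ := (hβ.mono _ _ hs h1).trans (hn _)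
      _ ≤ 2 * (s / δ) * β δ := by gcongr
      _ = 2 * β δ / δ * s := by ring
      _ ≤ _ := by linarith

theorem hull_le {β : ℝ → ℝ} {a b l : ℝ} (h : IsMajorant β a b) (hl : 0 ≤ l) :
    hull β l ≤ a * l + b := by
  refine csInf_le ⟨0, ?_⟩ ⟨a, b, h.1, h.2, h.3, rfl⟩
  rintro y ⟨a, b, ha, hb, -, rfl⟩
  positivity

theorem hull_nonneg {β : ℝ → ℝ} {l : ℝ} (hl : 0 ≤ l) : 0 ≤ hull β l := by
  refine Real.sInf_nonneg ?_
  rintro y ⟨a, b, ha, hb, -, rfl⟩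
  positivity

theorem IsModulus.le_hull {β : ℝ → ℝ} (hβ : IsModulus β) {y l : ℝ}
    (h : ∀ a b, IsMajorant β a b → y ≤ a * l + b) : y ≤ hull β l := by
  obtain ⟨a, ha⟩ := hβ.exists_majorant one_pos
  refine le_csInf ⟨_, a, 1, ha.1, ha.2, ha.3, rfl⟩ ?_
  rintro y ⟨a, b, h1, h2, h3, rfl⟩
  exact h a b ⟨h1, h2, h3⟩

theorem IsModulus.exists_majorant_lt {β : ℝ → ℝ} (hβ : IsModulus β) {l z : ℝ}
    (h : hull β l < z) : ∃ a b, IsMajorant β a b ∧ a * l + b < z := by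
  by_contra! hc
  exact absurd (hβ.le_hull hc) (not_le.2 h)

theorem IsModulus.tendsto_hull {β : ℝ → ℝ} (hβ : IsModulus β) {α : Type*} {F : Filter α}
    {e : α → ℝ} (he : Tendsto e F (𝓝 0)) (h0 : ∀ n, 0 ≤ e n) :
    Tendsto (fun n => hull β (e n)) F (𝓝 0) := by
  refine tendsto_order.2 ⟨fun y hy => Eventually.of_forall fun n => hy.trans_le
    (hull_nonneg (h0 n)), fun y hy => ?_⟩
  obtain ⟨a, ha⟩ := hβ.exists_majorant (half_pos hy)
  have h1 : Tendsto (fun n => a * e n + y / 2) F (𝓝 (a * 0 + y / 2)) :=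
    (he.const_mul a).add_const _
  filter_upwards [h1.eventually (gt_mem_nhds (show a * 0 + y / 2 < y by linarith))] with n hn
  exact (hull_le ha (h0 n)).trans_lt hn

/-! ### The error terms and their limits -/

theorem rate_nonneg {Y : Type*} (d : Y → Y → ℝ) (K : ℕ → Set Y) (N : ℕ) : 0 ≤ rate d K N := by
  refine Real.sInf_nonneg ?_
  rintro y ⟨i, j, -, -, rfl⟩
  positivity

theorem tendsto_rate {Y : Type*} (d : Y → Y → ℝ) (K : ℕ → Set Y) :
    Tendsto (rate d K) atTop (𝓝 0) := by
  refine tendsto_order.2 ⟨fun y hy => Eventually.of_forall fun n => hy.trans_le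
    (rate_nonneg d K n), fun y hy => ?_⟩
  obtain ⟨i, hi⟩ := exists_nat_one_div_lt (show 0 < y / 3 by linarith)
  have h1 : Tendsto (fun N : ℕ => √Real.pi * (coverNum d (K (i + 1)) (i + 1) : ℝ) / √(2 * (N : ℝ)))
      atTop (𝓝 0) := by
    refine Tendsto.const_div_atTop ?_ _
    exact Real.tendsto_sqrt_atTop.comp
      (tendsto_natCast_atTop_atTop.const_mul_atTop (by norm_num : (0 : ℝ) < 2))
  filter_upwards [h1.eventually (gt_mem_nhds (show 0 < y / 3 by linarith))] with N hN
  refine lt_of_le_of_lt (csInf_le ⟨0, ?_⟩ ⟨i + 1, i + 1, by omega, by omega, rfl⟩) ?_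
  · rintro y ⟨i, j, -, -, rfl⟩
    positivity
  · push_cast at hi ⊢
    linarith

/-- The infimum in the definition of `errE`: the error caused by replacing the empirical state
distributions by the mean field ones at the times before `t`. -/
noncomputable def drift (η ϑ : ℝ → ℝ) (e : ℕ → ℝ) (t : ℕ) : ℝ :=
  sInf {y | ∃ L : ℝ, 0 < L ∧ 1 + η (2 / L) < L ∧
    y = ∑ s ∈ Finset.Ico 1 t, (L * hull ϑ (e s) + hull η (e s)) + ((t : ℝ) - 1) * η (2 / L)}

theorem errE_one (η ϑ : ℝ → ℝ) (N : ℕ) (r : ℝ) : errE η ϑ N r 1 = r := by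
  rw [errE]; simp

theorem errE_eq (η ϑ : ℝ → ℝ) (N : ℕ) (r : ℝ) {t : ℕ} (ht : 2 ≤ t) :
    errE η ϑ N r t = 2 * drift η ϑ (errE η ϑ N r) t + (t : ℝ) / N + r := by
  rw [errE, if_neg (by omega), drift]
  have h (L : ℝ) := Finset.sum_attach (Finset.Ico 1 t)
    fun s => L * hull ϑ (errE η ϑ N r s) + hull η (errE η ϑ N r s)
  simp only [h]

section Drift

variable {η ϑ : ℝ → ℝ} (hη : IsModulus η) (hϑ : IsModulus ϑ) {e : ℕ → ℝ} {t : ℕ}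
include hη

/-- The admissible set of slopes in the definition of `errE` is not empty. -/
theorem exists_slope {ε : ℝ} (hε : 0 < ε) : ∃ L : ℝ, 0 < L ∧ 1 + η (2 / L) < L ∧ η (2 / L) < ε := by
  have h1 : Tendsto (fun L : ℝ => 2 / L) atTop (𝓝[>] 0) :=
    tendsto_nhdsWithin_iff.2 ⟨tendsto_const_nhds.div_atTop tendsto_id, by
      filter_upwards [eventually_gt_atTop 0] with L hL
      exact div_pos two_pos hL⟩
  have h2 := hη.tendsto_zero.comp h1
  obtain ⟨L, hL1, hL2, hL3⟩ := ((h2.eventually (gt_mem_nhds (lt_min one_pos hε))).and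
    ((eventually_gt_atTop 2).and (eventually_gt_atTop 0))).exists
  have hL1' := lt_min_iff.1 hL1
  simp only [Function.comp] at hL1'
  exact ⟨L, hL3, by linarith [hL1'.1], hL1'.2⟩

theorem drift_summand_nonneg (he : ∀ s, 1 ≤ s → 0 ≤ e s) (ht : 1 ≤ t) {L : ℝ} (hL : 0 < L) :
    0 ≤ ∑ s ∈ Finset.Ico 1 t, (L * hull ϑ (e s) + hull η (e s)) + ((t : ℝ) - 1) * η (2 / L) := by
  have h1 : (0 : ℝ) ≤ (t : ℝ) - 1 := by
    have : (1 : ℝ) ≤ t := by exact_mod_cast ht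
    linarith
  have h2 := hη.nonneg (2 / L) (by positivity)
  refine add_nonneg (Finset.sum_nonneg fun s hs => ?_) (by positivity)
  have hs := (Finset.mem_Ico.1 hs).1
  have := hull_nonneg (β := ϑ) (he s hs)
  have := hull_nonneg (β := η) (he s hs)
  positivity

theorem drift_nonneg (he : ∀ s, 1 ≤ s → 0 ≤ e s) (ht : 1 ≤ t) : 0 ≤ drift η ϑ e t := by
  refine Real.sInf_nonneg ?_
  rintro y ⟨L, hL, -, rfl⟩
  exact drift_summand_nonneg hη he ht hL

theorem drift_le (he : ∀ s, 1 ≤ s → 0 ≤ e s) (ht : 1 ≤ t) {L : ℝ} (hL : 0 < L)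
    (hL' : 1 + η (2 / L) < L) : drift η ϑ e t ≤
      ∑ s ∈ Finset.Ico 1 t, (L * hull ϑ (e s) + hull η (e s)) + ((t : ℝ) - 1) * η (2 / L) := by
  refine csInf_le ⟨0, ?_⟩ ⟨L, hL, hL', rfl⟩
  rintro y ⟨L, hL, -, rfl⟩
  exact drift_summand_nonneg hη he ht hL

theorem le_drift {y : ℝ} (h : ∀ L : ℝ, 0 < L → 1 + η (2 / L) < L → y ≤
      ∑ s ∈ Finset.Ico 1 t, (L * hull ϑ (e s) + hull η (e s)) + ((t : ℝ) - 1) * η (2 / L)) :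
    y ≤ drift η ϑ e t := by
  obtain ⟨L, h1, h2, -⟩ := exists_slope hη one_pos
  refine le_csInf ⟨_, L, h1, h2, rfl⟩ ?_
  rintro y ⟨L, h1, h2, rfl⟩
  exact h L h1 h2

theorem exists_drift_lt {z : ℝ} (h : drift η ϑ e t < z) : ∃ L : ℝ, 0 < L ∧ 1 + η (2 / L) < L ∧
    ∑ s ∈ Finset.Ico 1 t, (L * hull ϑ (e s) + hull η (e s)) + ((t : ℝ) - 1) * η (2 / L) < z := by
  by_contra! hc
  exact absurd (le_drift hη hc) (not_le.2 h)

theorem errE_nonneg (N : ℕ) {r : ℝ} (hr : 0 ≤ r) : ∀ t, 1 ≤ t → 0 ≤ errE η ϑ N r t := by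
  intro t
  induction t using Nat.strong_induction_on with
  | _ t ih =>
    intro ht
    rcases ht.eq_or_lt with rfl | ht
    · rwa [errE_one]
    · rw [errE_eq _ _ _ _ ht]
      have : 0 ≤ drift η ϑ (errE η ϑ N r) t := by
        refine Real.sInf_nonneg ?_
        rintro y ⟨L, hL, -, rfl⟩
        have h1 : (0 : ℝ) ≤ (t : ℝ) - 1 := by
          have : (1 : ℝ) ≤ t := by exact_mod_cast ht.le
          linarith
        have h2 := hη.nonneg (2 / L) (by positivity)
        refine add_nonneg (Finset.sum_nonneg fun s hs => ?_) (by positivity)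
        have hs := Finset.mem_Ico.1 hs
        have := hull_nonneg (β := ϑ) (ih s hs.2 hs.1)
        have := hull_nonneg (β := η) (ih s hs.2 hs.1)
        positivity
      positivity

include hϑ

theorem tendsto_drift {e : ℕ → ℕ → ℝ} (he : ∀ N s, 1 ≤ s → 0 ≤ e N s) (ht : 1 ≤ t)
    (h : ∀ s, 1 ≤ s → s < t → Tendsto (fun N => e N s) atTop (𝓝 0)) :
    Tendsto (fun N => drift η ϑ (e N) t) atTop (𝓝 0) := by
  refine tendsto_order.2 ⟨fun y hy => Eventually.of_forall fun n => hy.trans_le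
    (drift_nonneg hη (he n) ht), fun y hy => ?_⟩
  have ht' : (1 : ℝ) ≤ t := by exact_mod_cast ht
  obtain ⟨L, hL1, hL2, hL3⟩ := exists_slope hη (show 0 < y / t by positivity)
  -- the hulls are only known to be small where `e N s ≥ 0`, hence the `max`
  have h1 : Tendsto (fun N => ∑ s ∈ Finset.Ico 1 t, (L * hull ϑ (max (e N s) 0)
      + hull η (max (e N s) 0)) + ((t : ℝ) - 1) * η (2 / L)) atTop
      (𝓝 (∑ s ∈ Finset.Ico 1 t, (L * 0 + 0) + ((t : ℝ) - 1) * η (2 / L))) := by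
    refine Tendsto.add_const _ (tendsto_finsetSum _ fun s hs => ?_)
    have hs := Finset.mem_Ico.1 hs
    have h2 : Tendsto (fun N => max (e N s) 0) atTop (𝓝 0) := by
      simpa using (h s hs.1 hs.2).max (tendsto_const_nhds (x := (0 : ℝ)))
    exact ((hϑ.tendsto_hull h2 fun n => le_max_right _ _).const_mul L).add
      (hη.tendsto_hull h2 fun n => le_max_right _ _)
  have h3 : ∑ s ∈ Finset.Ico 1 t, (L * 0 + 0) + ((t : ℝ) - 1) * η (2 / L) < y := by
    rw [lt_div_iff₀ (by positivity)] at hL3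
    have := hη.nonneg (2 / L) (by positivity)
    simp only [mul_zero, add_zero, Finset.sum_const_zero, zero_add]
    nlinarith
  filter_upwards [h1.eventually (gt_mem_nhds h3)] with N hN
  refine (drift_le hη (he N) ht hL1 hL2).trans_lt (lt_of_eq_of_lt ?_ hN)
  congr 1
  refine Finset.sum_congr rfl fun s hs => ?_
  rw [max_eq_left (he N s (Finset.mem_Ico.1 hs).1)]

theorem tendsto_errE {r : ℕ → ℝ} (hr0 : ∀ N, 0 ≤ r N) (hr : Tendsto r atTop (𝓝 0)) :
    ∀ t, 1 ≤ t → Tendsto (fun N => errE η ϑ N (r N) t) atTop (𝓝 0) := by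
  intro t
  induction t using Nat.strong_induction_on with
  | _ t ih =>
    intro ht
    rcases ht.eq_or_lt with rfl | ht
    · simpa only [errE_one] using hr
    · simp only [errE_eq _ _ _ _ ht]
      have h1 := tendsto_drift hη hϑ (e := fun N => errE η ϑ N (r N)) (t := t)
        (fun N => errE_nonneg hη N (hr0 N)) ht.le fun s h1 h2 => ih s h2 h1
      have h2 : Tendsto (fun N : ℕ => (t : ℝ) / N) atTop (𝓝 0) :=
        tendsto_const_nhds.div_atTop tendsto_natCast_atTop_atTop
      simpa using ((h1.const_mul 2).add h2).add hr

end Drift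

section StateErr

variable {X : Type*} [MetricSpace X] {η ϑ : ℝ → ℝ} {K : ℕ → Set X}

theorem stateErr_nonneg (hη : IsModulus η) (N : ℕ) {t : ℕ} (ht : 1 ≤ t) :
    0 ≤ stateErr η ϑ K N t :=
  errE_nonneg hη N (rate_nonneg _ _ _) t ht

theorem tendsto_stateErr (hη : IsModulus η) (hϑ : IsModulus ϑ) {t : ℕ} (ht : 1 ≤ t) :
    Tendsto (fun N => stateErr η ϑ K N t) atTop (𝓝 0) :=
  tendsto_errE hη hϑ (fun _ => rate_nonneg _ _ _) (tendsto_rate _ _) t ht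

/-- The hull at an error term vanishes in the limit, although the error term is a genuine
nonnegative number only for times `t ≥ 1`. -/
theorem tendsto_hull_stateErr {β : ℝ → ℝ} (hβ : IsModulus β) (hη : IsModulus η)
    (hϑ : IsModulus ϑ) {t : ℕ} (ht : 1 ≤ t) :
    Tendsto (fun N => hull β (stateErr η ϑ K N t)) atTop (𝓝 0) :=
  hβ.tendsto_hull (tendsto_stateErr hη hϑ ht) fun N => stateErr_nonneg hη N ht

theorem tendsto_stateActionErr (A : Type*) [MetricSpace A] (hη : IsModulus η) (hϑ : IsModulus ϑ)
    {t : ℕ} (ht : 1 ≤ t) : Tendsto (fun N => stateActionErr A η ϑ K N t) atTop (𝓝 0) := by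
  have h := ((((tendsto_hull_stateErr (K := K) hϑ hη hϑ ht).const_mul 2).add
    ((tendsto_stateErr (K := K) hη hϑ ht).const_mul (3 / 2))).add (tendsto_rate sumDist
      fun i => K i ×ˢ (Set.univ : Set A))).sub (tendsto_rate dist K)
  simpa [stateActionErr, errEmp] using h

theorem tendsto_errB {ζ ι : ℝ → ℝ} (hη : IsModulus η) (hϑ : IsModulus ϑ) (hζ : IsModulus ζ)
    (hι : IsModulus ι) {T : ℕ} (C₀ C₁ Cb M : ℝ) {t : ℕ} (ht : 1 ≤ t) (hT : 1 ≤ T) :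
    Tendsto (fun N => errB T C₀ C₁ Cb M ζ ι (stateErr η ϑ K N) t) atTop (𝓝 0) := by
  have h1 : Tendsto (fun N => ∑ r ∈ Finset.Ico t T, Cb ^ (r - t) * growth C₀ C₁ (T - r) M *
      hull ζ (stateErr η ϑ K N r)) atTop (𝓝 (∑ r ∈ Finset.Ico t T, 0)) := by
    refine tendsto_finsetSum _ fun r hr => ?_
    simpa using (tendsto_hull_stateErr (K := K) hζ hη hϑ
      (ht.trans (Finset.mem_Ico.1 hr).1)).const_mul (Cb ^ (r - t) * growth C₀ C₁ (T - r) M)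
  simpa [errB] using h1.add ((tendsto_hull_stateErr (K := K) hι hη hϑ hT).const_mul (Cb ^ (T - t)))

theorem tendsto_regretErr {ζ ι : ℝ → ℝ} (hη : IsModulus η) (hϑ : IsModulus ϑ) (hζ : IsModulus ζ)
    (hι : IsModulus ι) {T : ℕ} (C₀ C₁ Cb M : ℝ) (hT : 1 ≤ T) :
    Tendsto (fun N => regretErr T C₀ C₁ Cb M η ζ ϑ ι K N) atTop (𝓝 0) := by
  have h1 : Tendsto (fun N => ∑ t ∈ Finset.Ico 1 T, Cb ^ t * ((T : ℝ) + 1 - t) *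
      errB T C₀ C₁ Cb M ζ ι (stateErr η ϑ K N) t) atTop (𝓝 (∑ t ∈ Finset.Ico 1 T, 0)) := by
    refine tendsto_finsetSum _ fun t ht => ?_
    simpa using (tendsto_errB (K := K) hη hϑ hζ hι C₀ C₁ Cb M (Finset.mem_Ico.1 ht).1
      hT).const_mul (Cb ^ t * ((T : ℝ) + 1 - t))
  have h2 : Tendsto (fun N => ∑ t ∈ Finset.Ico 1 T, Cb ^ t * growth C₀ C₁ (T - t) M *
      (hull ζ (hull ϑ (stateErr η ϑ K N t)) + hull ζ (stateErr η ϑ K N t) + stateErr η ϑ K N t))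
      atTop (𝓝 (∑ t ∈ Finset.Ico 1 T, 0)) := by
    refine tendsto_finsetSum _ fun t ht => ?_
    have ht := (Finset.mem_Ico.1 ht).1
    have h3 := hζ.tendsto_hull (tendsto_hull_stateErr (K := K) hϑ hη hϑ ht) fun N =>
      hull_nonneg (stateErr_nonneg hη N ht)
    simpa using ((h3.add (tendsto_hull_stateErr (K := K) hζ hη hϑ ht)).add
      (tendsto_stateErr (K := K) hη hϑ ht)).const_mul (Cb ^ t * growth C₀ C₁ (T - t) M)
  simpa [regretErr, errRegret] using
    ((h1.const_mul 2).add ((tendsto_hull_stateErr (K := K) hι hη hϑ hT).const_mul (Cb ^ T))).add h2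

end StateErr

/-! ### Bounded measurable functions -/

section IsBb

variable {Y Z : Type*} [MeasurableSpace Y] [MeasurableSpace Z] {f g : Y → ℝ}

theorem isBb_const (c : ℝ) : IsBb fun _ : Y => c := ⟨measurable_const, |c|, fun _ => le_rfl⟩

theorem IsBb.add (hf : IsBb f) (hg : IsBb g) : IsBb fun y => f y + g y := by
  obtain ⟨hf, C, hC⟩ := hf
  obtain ⟨hg, D, hD⟩ := hg
  exact ⟨hf.add hg, C + D, fun y => (abs_add_le _ _).trans (add_le_add (hC y) (hD y))⟩

theorem IsBb.const_mul (c : ℝ) (hf : IsBb f) : IsBb fun y => c * f y := by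
  obtain ⟨hf, C, hC⟩ := hf
  refine ⟨hf.const_mul c, |c| * C, fun y => ?_⟩
  rw [abs_mul]
  exact mul_le_mul_of_nonneg_left (hC y) (abs_nonneg c)

theorem IsBb.sub (hf : IsBb f) (hg : IsBb g) : IsBb fun y => f y - g y := by
  simpa [sub_eq_add_neg] using hf.add (hg.const_mul (-1))

theorem IsBb.abs (hf : IsBb f) : IsBb fun y => |f y| := by
  obtain ⟨hf, C, hC⟩ := hf
  exact ⟨by fun_prop, C, fun y => by rw [abs_abs]; exact hC y⟩

theorem IsBb.comp (hf : IsBb f) {φ : Z → Y} (hφ : Measurable φ) : IsBb fun z => f (φ z) := by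
  obtain ⟨hf, C, hC⟩ := hf
  exact ⟨hf.comp hφ, C, fun z => hC _⟩

theorem isBb_finset_sum {ι : Type*} (s : Finset ι) {F : ι → Y → ℝ} (hF : ∀ i ∈ s, IsBb (F i)) :
    IsBb fun y => ∑ i ∈ s, F i y := by
  classical
  induction s using Finset.induction_on with
  | empty => simpa using isBb_const (Y := Y) 0
  | insert a s ha ih =>
    simp only [Finset.sum_insert ha]
    exact (hF a (Finset.mem_insert_self a s)).add
      (ih fun i hi => hF i (Finset.mem_insert_of_mem hi))

theorem IsBb.integrable (hf : IsBb f) (μ : Measure Y) [IsFiniteMeasure μ] : Integrable f μ := by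
  obtain ⟨hf, C, hC⟩ := hf
  exact Integrable.of_bound hf.aestronglyMeasurable C (Eventually.of_forall hC)

theorem abs_integral_le_of_bound {μ : Measure Y} [IsProbabilityMeasure μ] {C : ℝ}
    (h : ∀ y, |f y| ≤ C) : |∫ y, f y ∂μ| ≤ C := by
  simpa using norm_integral_le_of_norm_le_const (μ := μ) (f := f) (Eventually.of_forall h)

theorem IsBb.integral_kernel {f : Y × Z → ℝ} (hf : IsBb f) (κ : Kernel Y Z) [IsMarkovKernel κ] :
    IsBb fun y => ∫ z, f (y, z) ∂κ y := by
  obtain ⟨hf, C, hC⟩ := hf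
  exact ⟨hf.stronglyMeasurable.integral_kernel_prod_right'.measurable, C,
    fun y => abs_integral_le_of_bound fun z => hC _⟩

theorem integral_bind_kernel (μ : Measure Y) [IsProbabilityMeasure μ] (κ : Kernel Y Z)
    [IsMarkovKernel κ] {f : Z → ℝ} (hf : IsBb f) :
    ∫ z, f z ∂(μ.bind κ) = ∫ y, ∫ z, f z ∂κ y ∂μ := by
  rw [← Measure.snd_compProd, Measure.snd,
    integral_map measurable_snd.aemeasurable hf.1.aestronglyMeasurable]
  exact Measure.integral_compProd ((hf.comp measurable_snd).integrable _)

theorem IsBb.le_supNorm (hf : IsBb f) (y : Y) : |f y| ≤ supNorm f := by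
  obtain ⟨-, C, hC⟩ := hf
  exact le_ciSup (f := fun y => |f y|) ⟨C, by rintro _ ⟨y, rfl⟩; exact hC y⟩ y

theorem supNorm_nonneg {Y : Type*} (f : Y → ℝ) : 0 ≤ supNorm f :=
  Real.iSup_nonneg fun _ => abs_nonneg _

theorem supNorm_le {Y : Type*} {f : Y → ℝ} {C : ℝ} (hC : 0 ≤ C) (h : ∀ y, |f y| ≤ C) :
    supNorm f ≤ C := Real.iSup_le h hC

end IsBb

/-! ### Mixtures, averages and empirical measures -/

section Operations

variable {Y Z : Type*} [MeasurableSpace Y] [MeasurableSpace Z]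

/-- A measurable family of probability measures, as a Markov kernel. -/
def asKernel (κ : {κ : Y → ProbabilityMeasure Z // Measurable κ}) : Kernel Y Z :=
  ⟨fun y => (κ.1 y : Measure Z), measurable_subtype_coe.comp κ.2⟩

instance (κ : {κ : Y → ProbabilityMeasure Z // Measurable κ}) : IsMarkovKernel (asKernel κ) :=
  ⟨fun y => (κ.1 y).2⟩

theorem isBb_integral_family {f : Y × Z → ℝ} (hf : IsBb f) {κ : Y → ProbabilityMeasure Z}
    (hκ : Measurable κ) : IsBb fun y => ∫ z, f (y, z) ∂(κ y : Measure Z) :=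
  hf.integral_kernel (asKernel ⟨κ, hκ⟩)

theorem integral_mix (μ : ProbabilityMeasure Y) (κ : {κ : Y → ProbabilityMeasure Z // Measurable κ})
    {f : Z → ℝ} (hf : IsBb f) :
    ∫ z, f z ∂(mix μ κ : Measure Z) = ∫ y, ∫ z, f z ∂(κ.1 y : Measure Z) ∂(μ : Measure Y) :=
  integral_bind_kernel (μ : Measure Y) (asKernel κ) hf

theorem lintegral_mix (μ : ProbabilityMeasure Y)
    (κ : {κ : Y → ProbabilityMeasure Z // Measurable κ}) {f : Z → ℝ≥0∞} (hf : Measurable f) :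
    ∫⁻ z, f z ∂(mix μ κ : Measure Z) = ∫⁻ y, ∫⁻ z, f z ∂(κ.1 y : Measure Z) ∂(μ : Measure Y) :=
  Measure.lintegral_bind (measurable_subtype_coe.comp κ.2).aemeasurable hf.aemeasurable

theorem integral_joint (μ : ProbabilityMeasure Y)
    (κ : {κ : Y → ProbabilityMeasure Z // Measurable κ}) {f : Y × Z → ℝ} (hf : IsBb f) :
    ∫ p, f p ∂(joint μ κ : Measure (Y × Z)) =
      ∫ y, ∫ z, f (y, z) ∂(κ.1 y : Measure Z) ∂(μ : Measure Y) :=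
  Measure.integral_compProd (μ := (μ : Measure Y)) (κ := asKernel κ) (hf.integrable _)

variable {N : ℕ} [NeZero N]

theorem natCast_pos : (0 : ℝ) < N := by exact_mod_cast Nat.pos_of_ne_zero (NeZero.ne N)

theorem integral_avg (μ : Fin N → ProbabilityMeasure Y) {f : Y → ℝ} (hf : IsBb f) :
    ∫ y, f y ∂(avg μ : Measure Y) = 1 / (N : ℝ) * ∑ n, ∫ y, f y ∂(μ n : Measure Y) := by
  change ∫ y, f y ∂((N : ℝ≥0∞)⁻¹ • ∑ n, (μ n : Measure Y)) = _
  rw [integral_smul_measure, integral_finsetSum_measure fun n _ => hf.integrable _]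
  simp

theorem lintegral_avg (μ : Fin N → ProbabilityMeasure Y) (f : Y → ℝ≥0∞) :
    ∫⁻ y, f y ∂(avg μ : Measure Y) = (N : ℝ≥0∞)⁻¹ * ∑ n, ∫⁻ y, f y ∂(μ n : Measure Y) := by
  change ∫⁻ y, f y ∂((N : ℝ≥0∞)⁻¹ • ∑ n, (μ n : Measure Y)) = _
  rw [lintegral_smul_measure, lintegral_finsetSum_measure, smul_eq_mul]

theorem integral_emp (y : Fin N → Y) {f : Y → ℝ} (hf : IsBb f) :
    ∫ z, f z ∂(emp y : Measure Y) = 1 / (N : ℝ) * ∑ n, f (y n) := by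
  refine (integral_avg _ hf).trans ?_
  congr 2
  funext n
  exact integral_dirac' f (y n) hf.1.stronglyMeasurable

theorem probabilityMeasure_ext_of_integral {μ ν : ProbabilityMeasure Y}
    (h : ∀ f : Y → ℝ, IsBb f → ∫ y, f y ∂(μ : Measure Y) = ∫ y, f y ∂(ν : Measure Y)) :
    μ = ν := by
  refine ProbabilityMeasure.toMeasure_injective (Measure.ext fun s hs => ?_)
  have h1 := h (s.indicator 1) ⟨measurable_one.indicator hs, 1, fun y => by
    by_cases hy : y ∈ s <;> simp [hy]⟩
  rw [integral_indicator_one hs, integral_indicator_one hs] at h1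
  exact (measureReal_eq_measureReal_iff (measure_ne_top _ _) (measure_ne_top _ _)).1 h1

theorem avg_const (μ : ProbabilityMeasure Y) : avg (fun _ : Fin N => μ) = μ := by
  refine probabilityMeasure_ext_of_integral fun f hf => ?_
  have := natCast_pos (N := N)
  rw [integral_avg _ hf]
  simp
  field_simp

theorem avg_comp_equiv (μ : Fin N → ProbabilityMeasure Y) (σ : Equiv.Perm (Fin N)) :
    avg (fun n => μ (σ n)) = avg μ := by
  refine probabilityMeasure_ext_of_integral fun f hf => ?_
  rw [integral_avg _ hf, integral_avg _ hf]
  congr 1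
  exact Equiv.sum_comp σ fun n => ∫ y, f y ∂(μ n : Measure Y)

end Operations

/-! ### The bounded-Lipschitz and total-variation distances -/

section Distances

variable {Y : Type*} [MeasurableSpace Y] {d : Y → Y → ℝ} {μ ν ρ : ProbabilityMeasure Y}

theorem half_abs_le_one {h : Y → ℝ} (hh : ∀ y, |h y| ≤ 1) :
    1 / 2 * |∫ y, h y ∂(μ : Measure Y) - ∫ y, h y ∂(ν : Measure Y)| ≤ 1 := by
  have h1 := abs_integral_le_of_bound (μ := (μ : Measure Y)) hh
  have h2 := abs_integral_le_of_bound (μ := (ν : Measure Y)) hh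
  have := abs_sub (∫ y, h y ∂(μ : Measure Y)) (∫ y, h y ∂(ν : Measure Y))
  linarith

theorem le_blDist {h : Y → ℝ} (hh : IsBL d h) :
    1 / 2 * |∫ y, h y ∂(μ : Measure Y) - ∫ y, h y ∂(ν : Measure Y)| ≤ blDist d μ ν :=
  le_csSup ⟨1, by rintro _ ⟨h, hh, rfl⟩; exact half_abs_le_one hh.1⟩ ⟨h, hh, rfl⟩

theorem le_tvDist {h : Y → ℝ} (hm : Measurable h) (hh : ∀ y, |h y| ≤ 1) :
    1 / 2 * |∫ y, h y ∂(μ : Measure Y) - ∫ y, h y ∂(ν : Measure Y)| ≤ tvDist μ ν :=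
  le_csSup ⟨1, by rintro _ ⟨h, -, hh, rfl⟩; exact half_abs_le_one hh⟩ ⟨h, hm, hh, rfl⟩

theorem blDist_le {C : ℝ} (hC : 0 ≤ C) (H : ∀ h : Y → ℝ, IsBL d h →
    1 / 2 * |∫ y, h y ∂(μ : Measure Y) - ∫ y, h y ∂(ν : Measure Y)| ≤ C) : blDist d μ ν ≤ C :=
  Real.sSup_le (by rintro _ ⟨h, hh, rfl⟩; exact H h hh) hC

theorem tvDist_le {C : ℝ} (hC : 0 ≤ C) (H : ∀ h : Y → ℝ, Measurable h → (∀ y, |h y| ≤ 1) →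
    1 / 2 * |∫ y, h y ∂(μ : Measure Y) - ∫ y, h y ∂(ν : Measure Y)| ≤ C) : tvDist μ ν ≤ C :=
  Real.sSup_le (by rintro _ ⟨h, hm, hh, rfl⟩; exact H h hm hh) hC

theorem blDist_nonneg : 0 ≤ blDist d μ ν :=
  Real.sSup_nonneg (by rintro _ ⟨h, -, rfl⟩; positivity)

theorem blDist_le_one : blDist d μ ν ≤ 1 := blDist_le zero_le_one fun _ hh => half_abs_le_one hh.1

theorem tvDist_le_one : tvDist μ ν ≤ 1 := tvDist_le zero_le_one fun _ _ hh => half_abs_le_one hh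

theorem blDist_self : blDist d μ μ = 0 :=
  le_antisymm (blDist_le le_rfl fun h _ => by simp) blDist_nonneg

theorem blDist_comm : blDist d μ ν = blDist d ν μ := by
  simp only [blDist, abs_sub_comm]

theorem blDist_triangle : blDist d μ ρ ≤ blDist d μ ν + blDist d ν ρ := by
  refine blDist_le (add_nonneg blDist_nonneg blDist_nonneg) fun h hh => ?_
  have h1 := le_blDist (μ := μ) (ν := ν) hh
  have h2 := le_blDist (μ := ν) (ν := ρ) hh
  have := abs_sub_le (∫ y, h y ∂(μ : Measure Y)) (∫ y, h y ∂(ν : Measure Y))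
    (∫ y, h y ∂(ρ : Measure Y))
  linarith

theorem abs_blDist_sub_le : |blDist d μ ρ - blDist d ν ρ| ≤ blDist d μ ν := by
  have h1 := blDist_triangle (d := d) (μ := μ) (ν := ν) (ρ := ρ)
  have h2 := blDist_triangle (d := d) (μ := ν) (ν := μ) (ρ := ρ)
  rw [blDist_comm (μ := ν) (ν := μ)] at h2
  rw [abs_le]
  constructor <;> linarith

/-- A function of oscillation at most `2 c` stays within `c` of some constant. -/
theorem exists_center {Y : Type*} [Nonempty Y] {f : Y → ℝ} {c : ℝ}
    (h : ∀ y z, |f y - f z| ≤ 2 * c) : ∃ m, ∀ y, |f y - m| ≤ c := by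
  obtain ⟨y₀⟩ := ‹Nonempty Y›
  have hb : BddBelow (Set.range f) := ⟨f y₀ - 2 * c, by
    rintro _ ⟨y, rfl⟩
    have := (abs_le.1 (h y y₀)).1
    linarith⟩
  have : Nonempty Y := ⟨y₀⟩
  refine ⟨(⨅ y, f y) + c, fun y => abs_le.2 ⟨?_, ?_⟩⟩
  · have := ciInf_le hb y
    linarith
  · have : f y - 2 * c ≤ ⨅ y, f y := le_ciInf fun z => by
      have := (abs_le.1 (h y z)).2
      linarith
    linarith

theorem IsBb.integral_center {f : Y → ℝ} (hf : IsBb f) {c : ℝ} (hc : c ≠ 0) (m : ℝ)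
    (μ : ProbabilityMeasure Y) :
    ∫ y, f y ∂(μ : Measure Y) = c * ∫ y, c⁻¹ * (f y - m) ∂(μ : Measure Y) + m := by
  rw [integral_const_mul, integral_sub (hf.integrable _) (integrable_const m)]
  simp
  field_simp
  ring

theorem nonempty_of_probabilityMeasure (μ : ProbabilityMeasure Y) : Nonempty Y :=
  nonempty_of_isProbabilityMeasure (μ : Measure Y)

theorem abs_integral_sub_le_tvDist {f : Y → ℝ} (hf : IsBb f) {c : ℝ} (hc : 0 ≤ c)
    (h : ∀ y z, |f y - f z| ≤ c) :
    |∫ y, f y ∂(μ : Measure Y) - ∫ y, f y ∂(ν : Measure Y)| ≤ c * tvDist μ ν := by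
  have := nonempty_of_probabilityMeasure μ
  obtain ⟨m, hm⟩ := exists_center (f := f) (c := c / 2) fun y z => by
    have := h y z
    linarith
  rcases hc.eq_or_lt with rfl | hc
  · have h1 : ∀ y, f y = m := fun y => by
      have := hm y
      rw [zero_div, abs_nonpos_iff] at this
      linarith
    simp [h1]
  · have hc2 : c / 2 ≠ 0 := by positivity
    have h1 := le_tvDist (μ := μ) (ν := ν) (h := fun y => (c / 2)⁻¹ * (f y - m))
      ((hf.1.sub_const m).const_mul _) fun y => by
        rw [abs_mul, abs_of_pos (by positivity), inv_mul_le_iff₀ (by positivity), mul_one]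
        exact hm y
    rw [hf.integral_center hc2 m μ, hf.integral_center hc2 m ν, add_sub_add_right_eq_sub,
      ← mul_sub, abs_mul, abs_of_pos (by positivity)]
    nlinarith

theorem abs_integral_sub_le_blDist {f : Y → ℝ} (hf : IsBb f) {c : ℝ} (hc : 0 < c)
    (h : ∀ y z, |f y - f z| ≤ 2 * c) (h' : ∀ y z, |f y - f z| ≤ c * d y z) :
    |∫ y, f y ∂(μ : Measure Y) - ∫ y, f y ∂(ν : Measure Y)| ≤ 2 * c * blDist d μ ν := by
  have := nonempty_of_probabilityMeasure μ
  obtain ⟨m, hm⟩ := exists_center h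
  have h1 := le_blDist (μ := μ) (ν := ν) (d := d) (h := fun y => c⁻¹ * (f y - m))
    ⟨fun y => by
      rw [abs_mul, abs_of_pos (by positivity), inv_mul_le_iff₀ (by positivity), mul_one]
      exact hm y, fun y z => by
      rw [← mul_sub, sub_sub_sub_cancel_right, abs_mul, abs_of_pos (by positivity),
        inv_mul_le_iff₀ (by positivity)]
      exact h' y z⟩
  rw [hf.integral_center hc.ne' m μ, hf.integral_center hc.ne' m ν, add_sub_add_right_eq_sub,
    ← mul_sub, abs_mul, abs_of_pos (by positivity)]
  nlinarith

end Distances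

/-! ### Continuous distances and finite nets of bounded Lipschitz functions -/

/-- `d` is continuous and vanishes on the diagonal: what is needed of a distance in order that the
`1`-Lipschitz functions are an equicontinuous family. -/
structure IsContDist {Y : Type*} [TopologicalSpace Y] (d : Y → Y → ℝ) : Prop where
  continuous : Continuous fun p : Y × Y => d p.1 p.2
  self : ∀ y, d y y = 0

theorem isContDist_dist {Y : Type*} [MetricSpace Y] : IsContDist (dist : Y → Y → ℝ) :=
  ⟨continuous_dist, dist_self⟩

theorem isContDist_sumDist {X A : Type*} [MetricSpace X] [MetricSpace A] :
    IsContDist (sumDist : X × A → X × A → ℝ) :=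
  ⟨by unfold sumDist; fun_prop, fun y => by simp [sumDist]⟩

section ContDist

variable {Y : Type*} [TopologicalSpace Y] {d : Y → Y → ℝ} (hd : IsContDist d)
include hd

theorem IsContDist.subtype (S : Set Y) : IsContDist fun y z : S => d y z :=
  ⟨hd.continuous.comp ((continuous_subtype_val.comp continuous_fst).prodMk
    (continuous_subtype_val.comp continuous_snd)), fun y => hd.self y⟩

theorem IsContDist.tendsto (y : Y) : Tendsto (fun z => d y z) (𝓝 y) (𝓝 0) := by
  have h : Continuous fun z => d y z := hd.continuous.comp (continuous_const.prodMk continuous_id)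
  simpa [hd.self] using h.tendsto y

theorem IsBL.continuous {h : Y → ℝ} (hh : IsBL d h) : Continuous h := by
  refine continuous_iff_continuousAt.2 fun y => ?_
  rw [ContinuousAt, tendsto_iff_dist_tendsto_zero]
  refine squeeze_zero (fun _ => dist_nonneg) (fun z => ?_) (hd.tendsto y)
  rw [dist_comm, Real.dist_eq]
  exact hh.2 y z

theorem IsBL.isBb [MeasurableSpace Y] [OpensMeasurableSpace Y] {h : Y → ℝ} (hh : IsBL d h) :
    IsBb h :=
  ⟨(hh.continuous hd).measurable, 1, hh.1⟩

/-- Bounded Lipschitz functions on a compact set have finite nets (Arzelà–Ascoli), so the minimum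
in the definition of `coverNum` is attained. -/
theorem exists_net {S : Set Y} (hS : IsCompact S) {j : ℕ} (hj : 1 ≤ j) :
    ∃ c : Fin (coverNum d S j) → (S → ℝ), (∀ k, IsBL (fun y z : S => d y z) (c k)) ∧
      ∀ h : S → ℝ, IsBL (fun y z : S => d y z) h →
        ∃ k, supNorm (fun y => h y - c k y) < 1 / (j : ℝ) := by
  have : CompactSpace S := isCompact_iff_compactSpace.1 hS
  have hdS := hd.subtype S
  let F : Set (BoundedContinuousFunction S ℝ) := {f | IsBL (fun y z : S => d y z) f}
  have hF : IsCompact (closure F) := by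
    refine BoundedContinuousFunction.arzela_ascoli (Set.Icc (-1) 1) isCompact_Icc F
      (fun f x hf => abs_le.1 (hf.1 x)) fun y => ?_
    rw [Metric.equicontinuousAt_iff_right]
    intro ε hε
    filter_upwards [(hdS.tendsto y).eventually (gt_mem_nhds hε)] with z hz f
    exact (Real.dist_eq _ _ ▸ f.2.2 y z).trans_lt hz
  have hj' : (0 : ℝ) < 1 / j := by
    have : (0 : ℝ) < j := by exact_mod_cast hj
    positivity
  obtain ⟨t, htF, ht, hcov⟩ := Metric.finite_approx_of_totallyBounded
    (hF.totallyBounded.subset subset_closure) _ hj'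
  refine Nat.sInf_mem (s := {n | ∃ c : Fin n → (S → ℝ),
    (∀ k, IsBL (fun y z : S => d y z) (c k)) ∧ ∀ h : S → ℝ, IsBL (fun y z : S => d y z) h →
      ∃ k, supNorm (fun y => h y - c k y) < 1 / (j : ℝ)}) ?_
  have := ht.fintype
  let e := Fintype.equivFin t
  refine ⟨Fintype.card t, fun k => (e.symm k : BoundedContinuousFunction S ℝ),
    fun k => htF (e.symm k).2, fun h hh => ?_⟩
  let hb : BoundedContinuousFunction S ℝ := BoundedContinuousFunction.mkOfCompact
    ⟨h, hh.continuous hdS⟩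
  obtain ⟨f, hft, hf⟩ := Set.mem_iUnion₂.1 (hcov (show hb ∈ F from hh))
  refine ⟨e ⟨f, hft⟩, lt_of_le_of_lt (supNorm_le dist_nonneg fun y => ?_) (Metric.mem_ball.1 hf)⟩
  simp only [Equiv.symm_apply_apply]
  exact (Real.dist_eq _ _).symm.trans_le
    (BoundedContinuousFunction.dist_coe_le_dist (f := hb) (g := f) y)

end ContDist

/-! ### Product measures -/

section Product

variable {ι Y : Type*} [Fintype ι] [DecidableEq ι] [MeasurableSpace Y]

/-- The product of a family of probability measures. -/
noncomputable abbrev prodLaw (μ : ι → ProbabilityMeasure Y) : Measure (ι → Y) :=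
  Measure.pi fun n => (μ n : Measure Y)

theorem prodLaw_update (μ : ι → ProbabilityMeasure Y) (i : ι) (ν : ProbabilityMeasure Y) :
    prodLaw (Function.update μ i ν) =
      ((prodLaw μ).prod (ν : Measure Y)).map fun p => Function.update p.1 i p.2 := by
  refine Measure.pi_eq fun s hs => ?_
  rw [Measure.map_apply measurable_update' (MeasurableSet.univ_pi hs)]
  have h1 : (fun p : (ι → Y) × Y => Function.update p.1 i p.2) ⁻¹' Set.univ.pi s =
      (Set.univ.pi (Function.update s i Set.univ)) ×ˢ s i := by
    ext ⟨x, y⟩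
    simp only [Set.mem_preimage, Set.mem_pi, Set.mem_univ, true_imp_iff, Set.mem_prod]
    constructor
    · refine fun h => ⟨fun n => ?_, by simpa using h i⟩
      by_cases hn : n = i
      · subst hn; simp
      · simpa [hn] using h n
    · rintro ⟨h, h'⟩ n
      by_cases hn : n = i
      · subst hn; simpa using h'
      · simpa [hn] using h n
  rw [h1, Measure.prod_prod, Measure.pi_pi, ← Finset.mul_prod_erase _ _ (Finset.mem_univ i),
    ← Finset.mul_prod_erase Finset.univ (fun n => (Function.update μ i ν n : Measure Y) (s n))
      (Finset.mem_univ i)]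
  simp only [Function.update_self, measure_univ, one_mul]
  rw [mul_comm]
  congr 1
  refine Finset.prod_congr rfl fun n hn => ?_
  simp [(Finset.mem_erase.1 hn).1]

theorem integral_prodLaw_update (μ : ι → ProbabilityMeasure Y) (i : ι) (ν : ProbabilityMeasure Y)
    {f : (ι → Y) → ℝ} (hf : IsBb f) :
    ∫ x, f x ∂prodLaw (Function.update μ i ν) =
      ∫ x, ∫ y, f (Function.update x i y) ∂(ν : Measure Y) ∂prodLaw μ := by
  rw [prodLaw_update, integral_map measurable_update'.aemeasurable hf.1.aestronglyMeasurable]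
  exact integral_prod _ ((hf.comp measurable_update').integrable _)

/-- Comparison of two product laws, exchanging the coordinates one at a time. -/
theorem abs_integral_prodLaw_sub_le (q κ : ι → ProbabilityMeasure Y) {f : (ι → Y) → ℝ}
    (hf : IsBb f) (D : ι → ℝ)
    (hD : ∀ n x, |∫ y, f (Function.update x n y) ∂(κ n : Measure Y) -
      ∫ y, f (Function.update x n y) ∂(q n : Measure Y)| ≤ D n) :
    |∫ x, f x ∂prodLaw κ - ∫ x, f x ∂prodLaw q| ≤ ∑ n, D n := by
  have key : ∀ s : Finset ι, |∫ x, f x ∂prodLaw (s.piecewise κ q) - ∫ x, f x ∂prodLaw q| ≤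
      ∑ n ∈ s, D n := by
    intro s
    induction s using Finset.induction_on with
    | empty => simp
    | insert i s hi ih =>
      have h1 : prodLaw (s.piecewise κ q) =
          prodLaw (Function.update (s.piecewise κ q) i (q i)) := by
        rw [Function.update_eq_self_iff.2 (s.piecewise_eq_of_notMem κ q hi).symm]
      have hint (ν : ProbabilityMeasure Y) : Integrable
          (fun x => ∫ y, f (Function.update x i y) ∂(ν : Measure Y)) (prodLaw (s.piecewise κ q)) :=
        (isBb_integral_family (hf.comp (φ := fun p : (ι → Y) × Y => Function.update p.1 i p.2)
          measurable_update') (measurable_const (a := ν))).integrable _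
      have h2 : |∫ x, f x ∂prodLaw ((insert i s).piecewise κ q) -
          ∫ x, f x ∂prodLaw (s.piecewise κ q)| ≤ D i := by
        rw [h1, Finset.piecewise_insert, integral_prodLaw_update _ _ _ hf,
          integral_prodLaw_update _ _ _ hf, ← integral_sub (hint _) (hint _)]
        exact abs_integral_le_of_bound fun x => hD i x
      rw [Finset.sum_insert hi]
      exact (abs_sub_le _ _ _).trans (add_le_add h2 ih)
  simpa using key Finset.univ

theorem measurable_prodLaw {ι Y Z : Type*} [Fintype ι] [MeasurableSpace Y] [MeasurableSpace Z]
    {q : ι → Z → ProbabilityMeasure Y}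
    (hq : ∀ n, Measurable (q n)) : Measurable fun z => prodLaw fun n => q n z := by
  refine Measurable.measure_of_isPiSystem_of_isProbabilityMeasure generateFrom_pi.symm
    isPiSystem_pi ?_
  rintro _ ⟨s, hs, rfl⟩
  simp only [Measure.pi_pi]
  exact Finset.measurable_fun_prod _ fun n _ => (Measure.measurable_coe (hs n trivial)).comp
    (measurable_subtype_coe.comp (hq n))

/-- Transitions that are independent over the coordinates carry a product law to the product of
the marginal laws. -/
theorem prodLaw_bind {ι Y Z : Type*} [Fintype ι] [MeasurableSpace Y] [MeasurableSpace Z]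
    (μ : ι → ProbabilityMeasure Y) (κ : ι → {κ : Y → ProbabilityMeasure Z // Measurable κ}) :
    (prodLaw μ).bind (fun x => prodLaw fun n => (κ n).1 (x n)) =
      prodLaw fun n => mix (μ n) (κ n) := by
  have hm : Measurable fun x : ι → Y => prodLaw fun n => (κ n).1 (x n) :=
    measurable_prodLaw fun n => (κ n).2.comp (measurable_pi_apply n)
  refine (Measure.pi_eq fun s hs => ?_).symm
  rw [Measure.bind_apply (MeasurableSet.univ_pi hs) hm.aemeasurable]
  simp only [Measure.pi_pi]
  have hms : ∀ n, Measurable fun y => ((κ n).1 y : Measure Z) (s n) := fun n =>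
    (Measure.measurable_coe (hs n)).comp (measurable_subtype_coe.comp (κ n).2)
  have h1 := lintegral_prod_eq_prod_lintegral_of_indepFun (μ := prodLaw μ) Finset.univ
    (fun n x => ((κ n).1 (x n) : Measure Z) (s n))
    (iIndepFun_pi (μ := fun n => (μ n : Measure Y)) fun n => (hms n).aemeasurable)
    fun n => (hms n).comp (measurable_pi_apply n)
  rw [h1]
  refine Finset.prod_congr rfl fun n _ => ?_
  rw [(measurePreserving_eval (fun n => (μ n : Measure Y)) n).lintegral_comp (hms n)]
  exact (Measure.bind_apply (hs n) (measurable_subtype_coe.comp (κ n).2).aemeasurable).symm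

end Product

/-! ### Concentration of empirical measures -/

section Empirical

variable {Y : Type*} [TopologicalSpace Y] [MeasurableSpace Y] {d : Y → Y → ℝ}
  {N : ℕ} [NeZero N]

section Lipschitz

variable [OpensMeasurableSpace Y] (hd : IsContDist d)
include hd

theorem blDist_emp_le (y z : Fin N → Y) :
    blDist d (emp y) (emp z) ≤ 1 / (2 * (N : ℝ)) * ∑ n, min 2 (max (d (y n) (z n)) 0) := by
  have hN := natCast_pos (N := N)
  have hs : 0 ≤ ∑ n, min 2 (max (d (y n) (z n)) 0) :=
    Finset.sum_nonneg fun n _ => le_min zero_le_two (le_max_right _ _)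
  refine blDist_le (by positivity) fun h hh => ?_
  rw [integral_emp _ (hh.isBb hd), integral_emp _ (hh.isBb hd), ← mul_sub,
    ← Finset.sum_sub_distrib, abs_mul, abs_of_pos (by positivity)]
  have h1 : |∑ n, (h (y n) - h (z n))| ≤ ∑ n, min 2 (max (d (y n) (z n)) 0) := by
    refine (Finset.abs_sum_le_sum_abs _ _).trans (Finset.sum_le_sum fun n _ => le_min ?_ ?_)
    · have := abs_sub (h (y n)) (h (z n))
      have := hh.1 (y n)
      have := hh.1 (z n)
      linarith
    · exact (hh.2 _ _).trans (le_max_left _ _)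
  calc 1 / 2 * (1 / (N : ℝ) * |∑ n, (h (y n) - h (z n))|)
      ≤ 1 / 2 * (1 / (N : ℝ) * ∑ n, min 2 (max (d (y n) (z n)) 0)) := by gcongr
    _ = _ := by field_simp

theorem abs_blDist_emp_update_sub_le (y : Fin N → Y) (n : Fin N) (a b : Y)
    (ν : ProbabilityMeasure Y) :
    |blDist d (emp (Function.update y n a)) ν - blDist d (emp (Function.update y n b)) ν| ≤
      1 / (2 * (N : ℝ)) * min 2 (max (d a b) 0) := by
  refine (abs_blDist_sub_le.trans (blDist_emp_le hd _ _)).trans_eq ?_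
  congr 1
  rw [Finset.sum_eq_single n]
  · simp
  · intro m _ hm
    simp [hm, hd.self]
  · simp

theorem continuous_blDist_emp (ν : ProbabilityMeasure Y) :
    Continuous fun y : Fin N → Y => blDist d (emp y) ν := by
  refine continuous_iff_continuousAt.2 fun y => ?_
  rw [ContinuousAt, tendsto_iff_dist_tendsto_zero]
  have h1 : Tendsto (fun z : Fin N → Y => 1 / (2 * (N : ℝ)) * ∑ n, min 2 (max (d (y n) (z n)) 0))
      (𝓝 y) (𝓝 (1 / (2 * (N : ℝ)) * ∑ n : Fin N, min 2 (max 0 0))) := by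
    refine (tendsto_finsetSum _ fun n _ => ?_).const_mul _
    exact tendsto_const_nhds.min (((hd.tendsto (y n)).comp
      ((continuous_apply n).tendsto y)).max tendsto_const_nhds)
  simp only [max_self, min_eq_right (zero_le_two (α := ℝ)), Finset.sum_const_zero, mul_zero] at h1
  refine squeeze_zero (fun _ => dist_nonneg) (fun z => ?_) h1
  rw [dist_comm, Real.dist_eq]
  exact abs_blDist_sub_le.trans (blDist_emp_le hd _ _)

theorem isBb_blDist_emp [OpensMeasurableSpace (Fin N → Y)] (ν : ProbabilityMeasure Y) :
    IsBb fun y : Fin N → Y => blDist d (emp y) ν :=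
  ⟨(continuous_blDist_emp hd ν).measurable, 1, fun y => by
    rw [abs_of_nonneg blDist_nonneg]; exact blDist_le_one⟩

end Lipschitz

/-- The mean absolute deviation of an empirical average of independent variables with values in
`[-1, 1]`. -/
theorem integral_abs_emp_sub_le {Y : Type*} [MeasurableSpace Y] (ν : Fin N → ProbabilityMeasure Y)
    {g : Y → ℝ} (hg : Measurable g) (hg1 : ∀ y, |g y| ≤ 1) :
    ∫ y, |∫ z, g z ∂(emp y : Measure Y) - ∫ z, g z ∂(avg ν : Measure Y)| ∂prodLaw ν ≤ 1 / √N := by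
  have hgb : IsBb g := ⟨hg, 1, hg1⟩
  have hN := natCast_pos (N := N)
  have hs := Real.sqrt_pos.2 hN
  simp only [integral_emp _ hgb, integral_avg _ hgb]
  set S : (Fin N → Y) → ℝ := ∑ n, fun y => g (y n) with hS
  set m : ℝ := ∑ n, ∫ y, g y ∂(ν n : Measure Y) with hm
  have hSb : IsBb S := by
    rw [hS, Finset.sum_fn]
    exact isBb_finset_sum _ fun n _ => hgb.comp (measurable_pi_apply n)
  have hSm : ∫ y, S y ∂prodLaw ν = m := by
    simp only [hS, Finset.sum_apply]
    rw [integral_finsetSum _ fun n _ => (hgb.comp (measurable_pi_apply n)).integrable _]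
    refine Finset.sum_congr rfl fun n _ => ?_
    exact integral_comp_eval (μ := fun n => (ν n : Measure Y)) hg.aestronglyMeasurable
  have hvar : ∫ y, (S y - m) ^ 2 ∂prodLaw ν ≤ N := by
    rw [← hSm, ← variance_eq_integral hSb.1.aemeasurable, hS,
      variance_sum_pi (X := fun _ => g) fun n => MemLp.of_bound hg.aestronglyMeasurable 1
        (Eventually.of_forall hg1)]
    calc ∑ n, Var[g; (ν n : Measure Y)] ≤ ∑ n : Fin N, (1 : ℝ) := Finset.sum_le_sum fun n _ => by
          have := variance_le_sq_of_bounded (μ := (ν n : Measure Y)) (a := -1) (b := 1) (X := g)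
            (Eventually.of_forall fun y => abs_le.1 (hg1 y)) hg.aemeasurable
          norm_num at this
          exact this
      _ = N := by simp
  have hdb := hSb.sub (isBb_const (Y := Fin N → Y) m)
  have hsq : IsBb fun y => (S y - m) ^ 2 := by
    obtain ⟨h1, C, hC⟩ := hdb
    exact ⟨h1.pow_const 2, C ^ 2, fun y => by
      rw [abs_pow]
      exact pow_le_pow_left₀ (abs_nonneg _) (hC y) 2⟩
  -- `|x| ≤ (x ^ 2 / √N + √N) / 2` replaces the Cauchy-Schwarz inequality
  calc ∫ y, |1 / (N : ℝ) * ∑ n, g (y n) - 1 / (N : ℝ) * m| ∂prodLaw ν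
      = 1 / (N : ℝ) * ∫ y, |S y - m| ∂prodLaw ν := by
        rw [← integral_const_mul]
        congr 1
        funext y
        rw [← mul_sub, abs_mul, abs_of_pos (by positivity), hS, Finset.sum_apply]
    _ ≤ 1 / (N : ℝ) * ∫ y, (1 / (2 * √N) * (S y - m) ^ 2 + √N / 2) ∂prodLaw ν := by
        refine mul_le_mul_of_nonneg_left (integral_mono (hdb.abs.integrable _)
          (((hsq.const_mul _).add (isBb_const _)).integrable _) fun y => ?_) (by positivity)
        have h1 := sq_nonneg (|S y - m| - √N)
        rw [sub_sq, sq_abs] at h1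
        simp only
        rw [← sub_nonneg]
        have h2 : 1 / (2 * √N) * (S y - m) ^ 2 + √N / 2 - |S y - m| =
            1 / (2 * √N) * ((S y - m) ^ 2 - 2 * |S y - m| * √N + √N ^ 2) := by
          field_simp
          ring
        rw [h2]
        positivity
    _ = 1 / (N : ℝ) * (1 / (2 * √N) * ∫ y, (S y - m) ^ 2 ∂prodLaw ν + √N / 2) := by
        rw [integral_add ((hsq.const_mul _).integrable _) (integrable_const _),
          integral_const_mul]
        simp
    _ ≤ 1 / (N : ℝ) * (1 / (2 * √N) * N + √N / 2) := by gcongr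
    _ = 1 / √N := by
        have hss : √(N : ℝ) ^ 2 = N := Real.sq_sqrt hN.le
        generalize √(N : ℝ) = s at hs hss
        rw [← hss]
        field_simp
        ring

/-- Testing against a bounded Lipschitz function is controlled by a member of a net on `S` and the
mass outside `S`. -/
theorem abs_integral_sub_net_le {Y : Type*} [MeasurableSpace Y] {S : Set Y}
    (hS : MeasurableSet S) {j : ℝ} {h g : Y → ℝ}
    (hh : IsBb h) (hg : IsBb g) (hj : 0 ≤ j) (h1 : ∀ y ∈ S, |h y - g y| ≤ j)
    (h2 : ∀ y ∉ S, |h y - g y| ≤ 1) (μ : ProbabilityMeasure Y) :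
    |∫ y, h y ∂(μ : Measure Y) - ∫ y, g y ∂(μ : Measure Y)| ≤ j + (μ : Measure Y).real Sᶜ := by
  rw [← integral_sub (hh.integrable _) (hg.integrable _)]
  have hi : IsBb (Sᶜ.indicator (fun _ => (1 : ℝ))) :=
    ⟨measurable_const.indicator hS.compl, 1, fun y => by
      by_cases hy : y ∈ S <;> simp [hy]⟩
  calc |∫ y, (h y - g y) ∂(μ : Measure Y)| ≤ ∫ y, |h y - g y| ∂(μ : Measure Y) :=
        abs_integral_le_integral_abs
    _ ≤ ∫ y, (j + Sᶜ.indicator (fun _ => (1 : ℝ)) y) ∂(μ : Measure Y) := by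
        refine integral_mono ((hh.sub hg).abs.integrable _)
          (((isBb_const j).add hi).integrable _) fun y => ?_
        by_cases hy : y ∈ S
        · simpa [hy] using h1 y hy
        · simpa [hy] using (h2 y hy).trans (by linarith)
    _ = j + (μ : Measure Y).real Sᶜ := by
        rw [integral_add (integrable_const _) (hi.integrable _),
          integral_indicator_const _ hS.compl]
        simp

/-- Independent variables with a tight average law: the expected distance of the empirical measure
to the average law. A finite net of the bounded Lipschitz functions on a compact set reduces the
supremum over all test functions to finitely many. -/
theorem integral_blDist_emp_avg_le [OpensMeasurableSpace Y] [OpensMeasurableSpace (Fin N → Y)]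
    (hd : IsContDist d) {K : ℕ → Set Y} (hK : ∀ i, IsCompact (K i))
    (hKm : ∀ i, MeasurableSet (K i)) (ν : Fin N → ProbabilityMeasure Y)
    (htail : ∀ i : ℕ, 1 ≤ i → (avg ν : Measure Y).real (K i)ᶜ ≤ 1 / i) :
    ∫ y, blDist d (emp y) (avg ν) ∂prodLaw ν ≤ rate d K N := by
  have hN := natCast_pos (N := N)
  refine le_csInf ⟨_, 1, 1, le_rfl, le_rfl, rfl⟩ ?_
  rintro _ ⟨i, j, hi, hj, rfl⟩
  have hnet := exists_net hd (hK i) hj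
  generalize coverNum d (K i) j = n at hnet ⊢
  obtain ⟨c, hc, hnet⟩ := hnet
  have hj' : (0 : ℝ) < 1 / j := by
    have : (0 : ℝ) < j := by exact_mod_cast hj
    positivity
  -- the net, extended by zero outside the compact set
  let g : Fin n → Y → ℝ := fun k => Function.extend Subtype.val (c k) 0
  have hgK : ∀ k (y : K i), g k y = c k y := fun k y => Subtype.val_injective.extend_apply _ _ y
  have hgK' : ∀ k, ∀ y ∉ K i, g k y = 0 := fun k y hy =>
    Function.extend_apply' _ _ _ fun ⟨z, hz⟩ => hy (hz ▸ z.2)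
  have hgm : ∀ k, Measurable (g k) := fun k =>
    (MeasurableEmbedding.subtype_coe (hKm i)).measurable_extend
      ((hc k).continuous (hd.subtype _)).measurable measurable_const
  have hg1 : ∀ k y, |g k y| ≤ 1 := fun k y => by
    by_cases hy : y ∈ K i
    · rw [hgK k ⟨y, hy⟩]; exact (hc k).1 _
    · simp [hgK' k y hy]
  have hgb : ∀ k, IsBb (g k) := fun k => ⟨hgm k, 1, hg1 k⟩
  let ψ : (Fin N → Y) → ℝ := fun y => ∑ k, |∫ z, g k z ∂(emp y : Measure Y) -
    ∫ z, g k z ∂(avg ν : Measure Y)|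
  have hindb : IsBb ((K i)ᶜ.indicator (1 : Y → ℝ)) :=
    ⟨measurable_const.indicator (hKm i).compl, 1, fun y => by
      by_cases hy : y ∈ K i <;> simp [hy]⟩
  have hreal : ∀ μ : ProbabilityMeasure Y, (μ : Measure Y).real (K i)ᶜ =
      ∫ z, (K i)ᶜ.indicator (1 : Y → ℝ) z ∂(μ : Measure Y) := fun μ =>
    (integral_indicator_one (hKm i).compl).symm
  have hempb : ∀ {f : Y → ℝ}, IsBb f → IsBb fun y : Fin N → Y => ∫ z, f z ∂(emp y : Measure Y) :=
    fun hf => isBb_integral_family (hf.comp measurable_snd) measurable_emp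
  have hψb : IsBb ψ := isBb_finset_sum _ fun k _ =>
    ((hempb (hgb k)).sub (isBb_const _)).abs
  have hpt : ∀ y : Fin N → Y, blDist d (emp y) (avg ν) ≤ 1 / 2 * ψ y + 1 / j +
      1 / 2 * (∫ z, (K i)ᶜ.indicator (1 : Y → ℝ) z ∂(emp y : Measure Y) + 1 / i) := by
    intro y
    have hψ0 : 0 ≤ ψ y := Finset.sum_nonneg fun _ _ => abs_nonneg _
    refine blDist_le (by
      rw [← hreal]
      positivity) fun h hh => ?_
    obtain ⟨k, hk⟩ := hnet (fun z => h z) ⟨fun z => hh.1 z, fun z w => hh.2 z w⟩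
    have h1 : ∀ z ∈ K i, |h z - g k z| ≤ 1 / j := fun z hz => by
      rw [hgK k ⟨z, hz⟩]
      exact (le_ciSup (f := fun z : K i => |h z - c k z|) ⟨2, by
        rintro _ ⟨w, rfl⟩
        have := abs_sub (h w) (c k w)
        have := hh.1 w
        have := (hc k).1 w
        simp only
        linarith⟩ ⟨z, hz⟩).trans hk.le
    have h2 : ∀ z ∉ K i, |h z - g k z| ≤ 1 := fun z hz => by
      simpa [hgK' k z hz] using hh.1 z
    have e1 := abs_integral_sub_net_le (hKm i) (hh.isBb hd) (hgb k) hj'.le h1 h2 (emp y)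
    have e2 := abs_integral_sub_net_le (hKm i) (hh.isBb hd) (hgb k) hj'.le h1 h2 (avg ν)
    have e3 : |∫ z, g k z ∂(emp y : Measure Y) - ∫ z, g k z ∂(avg ν : Measure Y)| ≤ ψ y :=
      Finset.single_le_sum (f := fun k => |∫ z, g k z ∂(emp y : Measure Y) -
        ∫ z, g k z ∂(avg ν : Measure Y)|) (fun _ _ => abs_nonneg _) (Finset.mem_univ k)
    have e4 := htail i hi
    rw [hreal] at e1
    rw [abs_le] at e1 e2 e3
    have : |∫ z, h z ∂(emp y : Measure Y) - ∫ z, h z ∂(avg ν : Measure Y)| ≤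
        ψ y + 2 * (1 / j) + (∫ z, (K i)ᶜ.indicator (1 : Y → ℝ) z ∂(emp y : Measure Y) + 1 / i) :=
      abs_le.2 ⟨by linarith [e1.1, e2.2, e3.1], by linarith [e1.2, e2.1, e3.2]⟩
    linarith
  have hψi : ∫ y, ψ y ∂prodLaw ν ≤ n * (1 / √N) := by
    rw [integral_finsetSum _ fun k _ =>
      ((hempb (hgb k)).sub (isBb_const _)).abs.integrable (prodLaw ν)]
    calc _ ≤ ∑ _ : Fin n, 1 / √N := Finset.sum_le_sum fun k _ =>
          integral_abs_emp_sub_le ν (hgm k) (hg1 k)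
      _ = _ := by simp
  have hei : ∫ y, ∫ z, (K i)ᶜ.indicator (1 : Y → ℝ) z ∂(emp y : Measure Y) ∂prodLaw ν ≤ 1 / i := by
    refine le_trans (le_of_eq ?_) (htail i hi)
    rw [hreal, integral_avg _ hindb]
    simp only [integral_emp _ hindb]
    rw [integral_const_mul, integral_finsetSum _ fun n _ =>
      (hindb.comp (measurable_pi_apply n)).integrable _]
    congr 2
    funext n
    exact integral_comp_eval (μ := fun n => (ν n : Measure Y)) hindb.1.aestronglyMeasurable
  have hb1 := (hψb.const_mul (1 / 2)).add (isBb_const (1 / (j : ℝ)))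
  have hb2 := ((hempb hindb).add (isBb_const (1 / (i : ℝ)))).const_mul (1 / 2)
  calc ∫ y, blDist d (emp y) (avg ν) ∂prodLaw ν
      ≤ ∫ y, (1 / 2 * ψ y + 1 / j + 1 / 2 * (∫ z, (K i)ᶜ.indicator (1 : Y → ℝ) z
          ∂(emp y : Measure Y) + 1 / i)) ∂prodLaw ν :=
        integral_mono ((isBb_blDist_emp hd _).integrable _) ((hb1.add hb2).integrable _) hpt
    _ = 1 / 2 * ∫ y, ψ y ∂prodLaw ν + 1 / j + 1 / 2 * (∫ y, ∫ z, (K i)ᶜ.indicator (1 : Y → ℝ) z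
          ∂(emp y : Measure Y) ∂prodLaw ν + 1 / i) := by
        rw [integral_add (hb1.integrable _) (hb2.integrable _),
          integral_add ((hψb.const_mul _).integrable _) (integrable_const _),
          integral_const_mul, integral_const_mul,
          integral_add ((hempb hindb).integrable _) (integrable_const _)]
        simp
    _ ≤ 1 / 2 * (n * (1 / √N)) + 1 / j + 1 / 2 * (1 / i + 1 / i) := by gcongr
    _ ≤ 1 / j + 1 / i + √Real.pi * n / √(2 * N) := by
        have h1 : 1 / 2 ≤ √Real.pi / √2 := by
          rw [div_le_div_iff₀ two_pos (by positivity), one_mul]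
          have : √2 ≤ √Real.pi := Real.sqrt_le_sqrt Real.two_le_pi
          have := Real.sqrt_nonneg Real.pi
          linarith
        have h2 : √Real.pi * n / √(2 * N) = √Real.pi / √2 * (n * (1 / √N)) := by
          rw [Real.sqrt_mul zero_le_two]
          field_simp
        rw [h2]
        have := mul_le_mul_of_nonneg_right h1 (show 0 ≤ n * (1 / √(N : ℝ)) by positivity)
        linarith

end Empirical

/-! ### Infima over action laws -/

section Actions

variable {A : Type*} [MetricSpace A] [CompactSpace A] [MeasurableSpace A] [BorelSpace A]

/-- The probability measures on a compact metric space are separable for the bounded-Lipschitz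
distance. -/
theorem exists_countable_dense_blDist : ∃ D : Set (ProbabilityMeasure A), D.Countable ∧
    ∀ (l : ProbabilityMeasure A) (ε : ℝ), 0 < ε → ∃ l' ∈ D, blDist dist l l' < ε := by
  have key : ∀ j : ℕ, ∃ D : Set (ProbabilityMeasure A), D.Countable ∧
      ∀ l : ProbabilityMeasure A, ∃ l' ∈ D, blDist dist l l' ≤ 2 * (1 / ((j + 1 : ℕ) : ℝ)) := by
    intro j
    have hj : (0 : ℝ) < 1 / ((j + 1 : ℕ) : ℝ) := by positivity
    obtain ⟨c, hc, hnet⟩ := exists_net (isContDist_dist (Y := A)) isCompact_univ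
      (Nat.succ_pos j)
    -- the integrals against the members of the net
    let Φ : ProbabilityMeasure A → Fin _ → ℝ := fun l k =>
      ∫ a, c k ⟨a, trivial⟩ ∂(l : Measure A)
    obtain ⟨s, hs, hsd⟩ := TopologicalSpace.exists_countable_dense (Set.range Φ)
    choose pre hpre using fun z : Set.range Φ => z.2
    refine ⟨pre '' s, hs.image _, fun l => ?_⟩
    obtain ⟨z, hz, hzs⟩ := Metric.dense_iff.1 hsd ⟨Φ l, l, rfl⟩ _ hj
    refine ⟨pre z, ⟨z, hzs, rfl⟩, blDist_le (by positivity) fun h hh => ?_⟩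
    obtain ⟨k, hk⟩ := hnet (fun a => h a) ⟨fun a => hh.1 a, fun a b => hh.2 a b⟩
    have hhb := hh.isBb isContDist_dist
    have hcb : IsBb fun a : A => c k ⟨a, trivial⟩ :=
      IsBL.isBb (d := dist) isContDist_dist
        ⟨fun a => (hc k).1 _, fun a b => (hc k).2 ⟨a, trivial⟩ ⟨b, trivial⟩⟩
    have h1 : ∀ l : ProbabilityMeasure A,
        |∫ a, h a ∂(l : Measure A) - Φ l k| ≤ 1 / ((j + 1 : ℕ) : ℝ) := fun l => by
      rw [← integral_sub (hhb.integrable _) (hcb.integrable _)]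
      exact abs_integral_le_of_bound fun a =>
        (le_ciSup (f := fun z : (Set.univ : Set A) => |h z - c k z|) ⟨2, by
          rintro _ ⟨w, rfl⟩
          have := abs_sub (h w) (c k w)
          have := hh.1 w
          have := (hc k).1 w
          simp only
          linarith⟩ ⟨a, trivial⟩).trans hk.le
    have h2 : |Φ l k - Φ (pre z) k| ≤ 1 / ((j + 1 : ℕ) : ℝ) := by
      rw [hpre z, ← Real.dist_eq, dist_comm]
      exact (dist_le_pi_dist _ _ k).trans (Metric.mem_ball.1 hz).le
    have e1 := abs_le.1 (h1 l)
    have e2 := abs_le.1 (h1 (pre z))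
    have e3 := abs_le.1 h2
    have : |∫ a, h a ∂(l : Measure A) - ∫ a, h a ∂(pre z : Measure A)| ≤
        3 * (1 / ((j + 1 : ℕ) : ℝ)) :=
      abs_le.2 ⟨by linarith [e1.1, e2.2, e3.1], by linarith [e1.2, e2.1, e3.2]⟩
    linarith
  choose D hD hDd using key
  refine ⟨⋃ j, D j, Set.countable_iUnion hD, fun l ε hε => ?_⟩
  obtain ⟨j, hj⟩ := exists_nat_one_div_lt (half_pos hε)
  obtain ⟨l', hl', h⟩ := hDd j l
  refine ⟨l', Set.mem_iUnion.2 ⟨j, hl'⟩, h.trans_lt ?_⟩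
  push_cast
  linarith

/-- Infima over all action laws of functions that are equicontinuous in the action law are
measurable, since a countable family of action laws suffices. -/
theorem measurable_iInf_action [Nonempty A] {Y : Type*} [MeasurableSpace Y]
    {F : Y → ProbabilityMeasure A → ℝ} (hF : ∀ l, Measurable fun y => F y l) {C c : ℝ} (hc : 0 ≤ c)
    (hb : ∀ y l, |F y l| ≤ C) {ζ : ℝ → ℝ} (hζ : IsModulus ζ)
    (hcont : ∀ y l l', |F y l - F y l'| ≤ c * ζ (blDist dist l l')) :
    Measurable fun y => ⨅ l, F y l := by
  obtain ⟨D, hD, hDd⟩ := exists_countable_dense_blDist (A := A)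
  have hne : Nonempty (ProbabilityMeasure A) := ⟨⟨Measure.dirac (Classical.arbitrary A),
    inferInstance⟩⟩
  have hneD : Nonempty D := by
    obtain ⟨l', hl', -⟩ := hDd hne.some 1 one_pos
    exact ⟨l', hl'⟩
  have hbb : ∀ y, BddBelow (Set.range (F y)) := fun y => ⟨-C, by
    rintro _ ⟨l, rfl⟩; exact (abs_le.1 (hb y l)).1⟩
  have hbD : ∀ y, BddBelow (Set.range fun l : D => F y l) := fun y => ⟨-C, by
    rintro _ ⟨l, rfl⟩; exact (abs_le.1 (hb y l)).1⟩
  have heq : (fun y => ⨅ l, F y l) = fun y => ⨅ l : D, F y l := by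
    funext y
    refine le_antisymm (le_ciInf fun l => ciInf_le (hbb y) l.1) (le_ciInf fun l => ?_)
    refine le_of_forall_pos_le_add fun ε hε => ?_
    have h1 : Tendsto (fun s => c * ζ s) (𝓝[>] 0) (𝓝 (c * 0)) := hζ.tendsto_zero.const_mul c
    rw [mul_zero] at h1
    obtain ⟨δ, hδ, hδ0⟩ := ((h1.eventually (gt_mem_nhds hε)).and self_mem_nhdsWithin).exists
    obtain ⟨l', hl', h⟩ := hDd l δ hδ0
    have h2 := hcont y l l'
    have h3 := mul_le_mul_of_nonneg_left (hζ.mono _ _ blDist_nonneg h.le) hc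
    have h4 := ciInf_le (hbD y) ⟨l', hl'⟩
    have h5 := (abs_le.1 h2).1
    simp only at h4
    linarith
  rw [heq]
  have : Countable D := hD.to_subtype
  exact Measurable.iInf fun l => hF l

/-- A function on `A` with values in `[-1, 1]` and modulus of continuity `2 η` is, by
inf-convolution, close to an `L`-Lipschitz one. This converts total-variation continuity of the
transitions into continuity for the bounded-Lipschitz distance of the action laws. -/
theorem half_abs_integral_sub_le_of_modulus {A : Type*} [MetricSpace A] [MeasurableSpace A]
    [BorelSpace A] {η : ℝ → ℝ} (hη : IsModulus η) {g : A → ℝ}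
    (hg : IsBb g) (hg1 : ∀ a, |g a| ≤ 1) (hgη : ∀ a b, |g a - g b| ≤ 2 * η (dist a b)) {L : ℝ}
    (hL : 1 ≤ L) (l l' : ProbabilityMeasure A) :
    1 / 2 * |∫ a, g a ∂(l : Measure A) - ∫ a, g a ∂(l' : Measure A)| ≤
      L * blDist dist l l' + η (2 / L) := by
  have hA := nonempty_of_probabilityMeasure l
  have hL0 : 0 < L := by linarith
  let φ : A → ℝ := fun a => ⨅ b, (g b + L * dist a b)
  have hbdd : ∀ a, BddBelow (Set.range fun b => g b + L * dist a b) := fun a => ⟨-1, by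
    rintro _ ⟨b, rfl⟩
    have := (abs_le.1 (hg1 b)).1
    have : 0 ≤ L * dist a b := by positivity
    simp only
    linarith⟩
  have h1 : ∀ a, φ a ≤ g a := fun a => by
    simpa using ciInf_le (hbdd a) a
  have h2 : ∀ a, g a - 2 * η (2 / L) ≤ φ a := fun a => le_ciInf fun b => by
    have hη0 := hη.nonneg (2 / L) (by positivity)
    rcases le_total (dist a b) (2 / L) with h | h
    · have := (abs_le.1 (hgη a b)).2
      have := hη.mono _ _ dist_nonneg h
      have : 0 ≤ L * dist a b := by positivity
      linarith
    · have := (abs_le.1 (hg1 a)).2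
      have := (abs_le.1 (hg1 b)).1
      have : 2 ≤ L * dist a b := by rwa [div_le_iff₀' hL0] at h
      linarith
  have h3 : ∀ a b, φ a - φ b ≤ L * dist a b := fun a b => by
    rw [sub_le_iff_le_add]
    refine le_trans ?_ (le_of_eq (add_comm _ _))
    rw [← sub_le_iff_le_add]
    refine le_ciInf fun e => ?_
    have h4 := ciInf_le (hbdd a) e
    have h5 := mul_le_mul_of_nonneg_left (dist_triangle a b e) hL0.le
    change φ a - _ ≤ _
    change φ a ≤ _ at h4
    linarith
  have h4 : ∀ a, |φ a| ≤ 1 := fun a => abs_le.2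
    ⟨le_ciInf fun b => by
      have := (abs_le.1 (hg1 b)).1
      have : 0 ≤ L * dist a b := by positivity
      linarith, (h1 a).trans (abs_le.1 (hg1 a)).2⟩
  have h5 : IsBL dist fun a => L⁻¹ * φ a := by
    refine ⟨fun a => ?_, fun a b => ?_⟩
    · rw [abs_mul, abs_of_pos (by positivity), inv_mul_le_iff₀ hL0]
      exact (h4 a).trans (by linarith)
    · rw [← mul_sub, abs_mul, abs_of_pos (by positivity), inv_mul_le_iff₀ hL0]
      refine abs_le.2 ⟨?_, h3 a b⟩
      have := h3 b a
      rw [dist_comm] at this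
      linarith
  have hφ : IsBb φ := by
    have := (h5.isBb isContDist_dist).const_mul L
    simpa [hL0.ne'] using this
  have h6 := le_blDist (μ := l) (ν := l') h5
  rw [integral_const_mul, integral_const_mul, ← mul_sub, abs_mul, abs_of_pos (by positivity),
    ← mul_assoc, mul_comm (1 / 2 : ℝ), mul_assoc, inv_mul_le_iff₀ hL0] at h6
  have e1 : ∀ l : ProbabilityMeasure A, ∫ a, φ a ∂(l : Measure A) ≤ ∫ a, g a ∂(l : Measure A) :=
    fun l => integral_mono (hφ.integrable _) (hg.integrable _) h1
  have e2 : ∀ l : ProbabilityMeasure A,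
      ∫ a, g a ∂(l : Measure A) - 2 * η (2 / L) ≤ ∫ a, φ a ∂(l : Measure A) := fun l => by
    have := integral_mono ((hg.sub (isBb_const (2 * η (2 / L)))).integrable (l : Measure A))
      (hφ.integrable _) h2
    rwa [integral_sub (hg.integrable _) (integrable_const _), integral_const, probReal_univ,
      one_smul] at this
  have := abs_le.1 (show |∫ a, φ a ∂(l : Measure A) - ∫ a, φ a ∂(l' : Measure A)| ≤
    2 * (L * blDist dist l l') by linarith)
  have : |∫ a, g a ∂(l : Measure A) - ∫ a, g a ∂(l' : Measure A)| ≤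
      2 * (L * blDist dist l l') + 2 * η (2 / L) :=
    abs_le.2 ⟨by linarith [e1 l, e2 l', e1 l', e2 l], by linarith [e1 l, e2 l', e1 l', e2 l]⟩
  linarith

end Actions

/-! ### Bounded differences -/

section BoundedDifferences

variable {Y Z : Type*} [MeasurableSpace Y] {N : ℕ}

/-- A change of the `n`-th coordinate changes `f` by at most `c n`. -/
def BddDiff (c : Fin N → ℝ) (f : (Fin N → Y) → ℝ) : Prop :=
  ∀ x n y z, |f (Function.update x n y) - f (Function.update x n z)| ≤ c n

theorem isBb_integral_prodLaw {W : Type*} [MeasurableSpace W] {f : W × (Fin N → Y) → ℝ}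
    (hf : IsBb f) {q : Fin N → W → ProbabilityMeasure Y} (hq : ∀ n, Measurable (q n)) :
    IsBb fun w => ∫ y, f (w, y) ∂prodLaw fun n => q n w :=
  isBb_integral_family hf
    (κ := fun w => ⟨prodLaw fun n => q n w, inferInstance⟩) (measurable_prodLaw hq).subtype_mk

/-- Product laws at a total-variation distance of at most `D n` in the `n`-th coordinate. -/
theorem BddDiff.abs_integral_sub_le {c : Fin N → ℝ} {f : (Fin N → Y) → ℝ} (h : BddDiff c f)
    (hf : IsBb f) (hc : ∀ n, 0 ≤ c n) {q κ : Fin N → ProbabilityMeasure Y} {D : Fin N → ℝ}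
    (hD : ∀ n, tvDist (κ n) (q n) ≤ D n) :
    |∫ x, f x ∂prodLaw κ - ∫ x, f x ∂prodLaw q| ≤ ∑ n, c n * D n :=
  abs_integral_prodLaw_sub_le q κ hf _ fun n x =>
    (abs_integral_sub_le_tvDist (hf.comp (measurable_update x)) (hc n) fun y z =>
      h x n y z).trans (mul_le_mul_of_nonneg_left (hD n) (hc n))

/-- Transitions that are independent over the coordinates preserve bounded differences. -/
theorem BddDiff.integral_prodLaw {c : Fin N → ℝ} {f : (Fin N → Y) → ℝ} (h : BddDiff c f)
    (hf : IsBb f) (hc : ∀ n, 0 ≤ c n) (q : Fin N → Z → ProbabilityMeasure Y) :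
    BddDiff c fun x : Fin N → Z => ∫ y, f y ∂prodLaw fun n => q n (x n) := by
  intro x n y z
  refine (h.abs_integral_sub_le hf hc (D := fun m => if m = n then 1 else 0)
    fun m => ?_).trans_eq (by simp)
  split_ifs with hm
  · exact tvDist_le_one
  · simp only [Function.update_of_ne hm]
    exact tvDist_le le_rfl (by simp)

end BoundedDifferences

theorem compose_succ_right {F : Type*} (op : ℕ → F → F) (k s : ℕ) (f : F) :
    compose op s (k + 1) f = compose op s k (op (s + k) f) := by
  induction k generalizing s with
  | zero => rfl
  | succ k ih =>
    change op s (compose op (s + 1) (k + 1) f) = op s (compose op (s + 1) k _)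
    rw [ih, Nat.add_right_comm, Nat.add_assoc]

theorem integral_mono_isBb {Y : Type*} [MeasurableSpace Y] {μ : Measure Y} [IsFiniteMeasure μ]
    {f g : Y → ℝ} (hf : IsBb f) (hg : IsBb g) (h : ∀ y, f y ≤ g y) :
    ∫ y, f y ∂μ ≤ ∫ y, g y ∂μ :=
  integral_mono (hf.integrable μ) (hg.integrable μ) h

namespace Game

/-! ### The dynamics of the `N`-player game and of the mean field -/

section Dynamics

variable {X A : Type*} [MeasurableSpace X] [MeasurableSpace A] (Γ : Game X A)

theorem measurable_Q_comp {Z : Type*} [MeasurableSpace Z] (t : ℕ) {x : Z → X}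
    {ξ : Z → ProbabilityMeasure X} {l : Z → ProbabilityMeasure A} (hx : Measurable x)
    (hξ : Measurable ξ) (hl : Measurable l) : Measurable fun z => Γ.Q t (x z) (ξ z) (l z) := by
  refine Measurable.subtype_mk (Measure.measurable_of_measurable_coe _ fun s hs => ?_)
  have hP : Measurable fun p : Z × A => (Γ.P t (x p.1, ξ p.1, p.2) : Measure X) s :=
    (Measure.measurable_coe hs).comp (measurable_subtype_coe.comp ((Γ.measurable_P t).comp
      ((hx.comp measurable_fst).prodMk ((hξ.comp measurable_fst).prodMk measurable_snd))))
  have h : ∀ z, ((l z : Measure A).bind fun a => (Γ.P t (x z, ξ z, a) : Measure X)) s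
      = ∫⁻ a, (Γ.P t (x z, ξ z, a) : Measure X) s ∂(l z : Measure A) := fun z =>
    Measure.bind_apply hs (measurable_subtype_coe.comp ((Γ.measurable_P t).comp
      (measurable_const.prodMk (measurable_const.prodMk measurable_id)))).aemeasurable
  simp only [h]
  exact Measurable.lintegral_kernel_prod_right' (κ := asKernel ⟨l, hl⟩) hP

theorem integral_Q (t : ℕ) (x : X) (ξ : ProbabilityMeasure X) (l : ProbabilityMeasure A)
    {f : X → ℝ} (hf : IsBb f) : ∫ y, f y ∂(Γ.Q t x ξ l : Measure X) =
      ∫ a, ∫ y, f y ∂(Γ.P t (x, ξ, a) : Measure X) ∂(l : Measure A) :=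
  integral_mix l _ hf

theorem lintegral_Q (t : ℕ) (x : X) (ξ : ProbabilityMeasure X) (l : ProbabilityMeasure A)
    {f : X → ℝ≥0∞} (hf : Measurable f) : ∫⁻ y, f y ∂(Γ.Q t x ξ l : Measure X) =
      ∫⁻ a, ∫⁻ y, f y ∂(Γ.P t (x, ξ, a) : Measure X) ∂(l : Measure A) :=
  lintegral_mix l _ hf

variable {N : ℕ} [NeZero N]

/-- The law of the next states in the `N`-player game, given the states `x` and the action laws
`l` of the players. -/
noncomputable abbrev jump (t : ℕ) (x : Fin N → X) (l : Fin N → ProbabilityMeasure A) :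
    Measure (Fin N → X) :=
  prodLaw fun n => Γ.Q t (x n) (emp x) (l n)

/-- The law of the next states if the players see the frozen mean field distribution instead of
the empirical one; the coordinates then move independently. -/
noncomputable abbrev meanJump (p : Fin N → ℕ → SymKernel X A) (t : ℕ) (x : Fin N → X) :
    Measure (Fin N → X) :=
  prodLaw fun n => Γ.Q t (x n) (Γ.xiBar p t) ((p n t).1 (x n, Γ.xiBar p t))

/-- The action laws chosen by the players with symmetric policies `p` at the states `x`. -/
noncomputable def actions (p : Fin N → ℕ → SymKernel X A) (t : ℕ) (x : Fin N → X) :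
    Fin N → ProbabilityMeasure A :=
  fun n => (p n t).1 (x n, emp x)

theorem measurable_actions (p : Fin N → ℕ → SymKernel X A) (t : ℕ) : Measurable (actions p t) :=
  measurable_pi_lambda _ fun n => ((p n t).toAction n).2

theorem isBb_integral_jump (t : ℕ) {l : (Fin N → X) → Fin N → ProbabilityMeasure A}
    (hl : Measurable l) {f : (Fin N → X) → ℝ} (hf : IsBb f) :
    IsBb fun x => ∫ y, f y ∂Γ.jump t x (l x) :=
  isBb_integral_prodLaw (hf.comp measurable_snd) fun n =>
    Γ.measurable_Q_comp t (measurable_pi_apply n) measurable_emp ((measurable_pi_apply n).comp hl)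

theorem isBb_integral_meanJump (p : Fin N → ℕ → SymKernel X A) (t : ℕ) {f : (Fin N → X) → ℝ}
    (hf : IsBb f) : IsBb fun x => ∫ y, f y ∂Γ.meanJump p t x :=
  isBb_integral_prodLaw (hf.comp measurable_snd) fun n =>
    (Γ.measurable_Q t (Γ.xiBar p t) ((p n t).freeze (Γ.xiBar p t))).comp (measurable_pi_apply n)

/-- The one-step transition kernel of the `N`-player game. -/
noncomputable def jumpKernel (p : Fin N → ℕ → SymKernel X A) (t : ℕ) :
    Kernel (Fin N → X) (Fin N → X) :=
  ⟨fun x => Γ.jump t x (actions p t x), measurable_prodLaw fun n =>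
    Γ.measurable_Q_comp t (measurable_pi_apply n) measurable_emp
      ((measurable_pi_apply n).comp (measurable_actions p t))⟩

instance (p : Fin N → ℕ → SymKernel X A) (t : ℕ) : IsMarkovKernel (Γ.jumpKernel p t) :=
  ⟨fun x => inferInstanceAs (IsProbabilityMeasure (Γ.jump t x (actions p t x)))⟩

/-- The joint law of the states at time `t` in the `N`-player game. (The value at time `0` is a
dummy.) -/
noncomputable def stateLaw (p : Fin N → ℕ → SymKernel X A) : ℕ → Measure (Fin N → X)
  | 0 => prodLaw fun _ => Γ.ξ₀
  | 1 => prodLaw fun _ => Γ.ξ₀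
  | t + 2 => (stateLaw p (t + 1)).bind (Γ.jumpKernel p (t + 1))

instance isProbabilityMeasure_stateLaw (p : Fin N → ℕ → SymKernel X A) :
    ∀ t, IsProbabilityMeasure (Γ.stateLaw p t)
  | 0 => inferInstanceAs (IsProbabilityMeasure (prodLaw fun _ => Γ.ξ₀))
  | 1 => inferInstanceAs (IsProbabilityMeasure (prodLaw fun _ => Γ.ξ₀))
  | t + 2 => by
    have := isProbabilityMeasure_stateLaw p (t + 1)
    exact isProbabilityMeasure_bind (Γ.jumpKernel p (t + 1)).aemeasurable
      (Eventually.of_forall fun x => inferInstance)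

theorem integral_stateLaw_succ (p : Fin N → ℕ → SymKernel X A) {t : ℕ} (ht : 1 ≤ t)
    {f : (Fin N → X) → ℝ} (hf : IsBb f) : ∫ x, f x ∂Γ.stateLaw p (t + 1) =
      ∫ x, ∫ y, f y ∂Γ.jump t x (actions p t x) ∂Γ.stateLaw p t := by
  obtain ⟨t, rfl⟩ := Nat.exists_eq_add_of_le' ht
  exact integral_bind_kernel _ _ hf

theorem lawT_eq_integral (p : Fin N → ℕ → SymKernel X A) {t : ℕ} (ht : 1 ≤ t)
    {f : (Fin N → X) → ℝ} (hf : IsBb f) :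
    Γ.lawT (toProfile p) t f = ∫ x, f x ∂Γ.stateLaw p t := by
  obtain ⟨k, rfl⟩ := Nat.exists_eq_add_of_le' ht
  clear ht
  induction k generalizing f with
  | zero => rfl
  | succ k ih =>
    rw [Γ.integral_stateLaw_succ p (Nat.le_add_left 1 k) hf,
      ← ih (Γ.isBb_integral_jump (k + 1) (measurable_actions p (k + 1)) hf)]
    simp only [lawT, Nat.add_sub_cancel]
    rw [compose_succ_right, Nat.add_comm 1 k]
    rfl

theorem playerLaw_succ (p : Fin N → ℕ → SymKernel X A) {t : ℕ} (ht : 1 ≤ t) (n : Fin N) :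
    Γ.playerLaw p (t + 1) n = mix (Γ.playerLaw p t n)
      ⟨fun x => Γ.Q t x (Γ.xiBar p t) (((p n t).freeze (Γ.xiBar p t)).1 x),
        Γ.measurable_Q t (Γ.xiBar p t) ((p n t).freeze (Γ.xiBar p t))⟩ := by
  obtain ⟨t, rfl⟩ := Nat.exists_eq_add_of_le' ht
  rfl

theorem integral_prodLaw_playerLaw_succ (p : Fin N → ℕ → SymKernel X A) {t : ℕ} (ht : 1 ≤ t)
    {f : (Fin N → X) → ℝ} (hf : IsBb f) : ∫ x, f x ∂prodLaw (Γ.playerLaw p (t + 1)) =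
      ∫ x, ∫ y, f y ∂Γ.meanJump p t x ∂prodLaw (Γ.playerLaw p t) := by
  have h := prodLaw_bind (Γ.playerLaw p t) fun n =>
    ⟨fun x => Γ.Q t x (Γ.xiBar p t) (((p n t).freeze (Γ.xiBar p t)).1 x),
        Γ.measurable_Q t (Γ.xiBar p t) ((p n t).freeze (Γ.xiBar p t))⟩
  simp only [← Γ.playerLaw_succ p ht] at h
  rw [show prodLaw (Γ.playerLaw p (t + 1)) = prodLaw fun n => Γ.playerLaw p (t + 1) n from rfl,
    ← h]
  exact integral_bind_kernel _ (asKernel ⟨fun x => ⟨Γ.meanJump p t x, inferInstance⟩,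
    (measurable_prodLaw fun n => (Γ.measurable_Q t (Γ.xiBar p t)
      ((p n t).freeze (Γ.xiBar p t))).comp (measurable_pi_apply n)).subtype_mk⟩) hf

/-- The backward evolution of a function under the independent mean field transitions. It keeps
bounded differences because the coordinates move independently. -/
theorem exists_mean_evolution (p : Fin N → ℕ → SymKernel X A) {r : ℕ} (hr : 1 ≤ r)
    {f : (Fin N → X) → ℝ} (hf : IsBb f) {c : Fin N → ℝ} (hc : ∀ n, 0 ≤ c n) (h : BddDiff c f) :
    ∃ J : ℕ → (Fin N → X) → ℝ, J r = f ∧ (∀ t, IsBb (J t)) ∧ (∀ t, BddDiff c (J t)) ∧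
      (∀ t, 1 ≤ t → t < r → J t = fun x => ∫ y, J (t + 1) y ∂Γ.meanJump p t x) ∧
      ∫ x, J 1 x ∂prodLaw (fun _ => Γ.ξ₀) = ∫ x, f x ∂prodLaw (Γ.playerLaw p r) := by
  let op : ℕ → ((Fin N → X) → ℝ) → (Fin N → X) → ℝ := fun t g x => ∫ y, g y ∂Γ.meanJump p t x
  have hcomp : ∀ k t, IsBb (compose op t k f) ∧ BddDiff c (compose op t k f) := by
    intro k
    induction k with
    | zero => exact fun t => ⟨hf, h⟩
    | succ k ih => exact fun t => ⟨Γ.isBb_integral_meanJump p t (ih (t + 1)).1,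
        (ih (t + 1)).2.integral_prodLaw (ih (t + 1)).1 hc fun n x =>
          Γ.Q t x (Γ.xiBar p t) ((p n t).1 (x, Γ.xiBar p t))⟩
  have hint : ∀ k t, 1 ≤ t → ∫ x, compose op t k f x ∂prodLaw (Γ.playerLaw p t) =
      ∫ x, f x ∂prodLaw (Γ.playerLaw p (t + k)) := by
    intro k
    induction k with
    | zero => exact fun t _ => rfl
    | succ k ih =>
      intro t ht
      rw [← Nat.add_assoc, Nat.add_right_comm, ← ih (t + 1) (by omega),
        Γ.integral_prodLaw_playerLaw_succ p ht (hcomp k (t + 1)).1]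
      rfl
  refine ⟨fun t => compose op t (r - t) f, by simp [compose], fun t => (hcomp _ t).1,
    fun t => (hcomp _ t).2, fun t _ ht => ?_, ?_⟩
  · simp only [show r - t = (r - (t + 1)) + 1 by omega]
    rfl
  · have := hint (r - 1) 1 le_rfl
    rwa [show 1 + (r - 1) = r by omega] at this

end Dynamics

/-! ### Tightness -/

section Tight

variable {X A : Type*} [MetricSpace X] [MeasurableSpace X] [BorelSpace X] [MeasurableSpace A]
  {Γ : Game X A} {K : ℕ → Set X} {N : ℕ} [NeZero N]

/-- The Lyapunov function keeps the mean field state distributions tight. -/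
theorem MomentTight.xiBar_compl_le (hK : Γ.MomentTight K) (p : Fin N → ℕ → SymKernel X A) {t : ℕ}
    (ht : 1 ≤ t) (htT : t ≤ Γ.T) {i : ℕ} (hi : 1 ≤ i) :
    (Γ.xiBar p t : Measure X).real (K i)ᶜ ≤ 1 / i := by
  obtain ⟨-, -, σ, hσc, hσ0, hσK, hσ1, hσP⟩ := hK
  have hm : Measurable fun y => ENNReal.ofReal (σ y) := hσc.measurable.ennreal_ofReal
  have h1 : ∀ n, ∫⁻ y, ENNReal.ofReal (σ y) ∂(Γ.playerLaw p t n : Measure X) ≤ 1 := by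
    induction t, ht using Nat.le_induction with
    | base => exact fun n => hσ1
    | succ t ht ih =>
      intro n
      rw [Γ.playerLaw_succ p ht, lintegral_mix _ _ hm]
      refine (lintegral_mono fun x => ?_).trans (ih (by omega) n)
      rw [Γ.lintegral_Q t x _ _ hm]
      refine (lintegral_mono fun a => hσP t ht (by omega) x _ a).trans ?_
      simp
  have h2 : ∫⁻ y, ENNReal.ofReal (σ y) ∂(Γ.xiBar p t : Measure X) ≤ 1 := by
    have hN : (N : ℝ≥0∞) ≠ 0 := by exact_mod_cast NeZero.ne N
    rw [xiBar, lintegral_avg]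
    calc _ ≤ (N : ℝ≥0∞)⁻¹ * ∑ _ : Fin N, 1 := by gcongr with n; exact h1 n
      _ = 1 := by simp [ENNReal.inv_mul_cancel hN]
  have hi' : (0 : ℝ) < i := by exact_mod_cast hi
  have h3 : (Γ.xiBar p t : Measure X) (K i)ᶜ ≤ ENNReal.ofReal (1 / i) := by
    calc (Γ.xiBar p t : Measure X) (K i)ᶜ
        ≤ (Γ.xiBar p t : Measure X) {y | ENNReal.ofReal i ≤ ENNReal.ofReal (σ y)} :=
          measure_mono fun y hy => ENNReal.ofReal_le_ofReal (hσK i y hy)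
      _ ≤ (∫⁻ y, ENNReal.ofReal (σ y) ∂(Γ.xiBar p t : Measure X)) / ENNReal.ofReal i :=
          meas_ge_le_lintegral_div hm.aemeasurable (by simpa using hi'.ne') ENNReal.ofReal_ne_top
      _ ≤ 1 / ENNReal.ofReal i := by gcongr
      _ = ENNReal.ofReal (1 / i) := by rw [ENNReal.ofReal_div_of_pos hi', ENNReal.ofReal_one]
  exact ENNReal.toReal_le_of_le_ofReal (by positivity) h3

end Tight

end Game

theorem le_mul_drift {η ϑ : ℝ → ℝ} (hη : IsModulus η) {e : ℕ → ℝ} {t : ℕ} {y c : ℝ} (hc : 0 ≤ c)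
    (h : ∀ L : ℝ, 0 < L → 1 + η (2 / L) < L → y ≤ c *
      (∑ s ∈ Finset.Ico 1 t, (L * hull ϑ (e s) + hull η (e s)) + ((t : ℝ) - 1) * η (2 / L))) :
    y ≤ c * drift η ϑ e t := by
  rcases hc.eq_or_lt with rfl | hc
  · obtain ⟨L, h1, h2, -⟩ := exists_slope hη one_pos
    simpa using h L h1 h2
  · rw [← div_le_iff₀' hc]
    exact le_drift hη fun L h1 h2 => (div_le_iff₀' hc).2 (h L h1 h2)

section Modulus

variable {Y : Type*} [MeasurableSpace Y] {β : ℝ → ℝ} (hβ : IsModulus β) {f : Y → ℝ} (hf : IsBb f)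
  (hf0 : ∀ y, 0 ≤ f y)
include hβ hf hf0

theorem IsModulus.isBb_comp : IsBb fun y => β (f y) := by
  obtain ⟨hm, C, hC⟩ := hf
  have hmono : Monotone fun s : ℝ => β (max s 0) := fun s r hsr =>
    hβ.mono _ _ (le_max_right _ _) (max_le_max_right 0 hsr)
  refine ⟨?_, β C, fun y => ?_⟩
  · have h : (fun y => β (f y)) = fun y => β (max (f y) 0) := by
      funext y
      rw [max_eq_left (hf0 y)]
    rw [h]
    exact hmono.measurable.comp hm
  · rw [abs_of_nonneg (hβ.nonneg _ (hf0 y))]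
    exact hβ.mono _ _ (hf0 y) ((le_abs_self _).trans (hC y))

/-- Jensen's inequality for the concave hull of a modulus. -/
theorem IsModulus.integral_comp_le_hull {μ : Measure Y} [IsProbabilityMeasure μ] {e : ℝ}
    (he : ∫ y, f y ∂μ ≤ e) : ∫ y, β (f y) ∂μ ≤ hull β e := by
  refine hβ.le_hull fun a b hab => ?_
  have hb := hf.const_mul a
  calc ∫ y, β (f y) ∂μ ≤ ∫ y, (a * f y + b) ∂μ :=
        integral_mono_isBb (hβ.isBb_comp hf hf0) (hb.add (isBb_const b)) fun y =>
          hab.le _ (hf0 y)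
    _ = a * ∫ y, f y ∂μ + b := by
        rw [integral_add (hb.integrable _) (integrable_const _), integral_const_mul]
        simp
    _ ≤ a * e + b := by
        have := mul_le_mul_of_nonneg_left he hab.slope_nonneg
        linarith

end Modulus

namespace Game

section Estimates

variable {X A : Type*} [MetricSpace X] [SecondCountableTopology X] [MeasurableSpace X]
  [BorelSpace X] [MetricSpace A] [MeasurableSpace A] [BorelSpace A] {Γ : Game X A}
  {η ϑ : ℝ → ℝ} {K : ℕ → Set X} {N : ℕ} [NeZero N] {p : Fin N → ℕ → SymKernel X A}

/-! ### One-step comparison with the independent system -/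

omit [SecondCountableTopology X] [BorelSpace X] in
theorem PCont.tvDist_Q_le (hP : Γ.PCont η) (hη : IsModulus η) {t : ℕ} (ht : 1 ≤ t)
    (htT : t < Γ.T) {L : ℝ} (hL : 1 ≤ L) (x : X) (ξ ξ' : ProbabilityMeasure X)
    (l l' : ProbabilityMeasure A) : tvDist (Γ.Q t x ξ l) (Γ.Q t x ξ' l') ≤
      η (blDist dist ξ ξ') + L * blDist dist l l' + η (2 / L) := by
  have hL0 : 0 < L := by linarith
  have h1 := hη.nonneg (2 / L) (by positivity)
  have h2 := hη.nonneg (blDist dist ξ ξ') blDist_nonneg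
  have h3 : 0 ≤ L * blDist dist l l' := mul_nonneg hL0.le blDist_nonneg
  refine tvDist_le (by positivity) fun h hm hh => ?_
  have hb : IsBb h := ⟨hm, 1, hh⟩
  have hg (ξ : ProbabilityMeasure X) : IsBb fun a => ∫ y, h y ∂(Γ.P t (x, ξ, a) : Measure X) :=
    isBb_integral_family (hb.comp measurable_snd) ((Γ.measurable_P t).comp
      (measurable_const.prodMk (measurable_const.prodMk measurable_id)))
  have htv (ξ ξ' : ProbabilityMeasure X) (a a' : A) :
      |∫ y, h y ∂(Γ.P t (x, ξ, a) : Measure X) - ∫ y, h y ∂(Γ.P t (x, ξ', a') : Measure X)| ≤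
        2 * (η (dist a a') + η (blDist dist ξ ξ')) := by
    have := (le_tvDist hm hh).trans (hP t ht htT x ξ ξ' a a')
    linarith
  rw [Γ.integral_Q t x ξ l hb, Γ.integral_Q t x ξ' l' hb]
  have e1 := half_abs_integral_sub_le_of_modulus hη (hg ξ')
    (fun a => abs_integral_le_of_bound hh) (fun a b => by
      simpa [blDist_self, hη.zero] using htv ξ' ξ' a b) hL l l'
  have e2 : |∫ a, ∫ y, h y ∂(Γ.P t (x, ξ, a) : Measure X) ∂(l : Measure A) -
      ∫ a, ∫ y, h y ∂(Γ.P t (x, ξ', a) : Measure X) ∂(l : Measure A)| ≤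
        2 * η (blDist dist ξ ξ') := by
    rw [← integral_sub ((hg ξ).integrable _) ((hg ξ').integrable _)]
    exact abs_integral_le_of_bound fun a => by simpa [hη.zero] using htv ξ ξ' a a
  have e3 := abs_sub_le (∫ a, ∫ y, h y ∂(Γ.P t (x, ξ, a) : Measure X) ∂(l : Measure A))
    (∫ a, ∫ y, h y ∂(Γ.P t (x, ξ', a) : Measure X) ∂(l : Measure A))
    (∫ a, ∫ y, h y ∂(Γ.P t (x, ξ', a) : Measure X) ∂(l' : Measure A))
  linarith

/-- The distance of the empirical state distribution to the mean field one. -/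
noncomputable abbrev empDev (Γ : Game X A) (p : Fin N → ℕ → SymKernel X A) (t : ℕ)
    (x : Fin N → X) : ℝ :=
  blDist dist (emp x) (Γ.xiBar p t)

omit [MetricSpace A] [BorelSpace A] in
theorem isBb_empDev (t : ℕ) : IsBb (Γ.empDev p t) := isBb_blDist_emp isContDist_dist _

omit [SecondCountableTopology X] [MetricSpace A] [BorelSpace A] in
theorem bddDiff_empDev (t : ℕ) : BddDiff (fun _ => 1 / (N : ℝ)) (Γ.empDev p t) := by
  intro x n y z
  have hN := natCast_pos (N := N)
  refine (abs_blDist_emp_update_sub_le isContDist_dist x n y z _).trans ?_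
  calc 1 / (2 * (N : ℝ)) * min 2 (max (dist y z) 0) ≤ 1 / (2 * (N : ℝ)) * 2 := by
        gcongr; exact min_le_left _ _
    _ = 1 / N := by field_simp

/-- The price of freezing the population distribution in the transition of a player, at the
states `x`, as a function of the slope `L`. -/
noncomputable def freezeCost (Γ : Game X A) (η ϑ : ℝ → ℝ) (p : Fin N → ℕ → SymKernel X A) (L : ℝ)
    (t : ℕ) (x : Fin N → X) : ℝ :=
  η (Γ.empDev p t x) + L * ϑ (Γ.empDev p t x) + η (2 / L)

omit [SecondCountableTopology X] [BorelSpace X] [BorelSpace A] [MetricSpace A] in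
theorem freezeCost_nonneg (hη : IsModulus η) (hϑ : IsModulus ϑ) {L : ℝ} (hL : 1 ≤ L) (t : ℕ)
    (x : Fin N → X) : 0 ≤ Γ.freezeCost η ϑ p L t x := by
  have := hη.nonneg (2 / L) (by positivity)
  have := hη.nonneg _ (blDist_nonneg (d := dist) (μ := emp x) (ν := Γ.xiBar p t))
  have := hϑ.nonneg _ (blDist_nonneg (d := dist) (μ := emp x) (ν := Γ.xiBar p t))
  unfold freezeCost
  positivity

omit [SecondCountableTopology X] [BorelSpace X] in
theorem PCont.tvDist_freeze_le (hP : Γ.PCont η) (hη : IsModulus η)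
    (hp : SymContProfile Γ.T ϑ p) {t : ℕ} (ht : 1 ≤ t) (htT : t < Γ.T) {L : ℝ} (hL : 1 ≤ L)
    (x : Fin N → X) (n : Fin N) :
    tvDist (Γ.Q t (x n) (emp x) (actions p t x n))
      (Γ.Q t (x n) (Γ.xiBar p t) ((p n t).1 (x n, Γ.xiBar p t))) ≤
        Γ.freezeCost η ϑ p L t x := by
  refine (hP.tvDist_Q_le hη ht htT hL _ _ _ _ _).trans ?_
  have := mul_le_mul_of_nonneg_left (hp n t ht htT (x n) (emp x) (Γ.xiBar p t))
    (zero_le_one.trans hL)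
  unfold freezeCost actions
  linarith

omit [SecondCountableTopology X] [BorelSpace X] in
/-- One step of the game against one step of the independent system. -/
theorem PCont.abs_integral_jump_sub_le (hP : Γ.PCont η) (hη : IsModulus η)
    (hp : SymContProfile Γ.T ϑ p) {t : ℕ} (ht : 1 ≤ t) (htT : t < Γ.T) {L : ℝ} (hL : 1 ≤ L)
    {f : (Fin N → X) → ℝ} (hf : IsBb f) {c : Fin N → ℝ} (hc : ∀ n, 0 ≤ c n) (h : BddDiff c f)
    (x : Fin N → X) :
    |∫ y, f y ∂Γ.jump t x (actions p t x) - ∫ y, f y ∂Γ.meanJump p t x| ≤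
      (∑ n, c n) * Γ.freezeCost η ϑ p L t x := by
  rw [Finset.sum_mul]
  exact h.abs_integral_sub_le hf hc fun n => hP.tvDist_freeze_le hη hp ht htT hL x n

omit [SecondCountableTopology X] [BorelSpace X] in
/-- If player `1` deviates, only its own transition changes, and this moves a function whose
differences are bounded by `1 / N` by at most `1 / N`. -/
theorem PCont.integral_jump_update_le (hP : Γ.PCont η) (hη : IsModulus η) (hϑ : IsModulus ϑ)
    (hp : SymContProfile Γ.T ϑ p) {t : ℕ} (ht : 1 ≤ t) (htT : t < Γ.T) {L : ℝ} (hL : 1 ≤ L)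
    {f : (Fin N → X) → ℝ} (hf : IsBb f) (h : BddDiff (fun _ => 1 / (N : ℝ)) f)
    (x : Fin N → X) (l : ProbabilityMeasure A) :
    ∫ y, f y ∂Γ.jump t x (Function.update (actions p t x) 0 l) ≤
      ∫ y, f y ∂Γ.meanJump p t x + (Γ.freezeCost η ϑ p L t x + 1 / N) := by
  have hN := natCast_pos (N := N)
  have hD0 := freezeCost_nonneg (Γ := Γ) (p := p) hη hϑ hL t x
  have h1 := h.abs_integral_sub_le hf (fun _ => by positivity)
    (κ := fun n => Γ.Q t (x n) (emp x) (Function.update (actions p t x) 0 l n))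
    (q := fun n => Γ.Q t (x n) (Γ.xiBar p t) ((p n t).1 (x n, Γ.xiBar p t)))
    (D := fun n => Γ.freezeCost η ϑ p L t x + if n = 0 then 1 else 0) fun n => by
      by_cases hn : n = 0
      · simp only [hn, if_true]
        exact tvDist_le_one.trans (by linarith)
      · simp only [hn, if_false, add_zero, ne_eq, not_false_eq_true, Function.update_of_ne]
        exact hP.tvDist_freeze_le hη hp ht htT hL x n
  have h2 : ∑ n : Fin N, 1 / (N : ℝ) * (Γ.freezeCost η ϑ p L t x + if n = 0 then 1 else 0) =
      Γ.freezeCost η ϑ p L t x + 1 / N := by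
    rw [← Finset.mul_sum, Finset.sum_add_distrib]
    simp
    field_simp
  rw [h2] at h1
  linarith [(abs_le.1 h1).2]

/-! ### Supersolutions under deviations of player `1` -/

/-- `Φ` decreases in mean along the game up to time `r`, whatever player `1` does. Such a `Φ`
bounds the expectation of `Φ r` at time `r` uniformly over all deviations of player `1`, without
any measurable selection of deviations. -/
structure IsSupersolution (Γ : Game X A) (p : Fin N → ℕ → SymKernel X A) (r : ℕ)
    (Φ : ℕ → (Fin N → X) → ℝ) : Prop where
  isBb : ∀ t, IsBb (Φ t)
  step : ∀ t, 1 ≤ t → t < r → ∀ x l,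
    ∫ y, Φ (t + 1) y ∂Γ.jump t x (Function.update (actions p t x) 0 l) ≤ Φ t x

/-- `f` at time `r` has an expectation of at most `z`, uniformly over all deviations of player
`1`, as witnessed by a supersolution. -/
def DevBound (Γ : Game X A) (p : Fin N → ℕ → SymKernel X A) (r : ℕ) (f : (Fin N → X) → ℝ)
    (z : ℝ) : Prop :=
  ∃ Φ, Γ.IsSupersolution p r Φ ∧ (∀ x, f x ≤ Φ r x) ∧ ∫ x, Φ 1 x ∂prodLaw (fun _ => Γ.ξ₀) ≤ z

omit [SecondCountableTopology X] [BorelSpace X] [BorelSpace A] [MetricSpace A] [MetricSpace X] in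
theorem IsSupersolution.integral_stateLaw_le {r : ℕ} {Φ : ℕ → (Fin N → X) → ℝ}
    (h : Γ.IsSupersolution p r Φ) {t : ℕ} (ht : 1 ≤ t) (htr : t ≤ r) :
    ∫ x, Φ t x ∂Γ.stateLaw p t ≤ ∫ x, Φ 1 x ∂prodLaw fun _ => Γ.ξ₀ := by
  induction t, ht using Nat.le_induction with
  | base => exact le_rfl
  | succ t ht ih =>
    refine le_trans ?_ (ih (by omega))
    rw [Γ.integral_stateLaw_succ p ht (h.isBb _)]
    refine integral_mono_isBb (Γ.isBb_integral_jump t (measurable_actions p t) (h.isBb _))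
      (h.isBb t) fun x => ?_
    have := h.step t ht (by omega) x (actions p t x 0)
    rwa [Function.update_eq_self] at this

omit [SecondCountableTopology X] [BorelSpace X] [BorelSpace A] [MetricSpace A] in
/-- Jensen's inequality for the concave hull, in terms of affine majorants. -/
theorem DevBound.hull {β : ℝ → ℝ} (hβ : IsModulus β) {r : ℕ} {e z : ℝ}
    (h : ∀ y, e < y → Γ.DevBound p r (Γ.empDev p r) y) (hz : hull β e < z) :
    Γ.DevBound p r (fun x => β (Γ.empDev p r x)) z := by
  obtain ⟨a, b, hab, hlt⟩ := hβ.exists_majorant_lt hz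
  have ha := hab.slope_nonneg
  obtain ⟨Φ, hΦ, hle, hint⟩ := h (e + (z - (a * e + b)) / (a + 1)) (by
    have : 0 < (z - (a * e + b)) / (a + 1) := div_pos (by linarith) (by linarith)
    linarith)
  refine ⟨fun t x => a * Φ t x + b, ⟨fun t => ((hΦ.isBb t).const_mul a).add (isBb_const b),
    fun t h1 h2 x l => ?_⟩, fun x => ?_, ?_⟩
  · rw [integral_add (((hΦ.isBb _).const_mul a).integrable _) (integrable_const b),
      integral_const_mul, integral_const, probReal_univ, one_smul]
    have := mul_le_mul_of_nonneg_left (hΦ.step t h1 h2 x l) ha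
    linarith
  · exact (hab.le _ blDist_nonneg).trans (by
      have := mul_le_mul_of_nonneg_left (hle x) ha
      linarith)
  · rw [integral_add (((hΦ.isBb _).const_mul a).integrable _) (integrable_const b),
      integral_const_mul, integral_const, probReal_univ, one_smul]
    have h1 := mul_le_mul_of_nonneg_left hint ha
    have h2 : a * ((z - (a * e + b)) / (a + 1)) ≤ z - (a * e + b) := by
      rw [mul_div_assoc', div_le_iff₀ (by linarith)]
      nlinarith
    rw [mul_add] at h1
    linarith

/-- The error of the empirical state distribution, uniformly over the deviations of player `1`. The
supersolution is the evolution of the deviation under the independent transitions, plus a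
supersolution for each of the costs, at the times before `r`, of replacing the transitions of the
game by the independent ones. -/
theorem devBound_empDev (hη : IsModulus η) (hϑ : IsModulus ϑ) (hK : Γ.MomentTight K)
    (hP : Γ.PCont η) (hp : SymContProfile Γ.T ϑ p) {r : ℕ} (hr : 1 ≤ r) (hrT : r ≤ Γ.T) {z : ℝ}
    (hz : stateErr η ϑ K N r < z) : Γ.DevBound p r (Γ.empDev p r) z := by
  have hN := natCast_pos (N := N)
  induction r using Nat.strong_induction_on generalizing z with
  | _ r ih =>
    have hrate : ∫ x, Γ.empDev p r x ∂prodLaw (Γ.playerLaw p r) ≤ rate dist K N :=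
      integral_blDist_emp_avg_le isContDist_dist hK.2.1 (fun i => (hK.2.1 i).measurableSet) _
        fun i hi => hK.xiBar_compl_le p hr hrT hi
    obtain ⟨J, hJr, hJb, hJd, hJ, hJ1⟩ := Γ.exists_mean_evolution p hr (isBb_empDev (p := p) r)
      (fun _ => by positivity) (bddDiff_empDev r)
    rcases hr.eq_or_lt with rfl | hr2
    · refine ⟨J, ⟨hJb, fun t h1 h2 => by omega⟩, fun x => by rw [hJr], ?_⟩
      rw [hJ1]
      exact hrate.trans (by simpa [stateErr, errE_one] using hz.le)
    have hz' : 2 * drift η ϑ (stateErr η ϑ K N) r + (r : ℝ) / N + rate dist K N < z := by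
      rw [stateErr, errE_eq _ _ _ _ hr2] at hz
      exact hz
    have he0 : ∀ s, 1 ≤ s → 0 ≤ stateErr η ϑ K N s := fun s hs => stateErr_nonneg hη N hs
    have hd0 := drift_nonneg (ϑ := ϑ) hη he0 hr
    obtain ⟨L, hL0, hL1, hL⟩ := exists_drift_lt (ϑ := ϑ) (e := stateErr η ϑ K N) (t := r)
      (z := z - (r : ℝ) / N - rate dist K N) hη (by linarith)
    have hL1' : 1 ≤ L := by linarith [hη.nonneg (2 / L) (by positivity)]
    have hr' : (1 : ℝ) ≤ r := by exact_mod_cast hr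
    -- the slack in the choice of `L` is distributed over the times before `r`
    obtain ⟨δ, hδ0, hδ⟩ : ∃ δ : ℝ, 0 < δ ∧ ((r : ℝ) - 1) * ((L + 1) * δ) ≤
        z - (r : ℝ) / N - rate dist K N - (∑ s ∈ Finset.Ico 1 r,
          (L * MFG.hull ϑ (stateErr η ϑ K N s) + MFG.hull η (stateErr η ϑ K N s)) +
            ((r : ℝ) - 1) * η (2 / L)) := by
      set w := z - (r : ℝ) / N - rate dist K N - (∑ s ∈ Finset.Ico 1 r,
          (L * MFG.hull ϑ (stateErr η ϑ K N s) + MFG.hull η (stateErr η ϑ K N s)) +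
            ((r : ℝ) - 1) * η (2 / L)) with hw
      have hw0 : 0 < w := by linarith
      refine ⟨w / (r * (L + 1)), by positivity, ?_⟩
      calc ((r : ℝ) - 1) * ((L + 1) * (w / (r * (L + 1))))
          ≤ r * ((L + 1) * (w / (r * (L + 1)))) := by gcongr; linarith
        _ = w := by field_simp
    have hcert : ∀ {β : ℝ → ℝ}, IsModulus β → ∀ s, ∃ Φ : ℕ → (Fin N → X) → ℝ,
        s ∈ Finset.Ico 1 r → Γ.IsSupersolution p s Φ ∧ (∀ x, β (Γ.empDev p s x) ≤ Φ s x) ∧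
          ∫ x, Φ 1 x ∂prodLaw (fun _ => Γ.ξ₀) ≤ MFG.hull β (stateErr η ϑ K N s) + δ := by
      intro β hβ s
      by_cases hs : s ∈ Finset.Ico 1 r
      · have hs' := Finset.mem_Ico.1 hs
        obtain ⟨Φ, hΦ⟩ := DevBound.hull hβ (fun y hy => ih s hs'.2 hs'.1 (by omega) hy)
          (lt_add_of_pos_right (MFG.hull β (stateErr η ϑ K N s)) hδ0)
        exact ⟨Φ, fun _ => hΦ⟩
      · exact ⟨fun _ _ => 0, fun h => absurd h hs⟩
    choose Φ hΦ using hcert hϑ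
    choose Ψ hΨ using hcert hη
    -- a supersolution for the cost of freezing the population at time `s` while player `1` deviates
    let G : ℕ → ℕ → (Fin N → X) → ℝ := fun s t x =>
      L * Φ s t x + Ψ s t x + (η (2 / L) + 1 / N)
    have hGb : ∀ s ∈ Finset.Ico 1 r, ∀ t, IsBb (G s t) := fun s hs t =>
      ((((hΦ s hs).1.isBb t).const_mul L).add ((hΨ s hs).1.isBb t)).add (isBb_const _)
    have hGint : ∀ s ∈ Finset.Ico 1 r, ∀ (t : ℕ) (μ : Measure (Fin N → X))
        [IsProbabilityMeasure μ], ∫ x, G s t x ∂μ =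
          L * ∫ x, Φ s t x ∂μ + ∫ x, Ψ s t x ∂μ + (η (2 / L) + 1 / N) := fun s hs t μ _ => by
      have e1 := (((hΦ s hs).1.isBb t).const_mul L).integrable μ
      have e2 := ((hΨ s hs).1.isBb t).integrable μ
      have e3 : Integrable (fun x => L * Φ s t x + Ψ s t x) μ := e1.add e2
      change ∫ x, (L * Φ s t x + Ψ s t x + (η (2 / L) + 1 / N)) ∂μ = _
      rw [integral_add e3 (integrable_const _), integral_add e1 e2, integral_const_mul,
        integral_const, probReal_univ, one_smul]
    have hsub : ∀ {t s}, 1 ≤ t → s ∈ Finset.Ico t r → s ∈ Finset.Ico 1 r := fun ht hs =>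
      Finset.mem_Ico.2 ⟨ht.trans (Finset.mem_Ico.1 hs).1, (Finset.mem_Ico.1 hs).2⟩
    refine ⟨fun t x => J t x + ∑ s ∈ Finset.Ico (max t 1) r, G s t x, ⟨fun t => (hJb t).add
      (isBb_finset_sum _ fun s hs => hGb s (hsub (le_max_right _ _) hs) t), fun t h1 h2 x l => ?_⟩,
      fun x => by simp [hJr, hr], ?_⟩
    · rw [max_eq_left h1, max_eq_left (by omega), integral_add ((hJb _).integrable _)
        ((isBb_finset_sum _ fun s hs => hGb s (hsub (by omega) hs) (t + 1)).integrable _),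
        integral_finsetSum _ fun s hs => (hGb s (hsub (by omega) hs) (t + 1)).integrable _,
        Finset.sum_eq_sum_Ico_succ_bot h2]
      have htr := Finset.mem_Ico.2 ⟨h1, h2⟩
      have e1 := hP.integral_jump_update_le hη hϑ hp h1 (by omega) hL1' (hJb (t + 1))
        (hJd (t + 1)) x l
      have e2 : J t x = ∫ y, J (t + 1) y ∂Γ.meanJump p t x := congrFun (hJ t h1 h2) x
      have e3 : Γ.freezeCost η ϑ p L t x + 1 / N ≤ G t t x := by
        have := mul_le_mul_of_nonneg_left ((hΦ t htr).2.1 x) hL0.le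
        have := (hΨ t htr).2.1 x
        simp only [freezeCost, G]
        linarith
      have e4 : ∑ s ∈ Finset.Ico (t + 1) r, ∫ y, G s (t + 1) y
          ∂Γ.jump t x (Function.update (actions p t x) 0 l) ≤ ∑ s ∈ Finset.Ico (t + 1) r,
            G s t x := Finset.sum_le_sum fun s hs => by
        have hs1 := hsub (t := t + 1) (by omega) hs
        have hst : t < s := (Finset.mem_Ico.1 hs).1
        rw [hGint s hs1]
        have := mul_le_mul_of_nonneg_left ((hΦ s hs1).1.step t h1 hst x l) hL0.le
        have := (hΨ s hs1).1.step t h1 hst x l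
        simp only [G]
        linarith
      linarith
    · change ∫ x, (J 1 x + ∑ s ∈ Finset.Ico 1 r, G s 1 x) ∂prodLaw (fun _ => Γ.ξ₀) ≤ z
      rw [integral_add ((hJb _).integrable _)
        ((isBb_finset_sum _ fun s hs => hGb s hs 1).integrable _),
        integral_finsetSum _ fun s hs => (hGb s hs 1).integrable _, hJ1]
      have e1 : ∑ s ∈ Finset.Ico 1 r, ∫ x, G s 1 x ∂prodLaw (fun _ => Γ.ξ₀) ≤
          ∑ s ∈ Finset.Ico 1 r, (L * MFG.hull ϑ (stateErr η ϑ K N s) +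
            MFG.hull η (stateErr η ϑ K N s) + ((L + 1) * δ + η (2 / L) + 1 / N)) :=
        Finset.sum_le_sum fun s hs => by
          rw [hGint s hs]
          have := mul_le_mul_of_nonneg_left (hΦ s hs).2.2 hL0.le
          have := (hΨ s hs).2.2
          linarith
      rw [Finset.sum_add_distrib, Finset.sum_const, Nat.card_Ico, nsmul_eq_mul,
        Nat.cast_sub hr] at e1
      have e2 : ((r : ℝ) - 1) * (1 / N) ≤ (r : ℝ) / N := by
        rw [mul_one_div]
        gcongr
        linarith
      push_cast at e1
      rw [mul_add, mul_add] at e1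
      linarith

theorem integral_empDev_le (hη : IsModulus η) (hϑ : IsModulus ϑ) (hK : Γ.MomentTight K)
    (hP : Γ.PCont η) (hp : SymContProfile Γ.T ϑ p) {t : ℕ} (ht : 1 ≤ t) (htT : t ≤ Γ.T) :
    ∫ x, Γ.empDev p t x ∂Γ.stateLaw p t ≤ stateErr η ϑ K N t := by
  refine le_of_forall_gt_imp_ge_of_dense fun z hz => ?_
  obtain ⟨Φ, hΦ, h1, h2⟩ := devBound_empDev hη hϑ hK hP hp ht htT hz
  exact (integral_mono_isBb (isBb_empDev t) (hΦ.isBb t) h1).trans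
    ((hΦ.integral_stateLaw_le ht le_rfl).trans h2)

omit [MetricSpace A] [BorelSpace A] in
theorem isBb_freezeCost (hη : IsModulus η) (hϑ : IsModulus ϑ) (L : ℝ) (t : ℕ) :
    IsBb (Γ.freezeCost η ϑ p L t) :=
  ((hη.isBb_comp (isBb_empDev t) fun _ => blDist_nonneg).add ((hϑ.isBb_comp (isBb_empDev t)
    fun _ => blDist_nonneg).const_mul L)).add (isBb_const _)

theorem integral_freezeCost_le (hη : IsModulus η) (hϑ : IsModulus ϑ) (hK : Γ.MomentTight K)
    (hP : Γ.PCont η) (hp : SymContProfile Γ.T ϑ p) {L : ℝ} (hL : 1 ≤ L) {t : ℕ} (ht : 1 ≤ t)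
    (htT : t ≤ Γ.T) : ∫ x, Γ.freezeCost η ϑ p L t x ∂Γ.stateLaw p t ≤
      L * hull ϑ (stateErr η ϑ K N t) + hull η (stateErr η ϑ K N t) + η (2 / L) := by
  have hb := isBb_empDev (Γ := Γ) (p := p) t
  have he := integral_empDev_le hη hϑ hK hP hp ht htT
  have h1 := hη.isBb_comp hb fun _ => blDist_nonneg
  have h2 := hϑ.isBb_comp hb fun _ => blDist_nonneg
  have e1 := hη.integral_comp_le_hull hb (fun _ => blDist_nonneg) he
  have e2 := hϑ.integral_comp_le_hull hb (fun _ => blDist_nonneg) he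
  have e3 := mul_le_mul_of_nonneg_left e2 (zero_le_one.trans hL)
  unfold freezeCost
  rw [integral_add ((h1.add (h2.const_mul L)).integrable _) (integrable_const _),
    integral_add (h1.integrable _) ((h2.const_mul L).integrable _), integral_const_mul,
    integral_const, probReal_univ, one_smul]
  linarith

/-- The joint law of the states against the product of the mean field laws, tested on functions
with bounded differences. The transitions of the game are replaced by the independent ones at one
time after the other. -/
theorem abs_integral_stateLaw_sub_le (hη : IsModulus η) (hϑ : IsModulus ϑ)
    (hK : Γ.MomentTight K) (hP : Γ.PCont η) (hp : SymContProfile Γ.T ϑ p) {t : ℕ} (ht : 1 ≤ t)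
    (htT : t ≤ Γ.T) {f : (Fin N → X) → ℝ} (hf : IsBb f) {c : Fin N → ℝ} (hc : ∀ n, 0 ≤ c n)
    (h : BddDiff c f) :
    |∫ x, f x ∂Γ.stateLaw p t - ∫ x, f x ∂prodLaw (Γ.playerLaw p t)| ≤
      (∑ n, c n) * drift η ϑ (stateErr η ϑ K N) t := by
  have hC : 0 ≤ ∑ n, c n := Finset.sum_nonneg fun n _ => hc n
  refine le_mul_drift hη hC fun L hL0 hL1 => ?_
  have hL1' : 1 ≤ L := by linarith [hη.nonneg (2 / L) (by positivity)]
  induction t, ht using Nat.le_induction generalizing f with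
  | base => simp [stateLaw, playerLaw]
  | succ t ht ih =>
    have hfm := Γ.isBb_integral_meanJump p t hf
    have hfj := Γ.isBb_integral_jump t (measurable_actions p t) hf
    have h1 := ih (by omega) hfm (h.integral_prodLaw hf hc fun n x =>
      Γ.Q t x (Γ.xiBar p t) ((p n t).1 (x, Γ.xiBar p t)))
    rw [← Γ.integral_prodLaw_playerLaw_succ p ht hf] at h1
    rw [Γ.integral_stateLaw_succ p ht hf, Finset.sum_Ico_succ_top ht]
    have h2 : |∫ x, ∫ y, f y ∂Γ.jump t x (actions p t x) ∂Γ.stateLaw p t -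
        ∫ x, ∫ y, f y ∂Γ.meanJump p t x ∂Γ.stateLaw p t| ≤ (∑ n, c n) *
          (L * hull ϑ (stateErr η ϑ K N t) + hull η (stateErr η ϑ K N t) + η (2 / L)) := by
      rw [← integral_sub (hfj.integrable _) (hfm.integrable _)]
      refine abs_integral_le_integral_abs.trans ((integral_mono_isBb (hfj.sub hfm).abs
        ((isBb_freezeCost hη hϑ L t).const_mul (∑ n, c n)) fun x =>
          hP.abs_integral_jump_sub_le hη hp ht (by omega) hL1' hf hc h x).trans ?_)
      rw [integral_const_mul]
      exact mul_le_mul_of_nonneg_left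
        (integral_freezeCost_le hη hϑ hK hP hp hL1' ht (by omega)) hC
    have h4 := abs_sub_le (∫ x, ∫ y, f y ∂Γ.jump t x (actions p t x) ∂Γ.stateLaw p t)
      (∫ x, ∫ y, f y ∂Γ.meanJump p t x ∂Γ.stateLaw p t)
      (∫ x, f x ∂prodLaw (Γ.playerLaw p (t + 1)))
    refine h4.trans ((add_le_add h2 h1).trans_eq ?_)
    push_cast
    ring

end Estimates

end Game

theorem two_mul_drift_add_rate_le {X : Type*} [MetricSpace X] {η : ℝ → ℝ} (ϑ : ℝ → ℝ)
    (hη : IsModulus η) (K : ℕ → Set X) (N : ℕ) {t : ℕ} (ht : 1 ≤ t) :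
    2 * drift η ϑ (stateErr η ϑ K N) t + rate dist K N ≤ stateErr η ϑ K N t := by
  rcases ht.eq_or_lt with rfl | ht
  · obtain ⟨L, h1, h2, -⟩ := exists_slope hη one_pos
    have := drift_le (ϑ := ϑ) (e := stateErr η ϑ K N) hη (fun s hs => stateErr_nonneg hη N hs)
      le_rfl h1 h2
    simp only [Finset.Ico_self, Finset.sum_empty, Nat.cast_one, sub_self, zero_mul,
      add_zero] at this
    simp only [stateErr, errE_one] at this ⊢
    linarith
  · have h1 : (0 : ℝ) ≤ (t : ℝ) / N := by positivity
    have h2 : stateErr η ϑ K N t =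
        2 * drift η ϑ (stateErr η ϑ K N) t + (t : ℝ) / N + rate dist K N := errE_eq _ _ _ _ ht
    linarith

/-! ### The mean field flow -/

section Marginals

variable {X A : Type*} [MeasurableSpace X] [MeasurableSpace A]

theorem integral_marg (ψ : ProbabilityMeasure (X × A)) {f : X → ℝ} (hf : IsBb f) :
    ∫ x, f x ∂(marg ψ : Measure X) = ∫ q, f q.1 ∂(ψ : Measure (X × A)) :=
  integral_map measurable_fst.aemeasurable hf.1.aestronglyMeasurable

namespace Game

variable (Γ : Game X A) {N : ℕ} [NeZero N] (p : Fin N → ℕ → SymKernel X A)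

theorem integral_psiBar (t : ℕ) {f : X × A → ℝ} (hf : IsBb f) :
    ∫ q, f q ∂(Γ.psiBar p t : Measure (X × A)) = 1 / (N : ℝ) * ∑ n,
      ∫ x, ∫ a, f (x, a) ∂((p n t).1 (x, Γ.xiBar p t) : Measure A)
        ∂(Γ.playerLaw p t n : Measure X) := by
  rw [psiBar, integral_avg _ hf]
  simp only [integral_joint _ _ hf]
  rfl

theorem integral_xiBar (t : ℕ) {f : X → ℝ} (hf : IsBb f) :
    ∫ x, f x ∂(Γ.xiBar p t : Measure X) =
      1 / (N : ℝ) * ∑ n, ∫ x, f x ∂(Γ.playerLaw p t n : Measure X) :=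
  integral_avg _ hf

theorem marg_psiBar (t : ℕ) : marg (Γ.psiBar p t) = Γ.xiBar p t := by
  refine probabilityMeasure_ext_of_integral fun f hf => ?_
  rw [integral_marg _ hf, Γ.integral_psiBar p t (hf.comp measurable_fst), Γ.integral_xiBar p t hf]
  simp

theorem integral_next (t : ℕ) (ψ : ProbabilityMeasure (X × A)) {f : X → ℝ} (hf : IsBb f) :
    ∫ x, f x ∂(Γ.next t ψ : Measure X) = ∫ q, ∫ y, f y ∂(Γ.P t (q.1, marg ψ, q.2) : Measure X)
      ∂(ψ : Measure (X × A)) :=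
  integral_mix _ _ hf

theorem xiBar_succ {t : ℕ} (ht : 1 ≤ t) : Γ.xiBar p (t + 1) = Γ.next t (Γ.psiBar p t) := by
  refine probabilityMeasure_ext_of_integral fun f hf => ?_
  have hb : IsBb fun q : X × A => ∫ y, f y ∂(Γ.P t (q.1, Γ.xiBar p t, q.2) : Measure X) :=
    isBb_integral_family (hf.comp measurable_snd) ((Γ.measurable_P t).comp
      (measurable_fst.prodMk (measurable_const.prodMk measurable_snd)))
  rw [Γ.integral_next t _ hf, marg_psiBar, Γ.integral_psiBar p t hb, Γ.integral_xiBar p _ hf]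
  congr 2
  funext n
  rw [Γ.playerLaw_succ p ht, integral_mix _ _ hf]
  simp only [Γ.integral_Q t _ _ _ hf]
  rfl

theorem xiBar_one : Γ.xiBar p 1 = Γ.ξ₀ := avg_const Γ.ξ₀

theorem isMeanFieldFlow_psiBar : Γ.IsMeanFieldFlow (Γ.psiBar p) := by
  refine ⟨by rw [marg_psiBar, xiBar_one], fun t ht _ => ?_⟩
  rw [marg_psiBar, Γ.xiBar_succ p ht]

end Game

end Marginals

/-! ### The empirical state-action measure -/

section Pairs

variable {X A : Type*} [MeasurableSpace X] [MeasurableSpace A]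

/-- The law of the pair `(x, a)` with a fixed state `x` and a random action `a ∼ l`. -/
noncomputable def pairLaw (x : X) (l : ProbabilityMeasure A) : ProbabilityMeasure (X × A) :=
  l.map (f := Prod.mk x) measurable_prodMk_left.aemeasurable

theorem integral_pairLaw (x : X) (l : ProbabilityMeasure A) {f : X × A → ℝ} (hf : Measurable f) :
    ∫ q, f q ∂(pairLaw x l : Measure (X × A)) = ∫ a, f (x, a) ∂(l : Measure A) :=
  integral_map measurable_prodMk_left.aemeasurable hf.aestronglyMeasurable

theorem measurable_pairLaw {W : Type*} [MeasurableSpace W] {g : W → X}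
    {κ : W → ProbabilityMeasure A} (hg : Measurable g) (hκ : Measurable κ) :
    Measurable fun w => pairLaw (g w) (κ w) := by
  refine Measurable.subtype_mk (Measure.measurable_of_measurable_coe _ fun s hs => ?_)
  have h1 : ∀ w, ((κ w : Measure A).map (Prod.mk (g w))) s =
      (κ w : Measure A) (Prod.mk w ⁻¹' ((fun q : W × A => (g q.1, q.2)) ⁻¹' s)) := fun w =>
    Measure.map_apply measurable_prodMk_left hs
  simp only [h1]
  exact Kernel.measurable_kernel_prodMk_left (κ := asKernel ⟨κ, hκ⟩)
    (((hg.comp measurable_fst).prodMk measurable_snd) hs)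

theorem mix_pairLaw (μ : ProbabilityMeasure X)
    (κ : {κ : X → ProbabilityMeasure A // Measurable κ}) :
    mix μ ⟨fun x => pairLaw x (κ.1 x), measurable_pairLaw measurable_id κ.2⟩ = joint μ κ := by
  refine probabilityMeasure_ext_of_integral fun f hf => ?_
  rw [integral_mix _ _ hf, integral_joint _ _ hf]
  simp only [integral_pairLaw _ _ hf.1]

theorem integral_prodLaw_pairLaw {ι : Type*} [Fintype ι] (x : ι → X)
    (l : ι → ProbabilityMeasure A) {f : (ι → X × A) → ℝ} (hf : Measurable f) :
    ∫ z, f z ∂prodLaw (fun n => pairLaw (x n) (l n)) =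
      ∫ a, f (fun n => (x n, a n)) ∂prodLaw l := by
  have h1 : prodLaw (fun n => pairLaw (x n) (l n)) =
      (prodLaw l).map fun a n => (x n, a n) :=
    (Measure.pi_map_pi (μ := fun n => (l n : Measure A)) (f := fun n => Prod.mk (x n))
      fun n => measurable_prodMk_left.aemeasurable).symm
  rw [h1, integral_map (measurable_pi_lambda _ fun n =>
    measurable_const.prodMk (measurable_pi_apply n)).aemeasurable hf.aestronglyMeasurable]

end Pairs

namespace Game

section EmpError

variable {X A : Type*} [MetricSpace X] [SecondCountableTopology X] [MeasurableSpace X]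
  [BorelSpace X] [MetricSpace A] [CompactSpace A] [MeasurableSpace A] [BorelSpace A] {Γ : Game X A}
  {η ϑ : ℝ → ℝ} {K : ℕ → Set X} {N : ℕ} [NeZero N] {p : Fin N → ℕ → SymKernel X A}

theorem integral_blDist_emp_prodLaw_joint_le (hK : Γ.MomentTight K) {t : ℕ} (ht : 1 ≤ t)
    (htT : t ≤ Γ.T) : ∫ z, blDist sumDist (emp z) (Γ.psiBar p t)
        ∂prodLaw (fun n => joint (Γ.playerLaw p t n) ((p n t).freeze (Γ.xiBar p t))) ≤
      rate sumDist (fun i => K i ×ˢ (Set.univ : Set A)) N := by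
  refine integral_blDist_emp_avg_le isContDist_sumDist (fun i => (hK.2.1 i).prod isCompact_univ)
    (fun i => (hK.2.1 i).measurableSet.prod MeasurableSet.univ) _ fun i hi => ?_
  refine le_trans (le_of_eq ?_) (hK.xiBar_compl_le p ht htT hi)
  have h1 : (K i ×ˢ (Set.univ : Set A))ᶜ = Prod.fst ⁻¹' (K i)ᶜ := by ext q; simp
  have h2 : (Γ.xiBar p t : Measure X).real (K i)ᶜ =
      (marg (Γ.psiBar p t) : Measure X).real (K i)ᶜ := by rw [Γ.marg_psiBar p t]
  rw [h1, h2]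
  exact (map_measureReal_apply measurable_fst (hK.2.1 i).measurableSet.compl).symm

/-- The action laws are first evaluated at the frozen population, which costs `ϑ` of the deviation
of the empirical state distribution. The rest is a function of the states with differences bounded
by `1 / N`, so that their joint law may be replaced by that of the independent system, where the
state-action pairs are independent. -/
theorem lawT_empError_le (hη : IsModulus η) (hϑ : IsModulus ϑ) (hK : Γ.MomentTight K)
    (hP : Γ.PCont η) (hp : SymContProfile Γ.T ϑ p) {t : ℕ} (ht : 1 ≤ t) (htT : t < Γ.T) :
    Γ.lawT (toProfile p) t (Γ.empError p t) ≤ stateActionErr A η ϑ K N t := by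
  have hN := natCast_pos (N := N)
  let F : (Fin N → X × A) → ℝ := fun z => blDist sumDist (emp z) (Γ.psiBar p t)
  have hF : IsBb F := isBb_blDist_emp isContDist_sumDist _
  have hFd : ∀ z n u w, |F (Function.update z n u) - F (Function.update z n w)| ≤
      1 / (2 * (N : ℝ)) * min 2 (max (sumDist u w) 0) := fun z n u w =>
    abs_blDist_emp_update_sub_le isContDist_sumDist z n u w _
  have hFd1 : BddDiff (fun _ => 1 / (N : ℝ)) F := fun z n u w => by
    refine (hFd z n u w).trans ?_
    calc 1 / (2 * (N : ℝ)) * min 2 (max (sumDist u w) 0) ≤ 1 / (2 * (N : ℝ)) * 2 := by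
          gcongr; exact min_le_left _ _
      _ = 1 / N := by field_simp
  have hE : IsBb (Γ.empError p t) :=
    isBb_integral_prodLaw (f := fun q : (Fin N → X) × (Fin N → A) => F fun n => (q.1 n, q.2 n))
      (hF.comp (by fun_prop)) fun n => (measurable_pi_apply n).comp (measurable_actions p t)
  let g : (Fin N → X) → ℝ := fun x =>
    ∫ z, F z ∂prodLaw fun n => pairLaw (x n) ((p n t).1 (x n, Γ.xiBar p t))
  have hpair : ∀ n, Measurable fun x => pairLaw x ((p n t).1 (x, Γ.xiBar p t)) := fun n =>
    measurable_pairLaw measurable_id ((p n t).freeze (Γ.xiBar p t)).2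
  have hg : IsBb g := isBb_integral_prodLaw (hF.comp measurable_snd) fun n =>
    (hpair n).comp (measurable_pi_apply n)
  have hgd : BddDiff (fun _ => 1 / (N : ℝ)) g := hFd1.integral_prodLaw hF (fun _ => by positivity)
    fun n x => pairLaw x ((p n t).1 (x, Γ.xiBar p t))
  have hEg : ∀ x, Γ.empError p t x ≤ ϑ (Γ.empDev p t x) + g x := by
    intro x
    have h1 : Γ.empError p t x = ∫ z, F z ∂prodLaw fun n => pairLaw (x n) (actions p t x n) :=
      (integral_prodLaw_pairLaw x (actions p t x) hF.1).symm
    have h2 := abs_integral_prodLaw_sub_le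
      (fun n => pairLaw (x n) ((p n t).1 (x n, Γ.xiBar p t)))
      (fun n => pairLaw (x n) (actions p t x n)) hF
      (fun _ => 1 / (N : ℝ) * ϑ (Γ.empDev p t x)) fun n z => by
        have hm := hF.comp (measurable_update z (a := n))
        rw [integral_pairLaw _ _ hm.1, integral_pairLaw _ _ hm.1]
        have hs : ∀ a b : A,
            min (2 : ℝ) (max (sumDist (x n, a) (x n, b)) 0) ≤ dist a b := fun a b => by
          refine (min_le_right _ _).trans (max_le ?_ dist_nonneg)
          simp [sumDist]
        refine (abs_integral_sub_le_blDist (d := dist) (c := 1 / (2 * (N : ℝ)))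
          (hm.comp measurable_prodMk_left) (by positivity) (fun a b => ?_) fun a b => ?_).trans ?_
        · refine (hFd z n _ _).trans ?_
          exact (mul_le_mul_of_nonneg_left (min_le_left _ _) (by positivity)).trans_eq
            (mul_comm _ _)
        · refine (hFd z n _ _).trans ?_
          gcongr
          exact hs a b
        · rw [show 2 * (1 / (2 * (N : ℝ))) = 1 / N by field_simp]
          gcongr
          exact hp n t ht htT (x n) (emp x) (Γ.xiBar p t)
    rw [Finset.sum_const, Finset.card_univ, Fintype.card_fin, nsmul_eq_mul, ← mul_assoc,
      mul_one_div_cancel hN.ne', one_mul, ← h1] at h2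
    linarith [(abs_le.1 h2).2]
  have hb := isBb_empDev (Γ := Γ) (p := p) t
  have hϑb := hϑ.isBb_comp hb fun _ => blDist_nonneg
  have h1 : ∫ x, Γ.empError p t x ∂Γ.stateLaw p t ≤
      hull ϑ (stateErr η ϑ K N t) + ∫ x, g x ∂Γ.stateLaw p t := by
    refine (integral_mono_isBb hE (hϑb.add hg) hEg).trans ?_
    rw [integral_add (hϑb.integrable _) (hg.integrable _)]
    exact add_le_add_left (hϑ.integral_comp_le_hull hb (fun _ => blDist_nonneg)
      (integral_empDev_le hη hϑ hK hP hp ht htT.le)) _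
  have h2 := abs_integral_stateLaw_sub_le hη hϑ hK hP hp ht htT.le hg
    (fun _ => by positivity) hgd
  have h3 : ∫ x, g x ∂prodLaw (Γ.playerLaw p t) ≤
      rate sumDist (fun i => K i ×ˢ (Set.univ : Set A)) N := by
    refine le_trans (le_of_eq ?_) (integral_blDist_emp_prodLaw_joint_le (p := p) hK ht htT.le)
    have h : prodLaw (fun n => joint (Γ.playerLaw p t n) ((p n t).freeze (Γ.xiBar p t))) =
        (prodLaw (Γ.playerLaw p t)).bind fun x => prodLaw fun n =>
          pairLaw (x n) ((p n t).1 (x n, Γ.xiBar p t)) := by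
      rw [prodLaw_bind (Γ.playerLaw p t) fun n =>
        ⟨fun x => pairLaw x ((p n t).1 (x, Γ.xiBar p t)), hpair n⟩]
      congr 1
      funext n
      rw [← mix_pairLaw]
      rfl
    rw [h]
    exact (integral_bind_kernel _ (asKernel ⟨fun x : Fin N → X => ⟨prodLaw fun n => pairLaw (x n)
      ((p n t).1 (x n, Γ.xiBar p t)), inferInstance⟩, (measurable_prodLaw fun n =>
        (hpair n).comp (measurable_pi_apply n)).subtype_mk⟩) hF).symm
  have h4 : ∑ _ : Fin N, 1 / (N : ℝ) = 1 := by simp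
  rw [h4, one_mul] at h2
  have h5 := two_mul_drift_add_rate_le ϑ hη K N ht
  have h6 := drift_nonneg (ϑ := ϑ) (e := stateErr η ϑ K N) hη
    (fun s hs => stateErr_nonneg hη N hs) ht
  have h7 := hull_nonneg (β := ϑ) (stateErr_nonneg (ϑ := ϑ) (K := K) hη N ht)
  have h8 := rate_nonneg dist K N
  rw [Γ.lawT_eq_integral p ht hE, stateActionErr, errEmp]
  linarith [(abs_le.1 h2).2]

end EmpError

end Game

/-! ### Bellman operators -/

theorem abs_ciInf_le {ι : Type*} [Nonempty ι] {F : ι → ℝ} {C : ℝ} (h : ∀ i, |F i| ≤ C) :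
    |⨅ i, F i| ≤ C := by
  obtain ⟨i⟩ := ‹Nonempty ι›
  have : Nonempty ι := ⟨i⟩
  have hb : BddBelow (Set.range F) := ⟨-C, by rintro _ ⟨i, rfl⟩; exact (abs_le.1 (h i)).1⟩
  exact abs_le.2 ⟨le_ciInf fun i => (abs_le.1 (h i)).1,
    (ciInf_le hb i).trans (abs_le.1 (h i)).2⟩

theorem abs_ciInf_sub_ciInf_le {ι : Type*} [Nonempty ι] {F G : ι → ℝ} {C c : ℝ}
    (hF : ∀ i, |F i| ≤ C) (hG : ∀ i, |G i| ≤ C) (h : ∀ i, |F i - G i| ≤ c) :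
    |(⨅ i, F i) - ⨅ i, G i| ≤ c := by
  have hbF : BddBelow (Set.range F) := ⟨-C, by rintro _ ⟨i, rfl⟩; exact (abs_le.1 (hF i)).1⟩
  have hbG : BddBelow (Set.range G) := ⟨-C, by rintro _ ⟨i, rfl⟩; exact (abs_le.1 (hG i)).1⟩
  have h1 : (⨅ i, F i) - c ≤ ⨅ i, G i := le_ciInf fun i => by
    linarith [ciInf_le hbF i, (abs_le.1 (h i)).2]
  have h2 : (⨅ i, G i) - c ≤ ⨅ i, F i := le_ciInf fun i => by
    linarith [ciInf_le hbG i, (abs_le.1 (h i)).1]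
  exact abs_le.2 ⟨by linarith, by linarith⟩

theorem le_of_forall_pos_le_add_mul {x y c : ℝ} (hc : 0 ≤ c)
    (h : ∀ δ, 0 < δ → x ≤ y + δ * c) : x ≤ y := by
  refine le_of_forall_pos_le_add fun ε hε => (h (ε / (c + 1)) (by positivity)).trans ?_
  have : ε / (c + 1) * c ≤ ε := by
    rw [div_mul_eq_mul_div, div_le_iff₀ (by positivity)]
    nlinarith
  linarith

theorem compose_step {F : Type*} (op : ℕ → F → F) {s T : ℕ} (h : s < T) (f : F) :
    compose op s (T - s) f = op s (compose op (s + 1) (T - (s + 1)) f) := by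
  rw [show T - s = (T - (s + 1)) + 1 by omega]
  rfl

theorem growth_succ (C₀ C₁ : ℝ) (r : ℕ) (z : ℝ) :
    growth C₀ C₁ (r + 1) z = C₀ + C₁ * growth C₀ C₁ r z := by
  have h : ∑ k ∈ Finset.range (r + 1), C₁ ^ k = 1 + C₁ * ∑ k ∈ Finset.range r, C₁ ^ k := by
    rw [Finset.sum_range_succ', Finset.mul_sum, pow_zero, add_comm]
    congr 1
    exact Finset.sum_congr rfl fun k _ => by ring
  simp only [growth, h]
  ring

theorem growth_nonneg {C₀ C₁ : ℝ} (hC₀ : 0 ≤ C₀) (hC₁ : 0 ≤ C₁) (r : ℕ) {z : ℝ} (hz : 0 ≤ z) :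
    0 ≤ growth C₀ C₁ r z := by
  unfold growth
  have := Finset.sum_nonneg fun k (_ : k ∈ Finset.range r) => pow_nonneg hC₁ k
  positivity

theorem errB_step {T t : ℕ} (h : t < T) (C₀ C₁ Cb M : ℝ) (ζ ι : ℝ → ℝ) (e : ℕ → ℝ) :
    errB T C₀ C₁ Cb M ζ ι e t = growth C₀ C₁ (T - t) M * hull ζ (e t) +
      Cb * errB T C₀ C₁ Cb M ζ ι e (t + 1) := by
  rw [errB, errB, Finset.sum_eq_sum_Ico_succ_bot h, mul_add, Finset.mul_sum,
    show T - t = (T - (t + 1)) + 1 by omega, pow_succ']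
  have h1 : ∀ r ∈ Finset.Ico (t + 1) T, Cb ^ (r - t) * growth C₀ C₁ (T - r) M * hull ζ (e r) =
      Cb * (Cb ^ (r - (t + 1)) * growth C₀ C₁ (T - r) M * hull ζ (e r)) := fun r hr => by
    rw [show r - t = (r - (t + 1)) + 1 by have := (Finset.mem_Ico.1 hr).1; omega, pow_succ']
    ring
  rw [Finset.sum_congr rfl h1]
  simp
  ring

theorem errB_nonneg {T t : ℕ} {C₀ C₁ Cb M : ℝ} (hC₀ : 0 ≤ C₀) (hC₁ : 0 ≤ C₁) (hCb : 0 ≤ Cb)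
    (hM : 0 ≤ M) (ζ ι : ℝ → ℝ) {e : ℕ → ℝ} (he : ∀ s, 1 ≤ s → 0 ≤ e s) (ht : 1 ≤ t)
    (hT : 1 ≤ T) : 0 ≤ errB T C₀ C₁ Cb M ζ ι e t := by
  refine add_nonneg (Finset.sum_nonneg fun r hr => ?_)
    (mul_nonneg (pow_nonneg hCb _) (hull_nonneg (he T hT)))
  exact mul_nonneg (mul_nonneg (pow_nonneg hCb _) (growth_nonneg hC₀ hC₁ _ hM))
    (hull_nonneg (he r (ht.trans (Finset.mem_Ico.1 hr).1)))

instance {A : Type*} [MeasurableSpace A] [Nonempty A] : Nonempty (ProbabilityMeasure A) :=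
  ⟨⟨Measure.dirac (Classical.arbitrary A), inferInstance⟩⟩

namespace Game

section Values

variable {X A : Type*} [MetricSpace X] [SecondCountableTopology X] [MeasurableSpace X]
  [BorelSpace X] [MetricSpace A] [CompactSpace A] [Nonempty A] [MeasurableSpace A] [BorelSpace A]
  {Γ : Game X A} {C₀ C₁ Cb : ℝ} {η ζ ϑ ι : ℝ → ℝ} {K : ℕ → Set X} {N : ℕ} [NeZero N]
  {p : Fin N → ℕ → SymKernel X A} {V : X × ProbabilityMeasure X → ℝ}

omit [SecondCountableTopology X] [BorelSpace X] in
theorem isBb_meanSstar (hC₀ : 0 ≤ C₀) (hC₁ : 0 ≤ C₁) (hζ : IsModulus ζ)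
    (hG : Γ.GBasic C₀ C₁ Cb) (hGc : Γ.GCont C₀ C₁ ζ) {t : ℕ} (ht : 1 ≤ t) (htT : t < Γ.T)
    (ξ : ProbabilityMeasure X) {v : X → ℝ} (hv : IsBb v) : IsBb (Γ.meanSstar t ξ v) := by
  have hs := supNorm_nonneg v
  refine ⟨measurable_iInf_action (c := C₀ + C₁ * supNorm v) (F := fun x l => Γ.G t ξ l v x)
    (fun l => (Γ.measurable_G t v ht htT hv).comp
      (measurable_id.prodMk (measurable_const (a := (ξ, l))))) (by positivity)
    (fun x l => hG.bound_G t ht htT ξ l v hv x) hζ fun x l l' => ?_, _,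
    fun x => abs_ciInf_le fun l => hG.bound_G t ht htT ξ l v hv x⟩
  simpa [blDist_self, hζ.zero] using hGc.cont_G t ht htT ξ ξ l l' v hv x

omit [SecondCountableTopology X] [BorelSpace X] in
theorem isBb_Sstar (hC₀ : 0 ≤ C₀) (hC₁ : 0 ≤ C₁) (hζ : IsModulus ζ)
    (hG : Γ.GBasic C₀ C₁ Cb) (hGc : Γ.GCont C₀ C₁ ζ) {t : ℕ} (ht : 1 ≤ t) (htT : t < Γ.T)
    {u : (Fin N → X) → ℝ} (hu : IsBb u) : IsBb (Γ.Sstar t (fun n => toProfile p n t) u) := by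
  have hs := supNorm_nonneg u
  refine ⟨measurable_iInf_action (c := C₀ + C₁ * supNorm u)
    (F := fun x l => Γ.GN N t (Function.update (actions p t x) 0 l) u x)
    (fun l => (Γ.measurable_GN N t u ht htT hu).comp (measurable_id.prodMk
      (measurable_update'.comp ((measurable_actions p t).prodMk measurable_const))))
    (by positivity) (fun x l => hG.bound_GN N t ht htT _ u hu x) hζ fun x l l' => ?_, _,
    fun x => abs_ciInf_le fun l => hG.bound_GN N t ht htT _ u hu x⟩
  simpa using hGc.cont_GN N t ht htT (Function.update (actions p t x) 0 l) l' u hu x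

/-- The value of the mean field control problem at time `s`, with the population flow generated
by the policies `p`. -/
noncomputable abbrev meanValue (Γ : Game X A) (p : Fin N → ℕ → SymKernel X A)
    (V : X × ProbabilityMeasure X → ℝ) (s : ℕ) : X → ℝ :=
  Γ.meanSstars (Γ.xiBar p) s fun x => V (x, Γ.xiBar p Γ.T)

/-- The value of player `1` at time `s` in the `N`-player game, against the policies `p` of the
others. -/
noncomputable abbrev gameValue (Γ : Game X A) (p : Fin N → ℕ → SymKernel X A)
    (V : X × ProbabilityMeasure X → ℝ) (s : ℕ) : (Fin N → X) → ℝ :=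
  Γ.Sstars (toProfile p) s (terminalN V)

omit [SecondCountableTopology X] [BorelSpace X] in
theorem meanValue_bound (hC₀ : 0 ≤ C₀) (hC₁ : 0 ≤ C₁) (hζ : IsModulus ζ)
    (hG : Γ.GBasic C₀ C₁ Cb) (hGc : Γ.GCont C₀ C₁ ζ) (hV : IsBb V) {s : ℕ} (hs : 1 ≤ s)
    (hsT : s ≤ Γ.T) : IsBb (Γ.meanValue p V s) ∧
      ∀ x, |Γ.meanValue p V s x| ≤ growth C₀ C₁ (Γ.T - s) (supNorm V) := by
  induction hsT using Nat.decreasingInduction with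
  | self =>
    have h : Γ.meanValue p V Γ.T = fun x => V (x, Γ.xiBar p Γ.T) := by
      simp [meanValue, meanSstars, compose]
    rw [h]
    exact ⟨hV.comp (measurable_id.prodMk measurable_const), fun x => by
      simpa [growth] using hV.le_supNorm _⟩
  | of_succ s hsT ih =>
    obtain ⟨h1, h2⟩ := ih (by omega)
    have h : Γ.meanValue p V s = Γ.meanSstar s (Γ.xiBar p s) (Γ.meanValue p V (s + 1)) :=
      compose_step _ hsT _
    rw [h]
    refine ⟨isBb_meanSstar hC₀ hC₁ hζ hG hGc hs hsT _ h1, fun x => ?_⟩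
    refine (abs_ciInf_le fun l => hG.bound_G s hs hsT _ l _ h1 x).trans ?_
    rw [show Γ.T - s = (Γ.T - (s + 1)) + 1 by omega, growth_succ]
    gcongr
    exact supNorm_le (growth_nonneg hC₀ hC₁ _ (supNorm_nonneg V)) h2

omit [SecondCountableTopology X] [BorelSpace X] in
theorem isBb_gameValue (hC₀ : 0 ≤ C₀) (hC₁ : 0 ≤ C₁) (hζ : IsModulus ζ)
    (hG : Γ.GBasic C₀ C₁ Cb) (hGc : Γ.GCont C₀ C₁ ζ) (hV : IsBb V) {s : ℕ} (hs : 1 ≤ s)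
    (hsT : s ≤ Γ.T) : IsBb (Γ.gameValue p V s) := by
  induction hsT using Nat.decreasingInduction with
  | self =>
    have h : Γ.gameValue p V Γ.T = terminalN V := by
      simp [gameValue, Sstars, compose]
    rw [h]
    exact hV.comp ((measurable_pi_apply 0).prodMk measurable_emp)
  | of_succ s hsT ih =>
    have h : Γ.gameValue p V s = Γ.Sstar s (fun n => toProfile p n s) (Γ.gameValue p V (s + 1)) :=
      compose_step _ hsT _
    rw [h]
    exact isBb_Sstar hC₀ hC₁ hζ hG hGc hs hsT (ih (by omega))

omit [SecondCountableTopology X] [BorelSpace X] [CompactSpace A] [Nonempty A] [BorelSpace A] in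
/-- Passing from the score of player `1` in the game to the mean field score: the change of the
continuation value costs its mean deviation, the change of the population costs `ζ`. -/
theorem abs_GN_sub_G_le (hC₁ : 0 ≤ C₁)
    (hG : Γ.GBasic C₀ C₁ Cb) (hGc : Γ.GCont C₀ C₁ ζ) (hζ : IsModulus ζ) {t : ℕ} (ht : 1 ≤ t)
    (htT : t < Γ.T) {u : (Fin N → X) → ℝ} (hu : IsBb u) {v : X → ℝ} (hv : IsBb v) {g : ℝ}
    (hg0 : 0 ≤ g) (hvg : ∀ x, |v x| ≤ g)
    (x : Fin N → X) (l : Fin N → ProbabilityMeasure A) (l' : ProbabilityMeasure A) :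
    |Γ.GN N t l u x - Γ.G t (Γ.xiBar p t) l' v (x 0)| ≤
      Cb * ∫ y, |u y - v (y 0)| ∂Γ.jump t x l +
        (C₀ + C₁ * g) * (ζ (Γ.empDev p t x) + ζ (blDist dist (l 0) l')) := by
  have hv0 : IsBb fun y : Fin N → X => v (y 0) := hv.comp (measurable_pi_apply 0)
  have h1 := hG.lip_GN N t ht htT l u _ hu hv0 x
  have h2 := hGc.cont_G t ht htT (emp x) (Γ.xiBar p t) (l 0) l' v hv (x 0)
  rw [hG.compat N t ht htT v hv l x] at h1
  have h3 := abs_sub_le (Γ.GN N t l u x) (Γ.G t (emp x) (l 0) v (x 0))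
    (Γ.G t (Γ.xiBar p t) l' v (x 0))
  have h4 : C₀ + C₁ * supNorm v ≤ C₀ + C₁ * g := by
    have := supNorm_le hg0 hvg
    gcongr
  have h5 := mul_le_mul_of_nonneg_right h4 (add_nonneg
    (hζ.nonneg _ (blDist_nonneg (d := dist) (μ := emp x) (ν := Γ.xiBar p t)))
    (hζ.nonneg _ (blDist_nonneg (d := dist) (μ := l 0) (ν := l'))))
  exact h3.trans (add_le_add h1 (h2.trans h5))

omit [SecondCountableTopology X] [BorelSpace X] in
/-- One backward step for the values. Only the player's own action law is optimized over, so both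
infima range over the same set. -/
theorem abs_value_step_le (hC₀ : 0 ≤ C₀) (hC₁ : 0 ≤ C₁) (hζ : IsModulus ζ)
    (hG : Γ.GBasic C₀ C₁ Cb) (hGc : Γ.GCont C₀ C₁ ζ) (hV : IsBb V) {s : ℕ} (hs : 1 ≤ s)
    (hsT : s < Γ.T) (x : Fin N → X) {B : ℝ}
    (hB : ∀ l, Cb * ∫ y, |Γ.gameValue p V (s + 1) y - Γ.meanValue p V (s + 1) (y 0)|
      ∂Γ.jump s x (Function.update (actions p s x) 0 l) ≤ B) :
    |Γ.gameValue p V s x - Γ.meanValue p V s (x 0)| ≤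
      B + growth C₀ C₁ (Γ.T - s) (supNorm V) * ζ (Γ.empDev p s x) := by
  obtain ⟨hv, hvb⟩ := meanValue_bound (p := p) hC₀ hC₁ hζ hG hGc hV (Nat.le_add_left 1 s) hsT
  have hu := isBb_gameValue (p := p) hC₀ hC₁ hζ hG hGc hV (Nat.le_add_left 1 s) hsT
  have e1 : Γ.gameValue p V s =
      Γ.Sstar s (fun n => toProfile p n s) (Γ.gameValue p V (s + 1)) := compose_step _ hsT _
  have e2 : Γ.meanValue p V s = Γ.meanSstar s (Γ.xiBar p s) (Γ.meanValue p V (s + 1)) :=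
    compose_step _ hsT _
  rw [e1, e2]
  refine abs_ciInf_sub_ciInf_le (fun l => (hG.bound_GN N s hs hsT _ _ hu x).trans (le_max_left _
    (C₀ + C₁ * supNorm (Γ.meanValue p V (s + 1))))) (fun l => (hG.bound_G s hs hsT _ l _ hv
      (x 0)).trans (le_max_right _ _)) fun l => ?_
  have h := abs_GN_sub_G_le (p := p) hC₁ hG hGc hζ hs hsT hu hv
    (growth_nonneg hC₀ hC₁ _ (supNorm_nonneg V)) hvb x
    (Function.update (actions p s x) 0 l) l
  rw [Function.update_self, blDist_self, hζ.zero, add_zero, ← growth_succ,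
    show Γ.T - (s + 1) + 1 = Γ.T - s by omega] at h
  exact h.trans (add_le_add_left (hB l) _)

/-- The value of player `1` against the mean field value: a supersolution for each of the times at
which the population is frozen dominates the pointwise difference. -/
theorem integral_abs_value_sub_le (hC₀ : 0 ≤ C₀) (hC₁ : 0 ≤ C₁) (hCb : 0 ≤ Cb) (hη : IsModulus η)
    (hζ : IsModulus ζ) (hϑ : IsModulus ϑ) (hι : IsModulus ι) (hK : Γ.MomentTight K)
    (hP : Γ.PCont η) (hG : Γ.GBasic C₀ C₁ Cb) (hGc : Γ.GCont C₀ C₁ ζ) (hV : IsBb V)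
    (hVι : SymCont ι V) (hp : SymContProfile Γ.T ϑ p) {t : ℕ} (ht : 1 ≤ t) (htT : t ≤ Γ.T) :
    ∫ x, |Γ.gameValue p V t x - Γ.meanValue p V t (x 0)| ∂Γ.stateLaw p t ≤
      errB Γ.T C₀ C₁ Cb (supNorm V) ζ ι (stateErr η ϑ K N) t := by
  have hg : ∀ r, 0 ≤ growth C₀ C₁ r (supNorm V) := fun r =>
    growth_nonneg hC₀ hC₁ r (supNorm_nonneg V)
  refine le_of_forall_pos_le_add_mul (c := ∑ r ∈ Finset.Ico t Γ.T, Cb ^ (r - t) *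
    growth C₀ C₁ (Γ.T - r) (supNorm V) + Cb ^ (Γ.T - t)) (add_nonneg (Finset.sum_nonneg fun r _ =>
      mul_nonneg (pow_nonneg hCb _) (hg _)) (pow_nonneg hCb _)) fun δ hδ => ?_
  have hcert : ∀ {β : ℝ → ℝ}, IsModulus β → ∀ r, ∃ Φ : ℕ → (Fin N → X) → ℝ,
      1 ≤ r → r ≤ Γ.T → Γ.IsSupersolution p r Φ ∧ (∀ x, β (Γ.empDev p r x) ≤ Φ r x) ∧
        ∫ x, Φ 1 x ∂prodLaw (fun _ => Γ.ξ₀) ≤ hull β (stateErr η ϑ K N r) + δ := by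
    intro β hβ r
    by_cases hr : 1 ≤ r ∧ r ≤ Γ.T
    · obtain ⟨Φ, hΦ⟩ := DevBound.hull hβ (fun y hy => devBound_empDev hη hϑ hK hP hp hr.1 hr.2 hy)
        (lt_add_of_pos_right (hull β (stateErr η ϑ K N r)) hδ)
      exact ⟨Φ, fun _ _ => hΦ⟩
    · exact ⟨fun _ _ => 0, fun h1 h2 => absurd ⟨h1, h2⟩ hr⟩
  choose Φ hΦ using hcert hζ
  obtain ⟨Ψ, hΨ⟩ := hcert hι Γ.T
  have hT : 1 ≤ Γ.T := ht.trans htT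
  obtain ⟨hΨs, hΨι, hΨ1⟩ := hΨ hT le_rfl
  have hΦ' : ∀ {s r}, 1 ≤ s → r ∈ Finset.Ico s Γ.T → Γ.IsSupersolution p r (Φ r) ∧
      (∀ x, ζ (Γ.empDev p r x) ≤ Φ r r x) ∧
        ∫ x, Φ r 1 x ∂prodLaw (fun _ => Γ.ξ₀) ≤ hull ζ (stateErr η ϑ K N r) + δ := fun hs hr =>
    hΦ _ (hs.trans (Finset.mem_Ico.1 hr).1) (Finset.mem_Ico.1 hr).2.le
  let W : ℕ → (Fin N → X) → ℝ := fun s x => ∑ r ∈ Finset.Ico s Γ.T, Cb ^ (r - s) *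
    growth C₀ C₁ (Γ.T - r) (supNorm V) * Φ r s x + Cb ^ (Γ.T - s) * Ψ s x
  have hWs : ∀ s, 1 ≤ s → IsBb fun x => ∑ r ∈ Finset.Ico s Γ.T, Cb ^ (r - s) *
      growth C₀ C₁ (Γ.T - r) (supNorm V) * Φ r s x := fun s hs =>
    isBb_finset_sum _ fun r hr => ((hΦ' hs hr).1.isBb s).const_mul _
  have hWb : ∀ s, 1 ≤ s → IsBb (W s) := fun s hs =>
    (hWs s hs).add ((hΨs.isBb s).const_mul _)
  have hWint : ∀ s, 1 ≤ s → ∀ (μ : Measure (Fin N → X)) [IsProbabilityMeasure μ],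
      ∫ x, W s x ∂μ = ∑ r ∈ Finset.Ico s Γ.T, Cb ^ (r - s) *
        growth C₀ C₁ (Γ.T - r) (supNorm V) * ∫ x, Φ r s x ∂μ +
          Cb ^ (Γ.T - s) * ∫ x, Ψ s x ∂μ := fun s hs μ _ => by
    rw [integral_add ((hWs s hs).integrable _) (((hΨs.isBb s).const_mul _).integrable _),
      integral_finsetSum _ fun r hr => (((hΦ' hs hr).1.isBb s).const_mul _).integrable _,
      integral_const_mul]
    congr 1
    exact Finset.sum_congr rfl fun r _ => integral_const_mul _ _
  have hdiff : ∀ s, 1 ≤ s → s ≤ Γ.T →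
      IsBb fun x => |Γ.gameValue p V s x - Γ.meanValue p V s (x 0)| := fun s hs hsT =>
    ((isBb_gameValue hC₀ hC₁ hζ hG hGc hV hs hsT).sub ((meanValue_bound hC₀ hC₁ hζ hG hGc hV hs
      hsT).1.comp (measurable_pi_apply 0))).abs
  have hle : ∀ s, s ≤ Γ.T → 1 ≤ s → ∀ x,
      |Γ.gameValue p V s x - Γ.meanValue p V s (x 0)| ≤ W s x := by
    intro s hsT
    induction hsT using Nat.decreasingInduction with
    | self =>
      intro _ x
      have h1 : Γ.gameValue p V Γ.T = terminalN V := by simp [gameValue, Sstars, compose]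
      have h2 : Γ.meanValue p V Γ.T = fun x => V (x, Γ.xiBar p Γ.T) := by
        simp [meanValue, meanSstars, compose]
      rw [h1, h2]
      simpa [W, terminalN] using (hVι (x 0) (emp x) (Γ.xiBar p Γ.T)).trans (hΨι x)
    | of_succ s hsT ih =>
      intro hs x
      have h1 := ih (by omega)
      refine (abs_value_step_le hC₀ hC₁ hζ hG hGc hV hs hsT x (B := ∑ r ∈ Finset.Ico (s + 1) Γ.T,
        Cb ^ (r - s) * growth C₀ C₁ (Γ.T - r) (supNorm V) * Φ r s x + Cb ^ (Γ.T - s) * Ψ s x)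
        fun l => ?_).trans ?_
      · refine (mul_le_mul_of_nonneg_left (integral_mono_isBb (hdiff _ (by omega) hsT)
          (hWb (s + 1) (by omega)) h1) hCb).trans ?_
        rw [hWint (s + 1) (by omega), mul_add, Finset.mul_sum]
        refine add_le_add (Finset.sum_le_sum fun r hr => ?_) ?_
        · have hsr := (Finset.mem_Ico.1 hr).1
          have h2 := (hΦ' (by omega) hr).1.step s hs (by omega) x l
          rw [show r - s = (r - (s + 1)) + 1 by omega, pow_succ', ← mul_assoc, ← mul_assoc]
          exact mul_le_mul_of_nonneg_left h2
            (mul_nonneg (mul_nonneg hCb (pow_nonneg hCb _)) (hg _))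
        · rw [show Γ.T - s = (Γ.T - (s + 1)) + 1 by omega, pow_succ', ← mul_assoc]
          exact mul_le_mul_of_nonneg_left (hΨs.step s hs hsT x l)
            (mul_nonneg hCb (pow_nonneg hCb _))
      · have h2 := mul_le_mul_of_nonneg_left ((hΦ' hs (Finset.left_mem_Ico.2 hsT)).2.1 x)
          (hg (Γ.T - s))
        simp only [W]
        rw [Finset.sum_eq_sum_Ico_succ_bot hsT, Nat.sub_self, pow_zero, one_mul]
        linarith
  refine (integral_mono_isBb (hdiff t ht htT) (hWb t ht) (hle t htT ht)).trans ?_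
  rw [hWint t ht, errB, mul_add, Finset.mul_sum, add_add_add_comm, ← Finset.sum_add_distrib]
  refine add_le_add (Finset.sum_le_sum fun r hr => ?_) ?_
  · have h1 := ((hΦ' ht hr).1.integral_stateLaw_le ht (Finset.mem_Ico.1 hr).1).trans
      (hΦ' ht hr).2.2
    refine (mul_le_mul_of_nonneg_left h1 (mul_nonneg (pow_nonneg hCb _) (hg _))).trans_eq ?_
    ring
  · refine (mul_le_mul_of_nonneg_left ((hΨs.integral_stateLaw_le ht htT).trans hΨ1)
      (pow_nonneg hCb _)).trans_eq ?_
    ring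

/-- The gap at time `t` and state `x` between the mean field score of the action law that the policy
of player `n` chooses there and the optimal one. -/
noncomputable def meanGap (Γ : Game X A) (p : Fin N → ℕ → SymKernel X A)
    (V : X × ProbabilityMeasure X → ℝ) (n : Fin N) (t : ℕ) (x : X) : ℝ :=
  Γ.G t (Γ.xiBar p t) ((p n t).1 (x, Γ.xiBar p t)) (Γ.meanValue p V (t + 1)) x -
    Γ.meanValue p V t x

omit [MetricSpace X] [SecondCountableTopology X] [BorelSpace X] [MetricSpace A] [CompactSpace A]
  [Nonempty A] [BorelSpace A] in
theorem isBb_score (hG : Γ.GBasic C₀ C₁ Cb) {t : ℕ} (ht : 1 ≤ t) (htT : t < Γ.T)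
    (ξ : ProbabilityMeasure X) {v : X → ℝ} (hv : IsBb v)
    (κ : {κ : X → ProbabilityMeasure A // Measurable κ}) :
    IsBb fun x => Γ.G t ξ (κ.1 x) v x :=
  ⟨(Γ.measurable_G t v ht htT hv).comp (measurable_id.prodMk (measurable_const.prodMk κ.2)), _,
    fun x => hG.bound_G t ht htT ξ _ v hv x⟩

omit [SecondCountableTopology X] [BorelSpace X] in
theorem meanGap_bound (hC₀ : 0 ≤ C₀) (hC₁ : 0 ≤ C₁) (hζ : IsModulus ζ)
    (hG : Γ.GBasic C₀ C₁ Cb) (hGc : Γ.GCont C₀ C₁ ζ) (hV : IsBb V) (n : Fin N) {t : ℕ}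
    (ht : 1 ≤ t) (htT : t < Γ.T) : IsBb (Γ.meanGap p V n t) ∧ ∀ x,
      0 ≤ Γ.meanGap p V n t x ∧
        Γ.meanGap p V n t x ≤ 2 * growth C₀ C₁ (Γ.T - t) (supNorm V) := by
  obtain ⟨hv, hvb⟩ := meanValue_bound (p := p) hC₀ hC₁ hζ hG hGc hV (Nat.le_add_left 1 t) htT
  obtain ⟨hv', hvb'⟩ := meanValue_bound (p := p) hC₀ hC₁ hζ hG hGc hV ht htT.le
  have hb := fun l => hG.bound_G t ht htT (Γ.xiBar p t) l (Γ.meanValue p V (t + 1)) hv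
  refine ⟨(isBb_score hG ht htT _ hv ((p n t).freeze (Γ.xiBar p t))).sub hv', fun x => ⟨?_, ?_⟩⟩
  · have e2 : Γ.meanValue p V t = Γ.meanSstar t (Γ.xiBar p t) (Γ.meanValue p V (t + 1)) :=
      compose_step _ htT _
    rw [meanGap, e2, sub_nonneg]
    exact ciInf_le ⟨_, by rintro _ ⟨l, rfl⟩; exact (abs_le.1 (hb l x)).1⟩ _
  · have h1 := (abs_le.1 (hb ((p n t).1 (x, Γ.xiBar p t)) x)).2
    have h2 := (abs_le.1 (hvb' x)).1
    have h3 : C₀ + C₁ * supNorm (Γ.meanValue p V (t + 1)) ≤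
        growth C₀ C₁ (Γ.T - t) (supNorm V) := by
      rw [show Γ.T - t = (Γ.T - (t + 1)) + 1 by omega, growth_succ]
      gcongr
      exact supNorm_le (growth_nonneg hC₀ hC₁ _ (supNorm_nonneg V)) hvb
    unfold meanGap
    linarith

/-- The regret of player `1` at time `t` against its mean field counterpart. The gap of the scores
contributes the errors of the values at the times `t` and `t + 1`; passing from the joint law of the
states to the law of the representative of player `1` costs an error of the order of `stateErr`,
because the mean field gap depends on the state of one player only. -/
theorem abs_lawT_regret_sub_le (hC₀ : 0 ≤ C₀) (hC₁ : 0 ≤ C₁) (hCb : 0 ≤ Cb) (hη : IsModulus η)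
    (hζ : IsModulus ζ) (hϑ : IsModulus ϑ) (hι : IsModulus ι) (hK : Γ.MomentTight K)
    (hP : Γ.PCont η) (hG : Γ.GBasic C₀ C₁ Cb) (hGc : Γ.GCont C₀ C₁ ζ) (hV : IsBb V)
    (hVι : SymCont ι V) (hp : SymContProfile Γ.T ϑ p) {t : ℕ} (ht : 1 ≤ t) (htT : t < Γ.T) :
    |Γ.lawT (toProfile p) t (fun x => Γ.S t (fun n => toProfile p n t) (Γ.gameValue p V (t + 1)) x -
        Γ.gameValue p V t x) - ∫ x, Γ.meanGap p V 0 t x ∂(Γ.playerLaw p t 0 : Measure X)| ≤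
      2 * errB Γ.T C₀ C₁ Cb (supNorm V) ζ ι (stateErr η ϑ K N) t +
        growth C₀ C₁ (Γ.T - t) (supNorm V) *
          (hull ζ (hull ϑ (stateErr η ϑ K N t)) + stateErr η ϑ K N t) := by
  set g := growth C₀ C₁ (Γ.T - t) (supNorm V) with hgdef
  have hg0 : 0 ≤ g := growth_nonneg hC₀ hC₁ _ (supNorm_nonneg V)
  obtain ⟨hv, hvb⟩ := meanValue_bound (p := p) hC₀ hC₁ hζ hG hGc hV (Nat.le_add_left 1 t) htT
  obtain ⟨hv', -⟩ := meanValue_bound (p := p) hC₀ hC₁ hζ hG hGc hV ht htT.le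
  have hu := isBb_gameValue (p := p) hC₀ hC₁ hζ hG hGc hV (Nat.le_add_left 1 t) htT
  have hu' := isBb_gameValue (p := p) hC₀ hC₁ hζ hG hGc hV ht htT.le
  obtain ⟨hh, hhb⟩ := meanGap_bound (p := p) hC₀ hC₁ hζ hG hGc hV 0 ht htT
  have hS : IsBb (Γ.S t (fun n => toProfile p n t) (Γ.gameValue p V (t + 1))) :=
    ⟨(Γ.measurable_GN N t _ ht htT hu).comp (measurable_id.prodMk (measurable_actions p t)), _,
      fun x => hG.bound_GN N t ht htT _ _ hu x⟩
  have hd : IsBb fun x => Γ.S t (fun n => toProfile p n t) (Γ.gameValue p V (t + 1)) x -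
      Γ.gameValue p V t x := hS.sub hu'
  have hh0 : IsBb fun x : Fin N → X => Γ.meanGap p V 0 t (x 0) := hh.comp (measurable_pi_apply 0)
  have hw := (hu.sub (hv.comp (measurable_pi_apply 0))).abs
  have hw' := (hu'.sub (hv'.comp (measurable_pi_apply 0))).abs
  have hj := Γ.isBb_integral_jump t (measurable_actions p t) hw
  have hb := isBb_empDev (Γ := Γ) (p := p) t
  have hb0 : ∀ x, 0 ≤ Γ.empDev p t x := fun x => blDist_nonneg
  have hϑb := hϑ.isBb_comp hb hb0
  have hϑ0 : ∀ x, 0 ≤ ϑ (Γ.empDev p t x) := fun x => hϑ.nonneg _ (hb0 x)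
  have hζb := hζ.isBb_comp hb hb0
  have hζϑb := hζ.isBb_comp hϑb hϑ0
  have hgeq : C₀ + C₁ * growth C₀ C₁ (Γ.T - (t + 1)) (supNorm V) = g := by
    rw [hgdef, ← growth_succ, show Γ.T - (t + 1) + 1 = Γ.T - t by omega]
  have hpt : ∀ x, |(Γ.S t (fun n => toProfile p n t) (Γ.gameValue p V (t + 1)) x -
      Γ.gameValue p V t x) - Γ.meanGap p V 0 t (x 0)| ≤
        (Cb * ∫ y, |Γ.gameValue p V (t + 1) y - Γ.meanValue p V (t + 1) (y 0)|
          ∂Γ.jump t x (actions p t x) + |Γ.gameValue p V t x - Γ.meanValue p V t (x 0)|) +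
        g * (ζ (Γ.empDev p t x) + ζ (ϑ (Γ.empDev p t x))) := fun x => by
    have h1 := abs_GN_sub_G_le (p := p) hC₁ hG hGc hζ ht htT hu hv
      (growth_nonneg hC₀ hC₁ _ (supNorm_nonneg V)) hvb x (actions p t x)
      ((p 0 t).1 (x 0, Γ.xiBar p t))
    rw [hgeq] at h1
    have h2 : ζ (blDist dist (actions p t x 0) ((p 0 t).1 (x 0, Γ.xiBar p t))) ≤
        ζ (ϑ (Γ.empDev p t x)) :=
      hζ.mono _ _ blDist_nonneg (hp 0 t ht htT (x 0) (emp x) (Γ.xiBar p t))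
    have h3 := mul_le_mul_of_nonneg_left h2 hg0
    have h4 : (Γ.S t (fun n => toProfile p n t) (Γ.gameValue p V (t + 1)) x -
        Γ.gameValue p V t x) - Γ.meanGap p V 0 t (x 0) =
        (Γ.GN N t (actions p t x) (Γ.gameValue p V (t + 1)) x - Γ.G t (Γ.xiBar p t)
          ((p 0 t).1 (x 0, Γ.xiBar p t)) (Γ.meanValue p V (t + 1)) (x 0)) -
        (Γ.gameValue p V t x - Γ.meanValue p V t (x 0)) := by
      rw [meanGap, sub_sub_sub_comm]
      rfl
    rw [h4]
    refine (abs_sub _ _).trans ?_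
    rw [mul_add] at h1
    rw [mul_add]
    linarith
  have hA : |∫ x, (Γ.S t (fun n => toProfile p n t) (Γ.gameValue p V (t + 1)) x -
      Γ.gameValue p V t x) ∂Γ.stateLaw p t - ∫ x, Γ.meanGap p V 0 t (x 0) ∂Γ.stateLaw p t| ≤
      2 * errB Γ.T C₀ C₁ Cb (supNorm V) ζ ι (stateErr η ϑ K N) t +
        g * hull ζ (hull ϑ (stateErr η ϑ K N t)) := by
    rw [← integral_sub (hd.integrable _) (hh0.integrable _)]
    refine abs_integral_le_integral_abs.trans ((integral_mono_isBb (hd.sub hh0).abs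
      (((hj.const_mul Cb).add hw').add ((hζb.add hζϑb).const_mul g)) hpt).trans ?_)
    rw [integral_add (((hj.const_mul Cb).add hw').integrable _)
        (((hζb.add hζϑb).const_mul g).integrable _),
      integral_add ((hj.const_mul Cb).integrable _) (hw'.integrable _), integral_const_mul,
      integral_const_mul, integral_add (hζb.integrable _) (hζϑb.integrable _),
      ← Γ.integral_stateLaw_succ p ht hw]
    have he := integral_empDev_le hη hϑ hK hP hp ht htT.le
    have e1 := mul_le_mul_of_nonneg_left (integral_abs_value_sub_le hC₀ hC₁ hCb hη hζ hϑ hι hK hP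
      hG hGc hV hVι hp (Nat.le_add_left 1 t) htT) hCb
    have e2 := integral_abs_value_sub_le hC₀ hC₁ hCb hη hζ hϑ hι hK hP hG hGc hV hVι hp ht htT.le
    have e3 := mul_le_mul_of_nonneg_left (hζ.integral_comp_le_hull hb hb0 he) hg0
    have e4 := mul_le_mul_of_nonneg_left (hζ.integral_comp_le_hull hϑb hϑ0
      (hϑ.integral_comp_le_hull hb hb0 he)) hg0
    have e5 := errB_step htT C₀ C₁ Cb (supNorm V) ζ ι (stateErr η ϑ K N)
    rw [← hgdef] at e5
    rw [mul_add]
    linarith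
  have hB : |∫ x, Γ.meanGap p V 0 t (x 0) ∂Γ.stateLaw p t -
      ∫ x, Γ.meanGap p V 0 t x ∂(Γ.playerLaw p t 0 : Measure X)| ≤ g * stateErr η ϑ K N t := by
    have h1 := abs_integral_stateLaw_sub_le (p := p) hη hϑ hK hP hp ht htT.le hh0
      -- the gap takes values in `[0, 2 * g]`
      (c := fun n => if n = 0 then 2 * g else 0) (fun n => by split_ifs <;> positivity)
      fun x n y z => by
        by_cases hn : n = 0
        · subst hn
          simp only [Function.update_self, if_true]
          exact abs_le.2 ⟨by linarith [(hhb y).1, (hhb z).2], by linarith [(hhb y).2, (hhb z).1]⟩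
        · simp [hn, Function.update_of_ne (Ne.symm hn)]
    rw [Finset.sum_ite_eq' Finset.univ (0 : Fin N) fun _ => 2 * g,
      if_pos (Finset.mem_univ _)] at h1
    have h2 : ∫ x, Γ.meanGap p V 0 t (x 0) ∂prodLaw (Γ.playerLaw p t) =
        ∫ x, Γ.meanGap p V 0 t x ∂(Γ.playerLaw p t 0 : Measure X) :=
      integral_comp_eval (μ := fun n => (Γ.playerLaw p t n : Measure X)) (i := 0)
        hh.1.aestronglyMeasurable
    rw [h2] at h1
    refine h1.trans ?_
    have h3 := two_mul_drift_add_rate_le ϑ hη K N ht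
    have h4 := rate_nonneg dist K N
    nlinarith
  rw [Γ.lawT_eq_integral p ht hd]
  refine (abs_sub_le _ _ _).trans ((add_le_add hA hB).trans_eq ?_)
  ring

/-- The regret of player `1` is close to the mean field regret of its own policy. Of the factor
`T + 1 - t` in `errRegret` only `1` is used. -/
theorem abs_regret_sub_le (hC₀ : 0 ≤ C₀) (hC₁ : 0 ≤ C₁) (hCb : 0 ≤ Cb) (hη : IsModulus η)
    (hζ : IsModulus ζ) (hϑ : IsModulus ϑ) (hι : IsModulus ι) (hK : Γ.MomentTight K)
    (hP : Γ.PCont η) (hG : Γ.GBasic C₀ C₁ Cb) (hGc : Γ.GCont C₀ C₁ ζ) (hV : IsBb V)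
    (hVι : SymCont ι V) (hp : SymContProfile Γ.T ϑ p) (hT : 1 ≤ Γ.T) :
    |Γ.regret Cb (toProfile p) (terminalN V) - ∑ t ∈ Finset.Ico 1 Γ.T, Cb ^ t *
        ∫ x, Γ.meanGap p V 0 t x ∂(Γ.playerLaw p t 0 : Measure X)| ≤
      regretErr Γ.T C₀ C₁ Cb (supNorm V) η ζ ϑ ι K N := by
  have hM := supNorm_nonneg V
  have he : ∀ s, 1 ≤ s → 0 ≤ stateErr η ϑ K N s := fun s hs => stateErr_nonneg hη N hs
  rw [regret, ← Finset.sum_sub_distrib, regretErr, errRegret, Finset.mul_sum, add_right_comm,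
    ← Finset.sum_add_distrib]
  refine (Finset.abs_sum_le_sum_abs _ _).trans (le_add_of_le_of_nonneg (Finset.sum_le_sum
    fun t ht => ?_) (mul_nonneg (pow_nonneg hCb _) (hull_nonneg (he _ hT))))
  obtain ⟨ht, htT⟩ := Finset.mem_Ico.1 ht
  have hB := errB_nonneg (T := Γ.T) hC₀ hC₁ hCb hM ζ ι he ht hT
  have hg := growth_nonneg hC₀ hC₁ (Γ.T - t) hM
  have hζ0 := hull_nonneg (β := ζ) (he t ht)
  have htT' : (1 : ℝ) ≤ (Γ.T : ℝ) + 1 - t := by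
    have : (t : ℝ) ≤ Γ.T := by exact_mod_cast htT.le
    linarith
  rw [← mul_sub, abs_mul, abs_of_nonneg (pow_nonneg hCb t)]
  calc _ ≤ Cb ^ t * _ := mul_le_mul_of_nonneg_left (abs_lawT_regret_sub_le hC₀ hC₁ hCb hη hζ hϑ hι
        hK hP hG hGc hV hVι hp ht htT) (pow_nonneg hCb t)
    _ ≤ Cb ^ t * (2 * (((Γ.T : ℝ) + 1 - t) *
          errB Γ.T C₀ C₁ Cb (supNorm V) ζ ι (stateErr η ϑ K N) t) +
        growth C₀ C₁ (Γ.T - t) (supNorm V) * (hull ζ (hull ϑ (stateErr η ϑ K N t)) +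
          hull ζ (stateErr η ϑ K N t) + stateErr η ϑ K N t)) := by
        refine mul_le_mul_of_nonneg_left (add_le_add ?_ ?_) (pow_nonneg hCb t)
        · nlinarith
        · exact mul_le_mul_of_nonneg_left (by linarith) hg
    _ = _ := by ring

end Values

end Game

/-! ### Disintegration and convexity in the action law -/

section Disintegration

variable {X B : Type*} [MeasurableSpace X] [MeasurableSpace B] [StandardBorelSpace B] [Nonempty B]

theorem joint_marg_induced (ψ : ProbabilityMeasure (X × B)) (ξ : ProbabilityMeasure X) :
    joint (marg ψ) ((induced ψ).freeze ξ) = ψ :=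
  ProbabilityMeasure.toMeasure_injective
    ((ψ : Measure (X × B)).disintegrate (ψ : Measure (X × B)).condKernel)

theorem integral_induced (ψ : ProbabilityMeasure (X × B)) (ξ : ProbabilityMeasure X)
    {f : X × B → ℝ} (hf : IsBb f) :
    ∫ x, ∫ b, f (x, b) ∂((induced ψ).1 (x, ξ) : Measure B) ∂(marg ψ : Measure X) =
      ∫ q, f q ∂(ψ : Measure (X × B)) := by
  conv_rhs => rw [← joint_marg_induced ψ ξ, integral_joint _ _ hf]
  rfl

theorem induced_ae_eq {ψ : ProbabilityMeasure (X × B)}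
    (κ : {κ : X → ProbabilityMeasure B // Measurable κ}) (h : joint (marg ψ) κ = ψ)
    (ξ : ProbabilityMeasure X) : ∀ᵐ x ∂(marg ψ : Measure X), (induced ψ).1 (x, ξ) = κ.1 x := by
  have h1 : (ψ : Measure (X × B)) = (ψ : Measure (X × B)).fst ⊗ₘ asKernel κ :=
    congrArg (fun ρ : ProbabilityMeasure (X × B) => (ρ : Measure (X × B))) h.symm
  filter_upwards [eq_condKernel_of_measure_eq_compProd (asKernel κ) h1] with x hx
  exact ProbabilityMeasure.toMeasure_injective hx.symm

end Disintegration

section Label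

variable {X : Type*} [MeasurableSpace X] {N : ℕ} [NeZero N]

/-- The joint law of a uniformly chosen label `n` and a state with law `μ n`. Its disintegration
over the state yields a measurable version of the posterior probabilities of the labels. -/
noncomputable def labelLaw (μ : Fin N → ProbabilityMeasure X) : ProbabilityMeasure (X × Fin N) :=
  avg fun n => joint (μ n) ⟨fun _ => ⟨Measure.dirac n, inferInstance⟩, measurable_const⟩

theorem integral_labelLaw (μ : Fin N → ProbabilityMeasure X) {f : X × Fin N → ℝ} (hf : IsBb f) :
    ∫ q, f q ∂(labelLaw μ : Measure (X × Fin N)) =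
      1 / (N : ℝ) * ∑ n, ∫ x, f (x, n) ∂(μ n : Measure X) := by
  rw [labelLaw, integral_avg _ hf]
  simp only [integral_joint _ _ hf, ProbabilityMeasure.coe_mk, integral_dirac]

theorem marg_labelLaw (μ : Fin N → ProbabilityMeasure X) : marg (labelLaw μ) = avg μ := by
  refine probabilityMeasure_ext_of_integral fun f hf => ?_
  rw [integral_marg _ hf, integral_labelLaw _ (hf.comp measurable_fst), integral_avg _ hf]

end Label

section Jensen

variable {A : Type*} [MeasurableSpace A]

/-- Jensen's inequality for finite mixtures, from convexity along segments. -/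
theorem le_sum_of_convComb {F : ProbabilityMeasure A → ℝ}
    (hF : ∀ (γ : Set.Icc (0 : ℝ) 1) l l', F (convComb γ l l') ≤ γ * F l + (1 - γ) * F l')
    {ι : Type*} (s : Finset ι) (m : ι → ProbabilityMeasure A) (a : ι → ℝ)
    (ha : ∀ i ∈ s, 0 ≤ a i) (hs : ∑ i ∈ s, a i = 1) (l : ProbabilityMeasure A)
    (hl : (l : Measure A) = ∑ i ∈ s, ENNReal.ofReal (a i) • (m i : Measure A)) :
    F l ≤ ∑ i ∈ s, a i * F (m i) := by
  classical
  induction s using Finset.induction_on generalizing a l with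
  | empty => simp at hs
  | insert j s hj ih =>
    have ha' : ∀ i ∈ s, 0 ≤ a i := fun i hi => ha i (Finset.mem_insert_of_mem hi)
    rw [Finset.sum_insert hj] at hs hl ⊢
    set b := ∑ i ∈ s, a i with hb
    have hj0 := ha j (Finset.mem_insert_self j s)
    rcases (Finset.sum_nonneg ha').eq_or_lt with h0 | h0
    · have hz := (Finset.sum_eq_zero_iff_of_nonneg ha').1 h0.symm
      have hj1 : a j = 1 := by rw [← hs, hb, ← h0, add_zero]
      have hl' : l = m j := ProbabilityMeasure.toMeasure_injective (by
        rw [hl, Finset.sum_eq_zero fun i hi => by rw [hz i hi]; simp, hj1]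
        simp)
      rw [Finset.sum_eq_zero fun i hi => by rw [hz i hi, zero_mul], hj1, hl']
      simp
    · have hb0 : 0 < b := h0
      have hbs : ∑ i ∈ s, a i / b = 1 := by rw [← Finset.sum_div, div_self hb0.ne']
      have hprob : IsProbabilityMeasure
          (∑ i ∈ s, ENNReal.ofReal (a i / b) • (m i : Measure A)) := ⟨by
        simp only [Measure.coe_finsetSum, Finset.sum_apply, Measure.smul_apply, measure_univ,
          smul_eq_mul, mul_one]
        rw [← ENNReal.ofReal_sum_of_nonneg fun i hi => div_nonneg (ha' i hi) hb0.le, hbs,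
          ENNReal.ofReal_one]⟩
      have h1 := ih (fun i => a i / b) (fun i hi => div_nonneg (ha' i hi) hb0.le) hbs ⟨_, hprob⟩ rfl
      -- split off the weight of `j` and renormalize the others
      have hl' : l = convComb ⟨a j, hj0, by linarith⟩ (m j) ⟨_, hprob⟩ :=
        ProbabilityMeasure.toMeasure_injective (by
          rw [hl]
          change _ = ENNReal.ofReal (a j) • (m j : Measure A) + ENNReal.ofReal (1 - a j) •
            ∑ i ∈ s, ENNReal.ofReal (a i / b) • (m i : Measure A)
          rw [Finset.smul_sum, show 1 - a j = b by linarith]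
          congr 1
          refine Finset.sum_congr rfl fun i hi => ?_
          rw [smul_smul, ← ENNReal.ofReal_mul hb0.le, mul_div_cancel₀ _ hb0.ne'])
      rw [hl']
      refine (hF _ _ _).trans (add_le_add le_rfl ?_)
      change (1 - a j) * _ ≤ _
      rw [show 1 - a j = b by linarith]
      refine (mul_le_mul_of_nonneg_left h1 hb0.le).trans_eq ?_
      rw [Finset.mul_sum]
      refine Finset.sum_congr rfl fun i hi => ?_
      field_simp

theorem mix_le_integral {F : ProbabilityMeasure A → ℝ}
    (hF : ∀ (γ : Set.Icc (0 : ℝ) 1) l l', F (convComb γ l l') ≤ γ * F l + (1 - γ) * F l')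
    {N : ℕ} (w : ProbabilityMeasure (Fin N))
    (m : {m : Fin N → ProbabilityMeasure A // Measurable m}) :
    F (mix w m) ≤ ∫ n, F (m.1 n) ∂(w : Measure (Fin N)) := by
  have h := le_sum_of_convComb hF Finset.univ m.1 (fun n => (w : Measure (Fin N)).real {n})
    (fun _ _ => measureReal_nonneg) (by
      rw [sum_measureReal_singleton, Finset.coe_univ, probReal_univ]) (mix w m) (by
        ext s hs
        change ((w : Measure (Fin N)).bind fun n => (m.1 n : Measure A)) s = _
        rw [Measure.bind_apply (f := fun n => (m.1 n : Measure A)) hs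
          (measurable_subtype_coe.comp m.2).aemeasurable, lintegral_fintype]
        simp [mul_comm])
  rw [integral_fintype (Integrable.of_finite)]
  simpa using h

end Jensen

/-! ### The regret of the mean field flow -/

namespace Game

section MeanRegret

variable {X A : Type*} [MeasurableSpace X] [MeasurableSpace A] [StandardBorelSpace A] [Nonempty A]
  {Γ : Game X A}

theorem meanLawT_eq_integral {M : ℕ → ProbabilityMeasure (X × A)} (hM : Γ.IsMeanFieldFlow M)
    {t : ℕ} (ht : 1 ≤ t) (htT : t < Γ.T) {h : X → ℝ} (hh : IsBb h) :
    Γ.meanLawT (fun s => induced (M s)) (fun s => marg (M s)) t h =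
      ∫ x, h x ∂(marg (M t) : Measure X) := by
  induction t, ht using Nat.le_induction generalizing h with
  | base => rw [hM.1]; rfl
  | succ t ht ih =>
    have hP : IsBb fun q : X × A => ∫ y, h y ∂(Γ.P t (q.1, marg (M t), q.2) : Measure X) :=
      isBb_integral_family (hh.comp measurable_snd) ((Γ.measurable_P t).comp
        (measurable_fst.prodMk (measurable_const.prodMk measurable_snd)))
    have hT : IsBb (Γ.meanT t (marg (M t)) (induced (M t)) h) :=
      isBb_integral_family (f := fun q : X × X => h q.2) (hh.comp measurable_snd)
        (Γ.measurable_Q t (marg (M t)) ((induced (M t)).freeze (marg (M t))))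
    have h1 : Γ.meanLawT (fun s => induced (M s)) (fun s => marg (M s)) (t + 1) h =
        Γ.meanLawT (fun s => induced (M s)) (fun s => marg (M s)) t
          (Γ.meanT t (marg (M t)) (induced (M t)) h) := by
      obtain ⟨k, rfl⟩ := Nat.exists_eq_add_of_le' ht
      simp only [meanLawT, Nat.add_sub_cancel]
      rw [compose_succ_right, Nat.add_comm 1 k]
    rw [h1, ih (by omega) hT, hM.2 t ht htT, Γ.integral_next t _ hh,
      ← integral_induced (M t) (marg (M t)) hP]
    simp only [meanT, Γ.integral_Q t _ _ _ hh]

end MeanRegret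

section Mixture

variable {X A : Type*} [MeasurableSpace X] [MeasurableSpace A] [StandardBorelSpace A] [Nonempty A]
  (Γ : Game X A) {N : ℕ} [NeZero N]

/-- The action law of the mean field at a state `x` is the average of the players' action laws
over the posterior distribution of the labels given `x`; a score that is convex in the action law
is therefore at most the average of the players' scores. -/
theorem integral_induced_le (p : Fin N → ℕ → SymKernel X A) (t : ℕ)
    {F : X × ProbabilityMeasure A → ℝ} (hF : IsBb F)
    (hconv : ∀ x (γ : Set.Icc (0 : ℝ) 1) l l',
      F (x, convComb γ l l') ≤ γ * F (x, l) + (1 - γ) * F (x, l')) :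
    ∫ x, F (x, (induced (Γ.psiBar p t)).1 (x, Γ.xiBar p t)) ∂(Γ.xiBar p t : Measure X) ≤
      1 / (N : ℝ) * ∑ n, ∫ x, F (x, (p n t).1 (x, Γ.xiBar p t))
        ∂(Γ.playerLaw p t n : Measure X) := by
  set ξ := Γ.xiBar p t with hξ
  let ρ := labelLaw (Γ.playerLaw p t)
  have hρ : marg ρ = ξ := marg_labelLaw _
  have hπ : Measurable fun q : X × Fin N => (p q.2 t).1 (q.1, ξ) :=
    measurable_from_prod_countable_left fun n => ((p n t).freeze ξ).2
  let m : X → {m : Fin N → ProbabilityMeasure A // Measurable m} := fun x =>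
    ⟨fun n => (p n t).1 (x, ξ), measurable_of_countable _⟩
  let w : X → ProbabilityMeasure (Fin N) := fun x => (induced ρ).1 (x, ξ)
  have hw : Measurable w := ((induced ρ).freeze ξ).2
  have hκ : Measurable fun x => mix (w x) (m x) := by
    refine Measurable.subtype_mk (Measure.measurable_of_measurable_coe _ fun s hs => ?_)
    have h : ∀ x, ((w x : Measure (Fin N)).bind fun n => ((m x).1 n : Measure A)) s =
        ∫⁻ n, ((m x).1 n : Measure A) s ∂asKernel ⟨w, hw⟩ x := fun x =>
      Measure.bind_apply hs (measurable_subtype_coe.comp (m x).2).aemeasurable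
    simp only [h]
    exact Measurable.lintegral_kernel_prod_right'
      (f := fun q : X × Fin N => ((p q.2 t).1 (q.1, ξ) : Measure A) s)
      ((Measure.measurable_coe hs).comp (measurable_subtype_coe.comp hπ))
  have hψ : marg (Γ.psiBar p t) = ξ := Γ.marg_psiBar p t
  have hjoint : joint (marg (Γ.psiBar p t)) ⟨_, hκ⟩ = Γ.psiBar p t := by
    refine probabilityMeasure_ext_of_integral fun f hf => ?_
    have hb : IsBb fun q : X × Fin N => ∫ a, f (q.1, a) ∂((p q.2 t).1 (q.1, ξ) : Measure A) :=
      isBb_integral_family (f := fun q : (X × Fin N) × A => f (q.1.1, q.2)) (hf.comp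
        ((measurable_fst.comp measurable_fst).prodMk measurable_snd)) hπ
    have h := integral_induced ρ ξ hb
    rw [hρ, integral_labelLaw _ hb] at h
    rw [hψ, integral_joint _ _ hf, Γ.integral_psiBar p t hf, ← h]
    refine integral_congr_ae (Eventually.of_forall fun x => ?_)
    exact integral_mix (w x) (m x) (hf.comp measurable_prodMk_left)
  have hFn : IsBb fun q : X × Fin N => F (q.1, (p q.2 t).1 (q.1, ξ)) :=
    hF.comp (measurable_fst.prodMk hπ)
  have hFκ : IsBb fun x => F (x, mix (w x) (m x)) := hF.comp (measurable_id.prodMk hκ)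
  have hFw : IsBb fun x => ∫ n, F (x, (p n t).1 (x, ξ)) ∂(w x : Measure (Fin N)) :=
    isBb_integral_family hFn hw
  calc _ = ∫ x, F (x, mix (w x) (m x)) ∂(ξ : Measure X) := by
        have hae := induced_ae_eq _ hjoint ξ
        rw [hψ] at hae
        refine integral_congr_ae ?_
        filter_upwards [hae] with x hx
        rw [hx]
    _ ≤ ∫ x, ∫ n, F (x, (p n t).1 (x, ξ)) ∂(w x : Measure (Fin N)) ∂(ξ : Measure X) :=
        integral_mono_isBb hFκ hFw fun x =>
          mix_le_integral (F := fun l => F (x, l)) (hconv x) (w x) (m x)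
    _ = ∫ q, F (q.1, (p q.2 t).1 (q.1, ξ)) ∂(ρ : Measure (X × Fin N)) := by
        rw [← integral_induced ρ ξ hFn, hρ]
    _ = _ := integral_labelLaw _ hFn

end Mixture

section Score

variable {X A : Type*} [MeasurableSpace X] [MeasurableSpace A] {Γ : Game X A} {C₀ C₁ Cb : ℝ}

theorem isBb_G (hG : Γ.GBasic C₀ C₁ Cb) {t : ℕ} (ht : 1 ≤ t) (htT : t < Γ.T)
    (ξ : ProbabilityMeasure X) {v : X → ℝ} (hv : IsBb v) :
    IsBb fun q : X × ProbabilityMeasure A => Γ.G t ξ q.2 v q.1 :=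
  ⟨(Γ.measurable_G t v ht htT hv).comp
    (measurable_fst.prodMk (measurable_const.prodMk measurable_snd)), _,
    fun q => hG.bound_G t ht htT ξ _ v hv q.1⟩

end Score

section Relabelling

variable {X A : Type*} [MeasurableSpace X] [MeasurableSpace A] (Γ : Game X A) {N : ℕ} [NeZero N]

theorem playerLaw_comp_perm (p : Fin N → ℕ → SymKernel X A) (σ : Equiv.Perm (Fin N)) (t : ℕ) :
    ∀ n, Γ.playerLaw (fun k => p (σ k)) t n = Γ.playerLaw p t (σ n) := by
  induction t with
  | zero => exact fun n => rfl
  | succ t ih =>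
    rcases Nat.eq_zero_or_pos t with rfl | ht
    · exact fun n => rfl
    · intro n
      have hξ : Γ.xiBar (fun k => p (σ k)) t = Γ.xiBar p t := by
        rw [xiBar, funext ih]
        exact avg_comp_equiv _ σ
      rw [Γ.playerLaw_succ _ ht, Γ.playerLaw_succ _ ht, ih n, hξ]

theorem xiBar_comp_perm (p : Fin N → ℕ → SymKernel X A) (σ : Equiv.Perm (Fin N)) :
    Γ.xiBar (fun k => p (σ k)) = Γ.xiBar p := by
  funext t
  rw [xiBar, funext (Γ.playerLaw_comp_perm p σ t)]
  exact avg_comp_equiv _ σ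

end Relabelling

section Average

variable {X A : Type*} [MetricSpace X] [MeasurableSpace X] [MetricSpace A] [CompactSpace A]
  [Nonempty A] [MeasurableSpace A] [BorelSpace A] {Γ : Game X A} {C₀ C₁ Cb : ℝ} {ζ : ℝ → ℝ} {N : ℕ}
  [NeZero N] {p : Fin N → ℕ → SymKernel X A} {V : X × ProbabilityMeasure X → ℝ}

theorem meanRegret_psiBar (hC₀ : 0 ≤ C₀) (hC₁ : 0 ≤ C₁) (hζ : IsModulus ζ)
    (hG : Γ.GBasic C₀ C₁ Cb) (hGc : Γ.GCont C₀ C₁ ζ) (hV : IsBb V) :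
    Γ.meanRegret Cb (Γ.psiBar p) V = ∑ t ∈ Finset.Ico 1 Γ.T, Cb ^ t *
      (∫ x, Γ.G t (Γ.xiBar p t) ((induced (Γ.psiBar p t)).1 (x, Γ.xiBar p t))
          (Γ.meanValue p V (t + 1)) x ∂(Γ.xiBar p t : Measure X) -
        ∫ x, Γ.meanValue p V t x ∂(Γ.xiBar p t : Measure X)) := by
  refine Finset.sum_congr rfl fun t ht => ?_
  obtain ⟨ht, htT⟩ := Finset.mem_Ico.1 ht
  have hterm : Γ.terminal (Γ.psiBar p) V = fun x => V (x, Γ.xiBar p Γ.T) := by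
    rw [show Γ.T = (Γ.T - 1) + 1 by omega, Γ.xiBar_succ p (by omega)]
    rfl
  obtain ⟨hv, -⟩ := meanValue_bound (p := p) hC₀ hC₁ hζ hG hGc hV (Nat.le_add_left 1 t) htT
  obtain ⟨hv', -⟩ := meanValue_bound (p := p) hC₀ hC₁ hζ hG hGc hV ht htT.le
  have hS := isBb_score hG ht htT (Γ.xiBar p t) hv
    ((induced (Γ.psiBar p t)).freeze (Γ.xiBar p t))
  have hm : (fun s => marg (Γ.psiBar p s)) = Γ.xiBar p := funext fun s => Γ.marg_psiBar p s
  have h1 := meanLawT_eq_integral (Γ.isMeanFieldFlow_psiBar p) ht htT (hS.sub hv')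
  rw [Γ.marg_psiBar p t, integral_sub (hS.integrable _) (hv'.integrable _)] at h1
  simp only [hm] at h1
  simp only [hterm, hm, Γ.marg_psiBar p t]
  exact congrArg _ h1

/-- The mean field regret of the policy of player `n`, the population being frozen at the average
flow of all players, and the state of player `n` moving by its own policy. -/
noncomputable def frozenRegret (Γ : Game X A) (Cb : ℝ) (p : Fin N → ℕ → SymKernel X A)
    (V : X × ProbabilityMeasure X → ℝ) (n : Fin N) : ℝ :=
  ∑ t ∈ Finset.Ico 1 Γ.T, Cb ^ t *
    ∫ x, Γ.meanGap p V n t x ∂(Γ.playerLaw p t n : Measure X)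

theorem average_frozenRegret (hC₀ : 0 ≤ C₀) (hC₁ : 0 ≤ C₁) (hζ : IsModulus ζ)
    (hG : Γ.GBasic C₀ C₁ Cb) (hGc : Γ.GCont C₀ C₁ ζ) (hV : IsBb V) :
    1 / (N : ℝ) * ∑ n, Γ.frozenRegret Cb p V n = ∑ t ∈ Finset.Ico 1 Γ.T, Cb ^ t *
      (1 / (N : ℝ) * ∑ n, ∫ x, Γ.G t (Γ.xiBar p t) ((p n t).1 (x, Γ.xiBar p t))
          (Γ.meanValue p V (t + 1)) x ∂(Γ.playerLaw p t n : Measure X) -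
        ∫ x, Γ.meanValue p V t x ∂(Γ.xiBar p t : Measure X)) := by
  simp only [frozenRegret]
  rw [Finset.sum_comm, Finset.mul_sum]
  refine Finset.sum_congr rfl fun t ht => ?_
  obtain ⟨ht, htT⟩ := Finset.mem_Ico.1 ht
  obtain ⟨hv, -⟩ := meanValue_bound (p := p) hC₀ hC₁ hζ hG hGc hV (Nat.le_add_left 1 t) htT
  obtain ⟨hv', -⟩ := meanValue_bound (p := p) hC₀ hC₁ hζ hG hGc hV ht htT.le
  have h : ∀ n, ∫ x, Γ.meanGap p V n t x ∂(Γ.playerLaw p t n : Measure X) =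
      ∫ x, Γ.G t (Γ.xiBar p t) ((p n t).1 (x, Γ.xiBar p t)) (Γ.meanValue p V (t + 1)) x
        ∂(Γ.playerLaw p t n : Measure X) -
      ∫ x, Γ.meanValue p V t x ∂(Γ.playerLaw p t n : Measure X) := fun n =>
    integral_sub ((isBb_score hG ht htT _ hv ((p n t).freeze (Γ.xiBar p t))).integrable _)
      (hv'.integrable _)
  simp only [h]
  rw [Γ.integral_xiBar p t hv', ← Finset.mul_sum, Finset.sum_sub_distrib]
  ring

theorem meanRegret_psiBar_le (hC₀ : 0 ≤ C₀) (hC₁ : 0 ≤ C₁) (hCb : 0 ≤ Cb) (hζ : IsModulus ζ)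
    (hG : Γ.GBasic C₀ C₁ Cb) (hGc : Γ.GCont C₀ C₁ ζ) (hV : IsBb V) :
    Γ.meanRegret Cb (Γ.psiBar p) V ≤ 1 / (N : ℝ) * ∑ n, Γ.frozenRegret Cb p V n := by
  rw [meanRegret_psiBar hC₀ hC₁ hζ hG hGc hV, average_frozenRegret hC₀ hC₁ hζ hG hGc hV]
  refine Finset.sum_le_sum fun t ht => mul_le_mul_of_nonneg_left (sub_le_sub_right ?_ _)
    (pow_nonneg hCb t)
  obtain ⟨ht, htT⟩ := Finset.mem_Ico.1 ht
  obtain ⟨hv, -⟩ := meanValue_bound (p := p) hC₀ hC₁ hζ hG hGc hV (Nat.le_add_left 1 t) htT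
  exact Γ.integral_induced_le p t (isBb_G hG ht htT (Γ.xiBar p t) hv)
    fun x γ l l' => hG.convex t ht htT _ γ l l' _ hv x

theorem meanRegret_psiBar_eq (hC₀ : 0 ≤ C₀) (hC₁ : 0 ≤ C₁) (hζ : IsModulus ζ)
    (hG : Γ.GBasic C₀ C₁ Cb) (hGc : Γ.GCont C₀ C₁ ζ) (hV : IsBb V) (hA : Γ.AffineInAction) :
    Γ.meanRegret Cb (Γ.psiBar p) V = 1 / (N : ℝ) * ∑ n, Γ.frozenRegret Cb p V n := by
  rw [meanRegret_psiBar hC₀ hC₁ hζ hG hGc hV, average_frozenRegret hC₀ hC₁ hζ hG hGc hV]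
  refine Finset.sum_congr rfl fun t ht => ?_
  obtain ⟨ht, htT⟩ := Finset.mem_Ico.1 ht
  obtain ⟨hv, -⟩ := meanValue_bound (p := p) hC₀ hC₁ hζ hG hGc hV (Nat.le_add_left 1 t) htT
  have hF := isBb_G hG ht htT (Γ.xiBar p t) hv
  have h1 := Γ.integral_induced_le p t hF fun x γ l l' => (hA t ht htT _ γ l l' _ hv x).le
  -- an affine score and its negative are both convex
  have h2 := Γ.integral_induced_le p t (hF.const_mul (-1)) fun x γ l l' => by
    simp only [hA t ht htT _ γ l l' _ hv x]
    exact le_of_eq (by ring)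
  simp only [integral_const_mul, ← Finset.mul_sum] at h2
  have h3 := le_antisymm h1 (by linarith)
  rw [h3]

end Average

section Comparison

variable {X A : Type*} [MetricSpace X] [SecondCountableTopology X] [MeasurableSpace X]
  [BorelSpace X] [MetricSpace A] [CompactSpace A] [Nonempty A] [MeasurableSpace A] [BorelSpace A]
  {Γ : Game X A} {C₀ C₁ Cb : ℝ} {η ζ ϑ ι : ℝ → ℝ} {K : ℕ → Set X} {N : ℕ} [NeZero N]
  {p : Fin N → ℕ → SymKernel X A} {V : X × ProbabilityMeasure X → ℝ}

/-- A relabelling of the players leaves the mean field flow unchanged, so the comparison for player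
`1` applies to every player. -/
theorem abs_regretOf_sub_le (hC₀ : 0 ≤ C₀) (hC₁ : 0 ≤ C₁) (hCb : 0 ≤ Cb) (hη : IsModulus η)
    (hζ : IsModulus ζ) (hϑ : IsModulus ϑ) (hι : IsModulus ι) (hK : Γ.MomentTight K)
    (hP : Γ.PCont η) (hG : Γ.GBasic C₀ C₁ Cb) (hGc : Γ.GCont C₀ C₁ ζ) (hV : IsBb V)
    (hVι : SymCont ι V) (hp : SymContProfile Γ.T ϑ p) (hT : 1 ≤ Γ.T) (n : Fin N) :
    |Γ.regretOf Cb p (terminalN V) n - Γ.frozenRegret Cb p V n| ≤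
      regretErr Γ.T C₀ C₁ Cb (supNorm V) η ζ ϑ ι K N := by
  have h := abs_regret_sub_le (p := fun k => p ((Fin.cycleRange n).symm k)) hC₀ hC₁ hCb hη hζ hϑ hι
    hK hP hG hGc hV hVι (fun k => hp _) hT
  have e : ∀ t, ∫ x, Γ.meanGap (fun k => p ((Fin.cycleRange n).symm k)) V 0 t x
        ∂(Γ.playerLaw (fun k => p ((Fin.cycleRange n).symm k)) t 0 : Measure X) =
      ∫ x, Γ.meanGap p V n t x ∂(Γ.playerLaw p t n : Measure X) := fun t => by
    rw [Γ.playerLaw_comp_perm p, Fin.cycleRange_symm_zero]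
    simp only [meanGap, meanValue, Γ.xiBar_comp_perm p, Fin.cycleRange_symm_zero]
  simp only [e] at h
  exact h

theorem abs_average_regretOf_sub_le (hC₀ : 0 ≤ C₀) (hC₁ : 0 ≤ C₁) (hCb : 0 ≤ Cb)
    (hη : IsModulus η) (hζ : IsModulus ζ) (hϑ : IsModulus ϑ) (hι : IsModulus ι)
    (hK : Γ.MomentTight K) (hP : Γ.PCont η) (hG : Γ.GBasic C₀ C₁ Cb) (hGc : Γ.GCont C₀ C₁ ζ)
    (hV : IsBb V) (hVι : SymCont ι V) (hp : SymContProfile Γ.T ϑ p) (hT : 1 ≤ Γ.T) :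
    |1 / (N : ℝ) * ∑ n, Γ.regretOf Cb p (terminalN V) n -
        1 / (N : ℝ) * ∑ n, Γ.frozenRegret Cb p V n| ≤
      regretErr Γ.T C₀ C₁ Cb (supNorm V) η ζ ϑ ι K N := by
  have hN := natCast_pos (N := N)
  rw [← mul_sub, ← Finset.sum_sub_distrib, abs_mul, abs_of_pos (one_div_pos.2 hN)]
  refine (mul_le_mul_of_nonneg_left ((Finset.abs_sum_le_sum_abs _ _).trans (Finset.sum_le_sum
    fun n _ => abs_regretOf_sub_le hC₀ hC₁ hCb hη hζ hϑ hι hK hP hG hGc hV hVι hp hT n))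
    (one_div_pos.2 hN).le).trans_eq ?_
  rw [Finset.sum_const, Finset.card_univ, Fintype.card_fin, nsmul_eq_mul, ← mul_assoc,
    one_div_mul_cancel hN.ne', one_mul]

end Comparison

end Game

end MFG

theorem theorem3p2 {X A : Type*}
    [MetricSpace X] [CompleteSpace X] [SecondCountableTopology X]
    [MeasurableSpace X] [BorelSpace X]
    [MetricSpace A] [CompactSpace A] [Nonempty A] [MeasurableSpace A] [BorelSpace A]
    (Γ : MFG.Game X A) (hT : 1 ≤ Γ.T)
    (K : ℕ → Set X) (C₀ C₁ Cb : ℝ) (hC₀ : 0 < C₀) (hC₁ : 0 < C₁) (hCb : 0 < Cb)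
    (η ζ ϑ ι : ℝ → ℝ) (hη : MFG.IsModulus η) (hζ : MFG.IsModulus ζ)
    (hϑ : MFG.IsModulus ϑ) (hι : MFG.IsModulus ι)
    (hK : Γ.MomentTight K) (hG : Γ.GBasic C₀ C₁ Cb) (hP : Γ.PCont η) (hGc : Γ.GCont C₀ C₁ ζ)
    (V : X × ProbabilityMeasure X → ℝ) (hV : MFG.IsBb V) (hVι : MFG.SymCont ι V) :
    -- the error terms vanish as the number of players grows
    (∀ t, 1 ≤ t → t ≤ Γ.T → Tendsto (fun N => MFG.stateErr η ϑ K N t) atTop (𝓝 0)) ∧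
    (∀ t, 1 ≤ t → t < Γ.T →
      Tendsto (fun N => MFG.stateActionErr A η ϑ K N t) atTop (𝓝 0)) ∧
    Tendsto (fun N => MFG.regretErr Γ.T C₀ C₁ Cb (MFG.supNorm V) η ζ ϑ ι K N) atTop (𝓝 0) ∧
    ∀ (N : ℕ) [NeZero N], 2 ≤ N →
      ∀ p : Fin N → ℕ → MFG.SymKernel X A, MFG.SymContProfile Γ.T ϑ p →
        Γ.IsMeanFieldFlow (Γ.psiBar p) ∧
        -- (a)
        (∀ t, 1 ≤ t → t < Γ.T →
          Γ.lawT (MFG.toProfile p) t (Γ.empError p t) ≤ MFG.stateActionErr A η ϑ K N t) ∧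
        -- (b)
        Γ.meanRegret Cb (Γ.psiBar p) V
          ≤ 1 / (N : ℝ) * ∑ n, Γ.regretOf Cb p (MFG.terminalN V) n
            + MFG.regretErr Γ.T C₀ C₁ Cb (MFG.supNorm V) η ζ ϑ ι K N ∧
        -- (c)
        (Γ.AffineInAction →
          |Γ.meanRegret Cb (Γ.psiBar p) V
              - 1 / (N : ℝ) * ∑ n, Γ.regretOf Cb p (MFG.terminalN V) n|
            ≤ MFG.regretErr Γ.T C₀ C₁ Cb (MFG.supNorm V) η ζ ϑ ι K N) := by
  refine ⟨fun t ht _ => MFG.tendsto_stateErr hη hϑ ht,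
    fun t ht _ => MFG.tendsto_stateActionErr A hη hϑ ht,
    MFG.tendsto_regretErr hη hϑ hζ hι C₀ C₁ Cb _ hT, fun N _ _ p hp => ⟨Γ.isMeanFieldFlow_psiBar p,
      fun t ht htT => MFG.Game.lawT_empError_le hη hϑ hK hP hp ht htT, ?_, fun hA => ?_⟩⟩
  · have h1 := MFG.Game.meanRegret_psiBar_le (p := p) hC₀.le hC₁.le hCb.le hζ hG hGc hV
    have h2 := MFG.Game.abs_average_regretOf_sub_le hC₀.le hC₁.le hCb.le hη hζ hϑ hι hK hP hG hGc
      hV hVι hp hT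
    linarith [(abs_le.1 h2).1]
  · rw [MFG.Game.meanRegret_psiBar_eq hC₀.le hC₁.le hζ hG hGc hV hA, abs_sub_comm]
    exact MFG.Game.abs_average_regretOf_sub_le hC₀.le hC₁.le hCb.le hη hζ hϑ hι hK hP hG hGc
      hV hVι hp hT
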